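/- **Theorem (Recovery Guarantee I).** There is an absolute constant $C>0$ such that for all $\kappa_1,\kappa_2\ge 0$ with $\kappa_1\kappa_2<1/3$ there is $\varepsilon_{cg}=\varepsilon_{cg}(\kappa_1,\kappa_2)>0$ for which the following holds. *Setting.* Let $n,r\ge 1$ and let $X\in\mathbb{R}^{n\times n}$ be a rank $r$ matrix with reduced SVD $X=U\Sigma V^*$, largest and smallest nonzero singular values $\sigma_{\max}=\|X\|$ and $\sigma_{\min}$, and condition number $\kappa=\sigma_{\max}/\sigma_{\min}$. Assume that, for all $i,j$, $$\|UU^*e_i\|\le\sqrt{\mu_0r/n},\qquad \|VV^*e_j\|\le\sqrt{\mu_0r/n},\qquad |X_{ij}|\le\mu_1\sqrt{r/n^2}\,\|X\| .$$ Let $\Omega$ consist of $m\le n^2$ indices drawn independently and uniformly from $\{1,\dots,n\}^2$ with replacement, let $p=m/n^2\ (\le 1)$, and let $\mathcal P_\Omega(Z)$ be the matrix whose entry $(i,j)$ is $Z_{ij}$ times the number of occurrences of $(i,j)$ in $\Omega$. The operator $\mathcal H_r$ replaces all but the $r$ largest singular values in an SVD by zero (any SVD may be used if it is not unique). $\langle\cdot,\cdot\rangle$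 and $\|\cdot\|_F$ are the Frobenius inner product and norm, and quotients with zero denominator are read as $0$. *Algorithms.* Both start from $X_0=\mathcal H_r(p^{-1}\mathcal P_\Omega(X))$. At step $l$ write $X_l=U_l\Sigma_lV_l^*$ with $U_l,V_l\in\mathbb{R}^{n\times r}$ having orthonormal columns, let $T_l=\{U_lZ_1^*+Z_2V_l^*\}$, with orthogonal projection $\mathcal P_{T_l}$, and $G_l=\mathcal P_\Omega(X-X_l)$. * Riemannian gradient descent (RGrad): $X_{l+1}=\mathcal H_r(X_l+\alpha_l\mathcal P_{T_l}(G_l))$ with $\alpha_l=\dfrac{\|\mathcal P_{T_l}(G_l)\|_F^2}{\langle\mathcal P_{T_l}(G_l),\mathcal P_\Omega\mathcal P_{T_l}(G_l)\rangle}$. * Restarted Riemannian conjugate gradient (RCG): with $P_{-1}=0$, put $P_l=\mathcal P_{T_l}(G_l)+\beta_l\mathcal P_{T_l}(P_{l-1})$ and $X_{l+1}=\mathcal H_r(X_l+\alpha_lP_l)$, where $\alpha_l=\dfrac{\langle\mathcal P_{T_l}(G_l),\mathcal P_{T_l}(P_l)\rangle}{\langle\mathcal P_{T_l}(P_l),\mathcal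 P_\Omega\mathcal P_{T_l}(P_l)\rangle}$, and $\beta_l=-\dfrac{\langle\mathcal P_{T_l}(G_l),\mathcal P_\Omega\mathcal P_{T_l}(P_{l-1})\rangle}{\langle\mathcal P_{T_l}(P_{l-1}),\mathcal P_\Omega\mathcal P_{T_l}(P_{l-1})\rangle}$ if $$\frac{|\langle\mathcal P_{T_l}(G_l),\mathcal P_{T_l}(P_{l-1})\rangle|}{\|\mathcal P_{T_l}(G_l)\|_F\|\mathcal P_{T_l}(P_{l-1})\|_F}\le\kappa_1\quad\text{and}\quad\|\mathcal P_{T_l}(G_l)\|_F\le\kappa_2\|\mathcal P_{T_l}(P_{l-1})\|_F ,$$ while $\beta_l=0$ (restart) if either inequality is violated. *Conclusion.* Let $\varepsilon_0>0$ and $\beta>1$, and suppose $$m\ \ge\ C\,\beta^{3/2}\max\Big\{\frac{\mu_0}{\varepsilon_0^2},\frac{\mu_1(1+\varepsilon_0)}{\varepsilon_0}\Big\}\,\kappa\,n^{3/2}\,r\,\log^{3/2}(n).$$ 1. If $4\varepsilon_0<1$ and $\dfrac{18\varepsilon_0}{1-4\varepsilon_0}<1$, then with probability at least $1-3n^{2-2\beta}-2n^{1-\beta}$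 the iterates of RGrad converge to $X$. 2. If $\varepsilon_0\le\varepsilon_{cg}(\kappa_1,\kappa_2)$, or if $(1-4\varepsilon_0)-\kappa_1(1+4\varepsilon_0)>0$ and $\tau_1+\tau_2<1$, where $$\tau_1=\frac{18\varepsilon_0-10\kappa_1\varepsilon_0(1+4\varepsilon_0)}{(1-4\varepsilon_0)-\kappa_1(1+4\varepsilon_0)}+\frac{4\kappa_2\varepsilon_0+\kappa_1\kappa_2}{1-4\varepsilon_0},\qquad\tau_2=\frac{8\kappa_2\varepsilon_0+2\kappa_1\kappa_2}{1-4\varepsilon_0},$$ then with probability at least $1-3n^{2-2\beta}-2n^{1-\beta}$ the iterates of RGrad and those of restarted RCG both converge to $X$. -/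

import Mathlib

open scoped Matrix
open Filter Topology MeasureTheory ProbabilityTheory

noncomputable section

namespace MatrixCompletion

variable {n m r : ℕ}

/-! ### Matrices, singular value decompositions -/

/-- The Frobenius inner product `⟨A, B⟩ = ∑ᵢⱼ Aᵢⱼ Bᵢⱼ`. -/
def frobInner (A B : Matrix (Fin n) (Fin n) ℝ) : ℝ := ∑ i, ∑ j, A i j * B i j

/-- The Frobenius norm. -/
def frobNorm (A : Matrix (Fin n) (Fin n) ℝ) : ℝ := Real.sqrt (frobInner A A)

/-- `Z = P diag(s) Qᵀ` is a (full) singular value decomposition, with the singular values in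
decreasing order. -/
structure IsSVD (Z P : Matrix (Fin n) (Fin n) ℝ) (s : Fin n → ℝ)
    (Q : Matrix (Fin n) (Fin n) ℝ) : Prop where
  left_orthogonal : Pᵀ * P = 1
  right_orthogonal : Qᵀ * Q = 1
  antitone : Antitone s
  nonneg : ∀ i, 0 ≤ s i
  eq : Z = P * Matrix.diagonal s * Qᵀ

/-- Every matrix has an SVD. -/
theorem exists_isSVD (Z : Matrix (Fin n) (Fin n) ℝ) : ∃ P s Q, IsSVD Z P s Q := by
  let T : EuclideanSpace ℝ (Fin n) →ₗ[ℝ] EuclideanSpace ℝ (Fin n) := Matrix.toEuclideanLin Z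
  have hT := T.isSymmetric_adjoint_comp_self
  have hn : Module.finrank ℝ (EuclideanSpace ℝ (Fin n)) = n := by simp
  let v := hT.eigenvectorBasis hn
  let s : Fin n → ℝ := fun i => T.singularValues i
  have hs : ∀ i, hT.eigenvalues hn i = s i ^ 2 := fun i => (T.sq_singularValues_fin hn i).symm
  have hs0 : ∀ i, 0 ≤ s i := fun i => T.singularValues_nonneg i
  have hin : ∀ i j, inner ℝ (T (v i)) (T (v j)) = if i = j then s i ^ 2 else 0 := by
    intro i j
    rw [← LinearMap.adjoint_inner_right]
    have h1 : T.adjoint (T (v j)) = (s j ^ 2) • v j := by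
      have := hT.apply_eigenvectorBasis hn j
      rw [hs j] at this
      exact this
    rw [h1, inner_smul_right, v.inner_eq_ite]
    by_cases h : i = j <;> simp [h]
  obtain ⟨u, hu⟩ : ∃ u : OrthonormalBasis (Fin n) ℝ (EuclideanSpace ℝ (Fin n)),
      ∀ i ∈ {i | s i ≠ 0}, u i = (s i)⁻¹ • T (v i) := by
    refine Orthonormal.exists_orthonormalBasis_extension_of_card_eq
      (v := fun i => (s i)⁻¹ • T (v i)) (by simp) ?_
    rw [orthonormal_iff_ite]
    rintro ⟨i, hi⟩ ⟨j, hj⟩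
    simp only [Set.mem_ofPred_eq] at hi hj
    simp only [Set.domRestrict_apply, inner_smul_left, inner_smul_right, hin, Subtype.mk.injEq]
    by_cases h : i = j
    · subst h; simp; field_simp
    · simp [h]
  have hTv : ∀ i, T (v i) = s i • u i := by
    intro i
    by_cases h : s i = 0
    · have := hin i i
      rw [if_pos rfl, h] at this
      simpa [h] using this
    · rw [hu i h, smul_smul, mul_inv_cancel₀ h, one_smul]
  have horth : ∀ w : OrthonormalBasis (Fin n) ℝ (EuclideanSpace ℝ (Fin n)),
      (Matrix.of fun a i => w i a)ᵀ * (Matrix.of fun a i => w i a) = 1 := by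
    intro w
    ext i j
    have := w.inner_eq_ite i j
    simp only [PiLp.inner_apply, RCLike.inner_apply, conj_trivial] at this
    simp only [Matrix.mul_apply, Matrix.transpose_apply, Matrix.of_apply, Matrix.one_apply]
    rw [← this]
    exact Finset.sum_congr rfl fun _ _ => mul_comm _ _
  refine ⟨Matrix.of fun a i => u i a, s, Matrix.of fun a i => v i a, horth u, horth v,
    fun i j h => T.singularValues_antitone h, hs0, ?_⟩
  have hQ : (Matrix.of fun a i => v i a) * (Matrix.of fun a i => v i a)ᵀ = 1 :=
    mul_eq_one_comm.mp (horth v)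
  have hZ : Z * (Matrix.of fun a i => v i a) =
      (Matrix.of fun a i => u i a) * Matrix.diagonal s := by
    ext a i
    have := congrArg (fun x : EuclideanSpace ℝ (Fin n) => x a) (hTv i)
    rw [Matrix.mul_diagonal]
    simp only [T, Matrix.toLpLin_apply, Matrix.mulVec, dotProduct, PiLp.smul_apply,
      smul_eq_mul] at this
    simp only [Matrix.mul_apply, Matrix.of_apply]
    rw [this, mul_comm]
  rw [← hZ, Matrix.mul_assoc, hQ, Matrix.mul_one]

/-- `Z = U diag(s) Vᵀ` with `U`, `V` having `r` orthonormal columns and `s ≥ 0`.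
When `Z` has rank `r`, all `s i` are positive and this is the reduced SVD of `Z`. -/
structure IsThinSVD (Z : Matrix (Fin n) (Fin n) ℝ) (U : Matrix (Fin n) (Fin r) ℝ)
    (s : Fin r → ℝ) (V : Matrix (Fin n) (Fin r) ℝ) : Prop where
  left_orthonormal : Uᵀ * U = 1
  right_orthonormal : Vᵀ * V = 1
  nonneg : ∀ i, 0 ≤ s i
  eq : Z = U * Matrix.diagonal s * Vᵀ

/-- `Y` is a value of the hard thresholding operator `H_r` at `Z`: all but the `r` largest
singular values in some SVD of `Z` are set to zero. (If there is a tie between the `r`-th and the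
`(r+1)`-st singular value, then `H_r(Z)` depends on the chosen SVD, and every choice is allowed.) -/
def IsHardThreshold (r : ℕ) (Z Y : Matrix (Fin n) (Fin n) ℝ) : Prop :=
  ∃ (P : Matrix (Fin n) (Fin n) ℝ) (s : Fin n → ℝ) (Q : Matrix (Fin n) (Fin n) ℝ),
    IsSVD Z P s Q ∧
      Y = P * Matrix.diagonal (fun i : Fin n => if (i : ℕ) < r then s i else 0) * Qᵀ

/-- The orthogonal projection onto the tangent space `T = {U Z₁ᵀ + Z₂ Vᵀ}`, for `U`, `V` with
orthonormal columns. -/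
def tangentProj (U V : Matrix (Fin n) (Fin r) ℝ) (Z : Matrix (Fin n) (Fin n) ℝ) :
    Matrix (Fin n) (Fin n) ℝ :=
  U * Uᵀ * Z + Z * (V * Vᵀ) - U * Uᵀ * Z * (V * Vᵀ)

/-! ### Sampling with replacement -/

/-- The law of `m` indices drawn independently and uniformly from `{1,…,n} × {1,…,n}`. -/
def samplingLaw (n m : ℕ) : Measure (Fin m → Fin n × Fin n) :=
  Measure.pi fun _ => uniformOn (Set.univ : Set (Fin n × Fin n))

/-- The sampling operator `P_Ω`: the entry `(i,j)` is multiplied by the number of times that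
`(i,j)` occurs in the sample. -/
def sample (ω : Fin m → Fin n × Fin n) (Z : Matrix (Fin n) (Fin n) ℝ) :
    Matrix (Fin n) (Fin n) ℝ :=
  Matrix.of fun i j => ((Finset.univ.filter fun k => ω k = (i, j)).card : ℝ) * Z i j

/-- `X₀ = H_r(p⁻¹ P_Ω(X))` with `p = m / n²`. -/
def IsOneStepInit (r : ℕ) (ω : Fin m → Fin n × Fin n) (X X₀ : Matrix (Fin n) (Fin n) ℝ) : Prop :=
  IsHardThreshold r (((m : ℝ) / (n : ℝ) ^ 2)⁻¹ • sample ω X) X₀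

/-! ### The algorithms -/

/-- The tangent gradient `P_T(G)`, `G = P_Ω(X - Y)`, where `T` is the tangent space at `Y`
given by the factors `U`, `V` of `Y`. -/
def tangentGrad (ω : Fin m → Fin n × Fin n) (X Y : Matrix (Fin n) (Fin n) ℝ)
    (U V : Matrix (Fin n) (Fin r) ℝ) : Matrix (Fin n) (Fin n) ℝ :=
  tangentProj U V (sample ω (X - Y))

/-- The exact line search stepsize `⟨G, D⟩ / ⟨D, P_Ω D⟩` (zero if the denominator vanishes). -/
def stepsize (ω : Fin m → Fin n × Fin n) (G D : Matrix (Fin n) (Fin n) ℝ) : ℝ :=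
  frobInner G D / frobInner D (sample ω D)

/-- `Y 0, Y 1, …` are iterates of Riemannian gradient descent for `X` with the sample `ω`,
initialised by one step hard thresholding. -/
structure IsRGradRun (r : ℕ) (ω : Fin m → Fin n × Fin n) (X : Matrix (Fin n) (Fin n) ℝ)
    (Y : ℕ → Matrix (Fin n) (Fin n) ℝ) : Prop where
  init : IsOneStepInit r ω X (Y 0)
  step : ∀ l, ∃ (U V : Matrix (Fin n) (Fin r) ℝ) (s : Fin r → ℝ), IsThinSVD (Y l) U s V ∧
    ∃ G, G = tangentGrad ω X (Y l) U V ∧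
      IsHardThreshold r (Y l + stepsize ω G G • G) (Y (l + 1))

/-- The two inequalities whose violation makes the conjugate gradient method restart;
`G = P_T(G_l)` and `Q = P_T(P_{l-1})`. -/
def KeepsDirection (κ₁ κ₂ : ℝ) (G Q : Matrix (Fin n) (Fin n) ℝ) : Prop :=
  |frobInner G Q| / (frobNorm G * frobNorm Q) ≤ κ₁ ∧ frobNorm G ≤ κ₂ * frobNorm Q

open Classical in
/-- The orthogonalization weight `β_l` of the restarted conjugate gradient method. -/
def restartedWeight (κ₁ κ₂ : ℝ) (ω : Fin m → Fin n × Fin n) (G Q : Matrix (Fin n) (Fin n) ℝ) : ℝ :=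
  if KeepsDirection κ₁ κ₂ G Q then -(frobInner G (sample ω Q) / frobInner Q (sample ω Q)) else 0

/-- `Y 0, Y 1, …` are iterates of the restarted Riemannian conjugate gradient descent for `X` with
the sample `ω`, initialised by one step hard thresholding. Here `D l` is the search direction
`P_{l-1}`, so that `D 0 = P_{-1} = 0` (which also makes the weight irrelevant for `l = 0`). -/
structure IsRCGRun (κ₁ κ₂ : ℝ) (r : ℕ) (ω : Fin m → Fin n × Fin n)
    (X : Matrix (Fin n) (Fin n) ℝ) (Y : ℕ → Matrix (Fin n) (Fin n) ℝ)
    (D : ℕ → Matrix (Fin n) (Fin n) ℝ) : Prop where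
  init : IsOneStepInit r ω X (Y 0)
  init_dir : D 0 = 0
  step : ∀ l, ∃ (U V : Matrix (Fin n) (Fin r) ℝ) (s : Fin r → ℝ), IsThinSVD (Y l) U s V ∧
    ∃ G Q, G = tangentGrad ω X (Y l) U V ∧ Q = tangentProj U V (D l) ∧
      D (l + 1) = G + restartedWeight κ₁ κ₂ ω G Q • Q ∧
      IsHardThreshold r
        (Y l + stepsize ω G (tangentProj U V (D (l + 1))) • D (l + 1)) (Y (l + 1))

/-- For the sample `ω`, Riemannian gradient descent converges to `X`
(whichever SVDs are used in the hard thresholdings). -/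
def RGradConverges (r : ℕ) (X : Matrix (Fin n) (Fin n) ℝ) (ω : Fin m → Fin n × Fin n) : Prop :=
  ∀ Y, IsRGradRun r ω X Y → Tendsto Y atTop (𝓝 X)

/-- For the sample `ω`, the restarted Riemannian conjugate gradient descent converges to `X`
(whichever SVDs are used in the hard thresholdings). -/
def RCGConverges (κ₁ κ₂ : ℝ) (r : ℕ) (X : Matrix (Fin n) (Fin n) ℝ)
    (ω : Fin m → Fin n × Fin n) : Prop :=
  ∀ Y D, IsRCGRun κ₁ κ₂ r ω X Y D → Tendsto Y atTop (𝓝 X)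

/-! ### The measured matrix -/

/-- The largest singular value `‖X‖`, from the singular values of a reduced SVD. -/
def sigmaMax (σ : Fin r → ℝ) : ℝ := ⨆ i, σ i

/-- The smallest nonzero singular value, from the singular values of a reduced SVD. -/
def sigmaMin (σ : Fin r → ℝ) : ℝ := ⨅ i, σ i

/-- The condition number `κ`. -/
def condNumber (σ : Fin r → ℝ) : ℝ := sigmaMax σ / sigmaMin σ

/-- `X` is a rank `r` matrix with reduced SVD `X = U diag(σ) Vᵀ`, is `μ₀`-incoherent, and is not
too spiky (with parameter `μ₁`). -/
structure IsMeasuredMatrix (X : Matrix (Fin n) (Fin n) ℝ) (U : Matrix (Fin n) (Fin r) ℝ)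
    (σ : Fin r → ℝ) (V : Matrix (Fin n) (Fin r) ℝ) (μ₀ μ₁ : ℝ) : Prop where
  svd : IsThinSVD X U σ V
  pos : ∀ i, 0 < σ i
  incoherent_left : ∀ i, ‖WithLp.toLp 2 ((U * Uᵀ) *ᵥ Pi.single i (1 : ℝ))‖ ≤ √(μ₀ * r / n)
  incoherent_right : ∀ j, ‖WithLp.toLp 2 ((V * Vᵀ) *ᵥ Pi.single j (1 : ℝ))‖ ≤ √(μ₀ * r / n)
  not_spiky : ∀ i j, |X i j| ≤ μ₁ * √(r / (n : ℝ) ^ 2) * sigmaMax σ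

/-! ### The radius parameter -/

/-- The condition on `ε₀` for Riemannian gradient descent: `ν_g = 18ε₀/(1-4ε₀) < 1`. -/
def RGradRadius (ε₀ : ℝ) : Prop :=
  0 < 1 - 4 * ε₀ ∧ 18 * ε₀ / (1 - 4 * ε₀) < 1

/-- `τ₁` -/
def tau₁ (κ₁ κ₂ ε₀ : ℝ) : ℝ :=
  (18 * ε₀ - 10 * κ₁ * ε₀ * (1 + 4 * ε₀)) / ((1 - 4 * ε₀) - κ₁ * (1 + 4 * ε₀)) +
    (4 * κ₂ * ε₀ + κ₁ * κ₂) / (1 - 4 * ε₀)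

/-- `τ₂` -/
def tau₂ (κ₁ κ₂ ε₀ : ℝ) : ℝ := (8 * κ₂ * ε₀ + 2 * κ₁ * κ₂) / (1 - 4 * ε₀)

/-- The condition on `ε₀` for restarted conjugate gradient descent: `τ₁ + τ₂ < 1`, where the
denominators are positive. -/
def RCGRadius (κ₁ κ₂ ε₀ : ℝ) : Prop :=
  0 < (1 - 4 * ε₀) - κ₁ * (1 + 4 * ε₀) ∧ tau₁ κ₁ κ₂ ε₀ + tau₂ κ₁ κ₂ ε₀ < 1

end MatrixCompletion

end

open MatrixCompletion

namespace MatrixCompletion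

/-! ### The Golden–Thompson inequality -/

section LieProduct

variable {𝔸 : Type*} [NormedRing 𝔸]

/-! The argument separates a deterministic part from a probabilistic one; `IsGoodSample` is the
interface between them.

Deterministic part. Let `p` be the sampling density, `c` the smallest singular value of `X`, and `L`
a bound for the multiplicities. On the tangent space `T` at `X` the form `⟨Z, P_Ω W⟩` is close to
`p⟨Z, W⟩`. On arbitrary matrices only the bound `L` is available. If an iterate `Y` satisfies `‖Y -
X‖ √L ≤ a c √p`, its tangent space is tilted against `T` by an angle of order `‖Y - X‖ / c`, so even
the crude bound `√L` keeps the error of order `a √p`, and near isometry passes to the tangent space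
at `Y` (`IsGoodSample.nearIsometry`). No incoherence of the iterates is needed. Moreover `X` leaves
the tangent space at `Y` only to second order, so `p⁻¹ P_T P_Ω (X - Y)` is close to `X - Y`
(`IsGoodSample.frobNorm_grad_sub_le`). Exact line search behaves like the stepsize `p⁻¹`, and hard
thresholding at most doubles the distance to `X`. This gives a linear contraction for gradient
descent. For conjugate gradients the old direction adds a term of size about `3 κ₁ κ₂` times the
error before last, whence the condition `κ₁ κ₂ < 1/3`; the resulting two-term recursion contracts.

Probabilistic part. A matrix Bernstein inequality, proved by the Ahlswede–Winter method from
Golden–Thompson, is applied twice: to the rank-one matrices of the projected matrix units (near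
isometry on `T`), and to the symmetric dilations of the sampled entries (spectral bound for `P_Ω X -
p X`). The spectral bound makes the hard-thresholded initial guess accurate in Frobenius norm, at
the cost of a factor `√r`. A Chernoff bound controls the multiplicities. Requiring the initial error
to be below `a c √(p / L)` is what forces a sample size of order `n^(3/2)`. -/

theorem norm_pow_sub_pow_le [NormOneClass 𝔸] (x y : 𝔸) {c : ℝ} (hx : ‖x‖ ≤ c) (hy : ‖y‖ ≤ c)
    (k : ℕ) : ‖x ^ (k + 1) - y ^ (k + 1)‖ ≤ (k + 1) * c ^ k * ‖x - y‖ := by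
  have hc : 0 ≤ c := (norm_nonneg _).trans hx
  induction k with
  | zero => simp
  | succ k ih =>
    have h : x ^ (k + 1 + 1) - y ^ (k + 1 + 1) =
        x ^ (k + 1) * (x - y) + (x ^ (k + 1) - y ^ (k + 1)) * y := by
      rw [pow_succ x (k + 1), pow_succ y (k + 1)]; noncomm_ring
    rw [h]
    have h1 : ‖x ^ (k + 1) * (x - y)‖ ≤ c ^ (k + 1) * ‖x - y‖ :=
      (norm_mul_le _ _).trans (mul_le_mul_of_nonneg_right
        ((norm_pow_le _ _).trans (pow_le_pow_left₀ (norm_nonneg _) hx _)) (norm_nonneg _))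
    have h2 : ‖(x ^ (k + 1) - y ^ (k + 1)) * y‖ ≤ (k + 1) * c ^ k * ‖x - y‖ * c :=
      (norm_mul_le _ _).trans (mul_le_mul ih hy (norm_nonneg _) (by positivity))
    refine (norm_add_le _ _).trans ((add_le_add h1 h2).trans_eq ?_)
    push_cast; ring

variable [NormedAlgebra ℝ 𝔸]

theorem norm_exp_le_exp_norm [NormOneClass 𝔸] [CompleteSpace 𝔸] (x : 𝔸) :
    ‖NormedSpace.exp x‖ ≤ Real.exp ‖x‖ := by
  have h := NormedSpace.exp_series_hasSum_exp' (𝕂 := ℝ) x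
  have h' := NormedSpace.exp_series_hasSum_exp' (𝕂 := ℝ) ‖x‖
  rw [← Real.exp_eq_exp_ℝ] at h'
  rw [← h.tsum_eq]
  refine tsum_of_norm_bounded h' fun k => ?_
  rw [norm_smul, Real.norm_of_nonneg (by positivity), smul_eq_mul]
  exact mul_le_mul_of_nonneg_left (norm_pow_le _ _) (by positivity)

/-- The Lie product formula. -/
theorem tendsto_exp_mul_exp_pow [NormOneClass 𝔸] [CompleteSpace 𝔸] (a b : 𝔸) :
    Tendsto (fun k : ℕ => (NormedSpace.exp ((1 / ((k : ℝ) + 1)) • a) *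
      NormedSpace.exp ((1 / ((k : ℝ) + 1)) • b)) ^ (k + 1)) atTop
      (𝓝 (NormedSpace.exp (a + b))) := by
  let : NormedAlgebra ℚ 𝔸 := NormedAlgebra.restrictScalars ℚ ℝ 𝔸
  -- The defect of multiplicativity has derivative `a + b - (a + b) = 0` at the origin, so `(k + 1)
  -- ‖f (1 / (k + 1))‖` tends to zero; this beats the factor `k + 1` lost in comparing the powers.
  let f : ℝ → 𝔸 := fun t => NormedSpace.exp (t • a) * NormedSpace.exp (t • b) -
    NormedSpace.exp (t • (a + b))
  have hf : HasDerivAt f 0 0 := by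
    have ha := hasDerivAt_exp_smul_const (𝕂 := ℝ) a (0 : ℝ)
    have hb := hasDerivAt_exp_smul_const (𝕂 := ℝ) b (0 : ℝ)
    have hab := hasDerivAt_exp_smul_const (𝕂 := ℝ) (a + b) (0 : ℝ)
    have := (ha.mul hb).sub hab
    simp only [zero_smul, NormedSpace.exp_zero, one_mul, mul_one, sub_self] at this
    exact this
  have hlim : Tendsto (fun k : ℕ => ((k : ℝ) + 1) * ‖f (1 / ((k : ℝ) + 1))‖) atTop (𝓝 0) := by
    have h0 : f 0 = 0 := by simp [f, NormedSpace.exp_zero]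
    have h1 := hasDerivAt_iff_tendsto.mp hf
    have h2 := h1.comp (tendsto_one_div_add_atTop_nhds_zero_nat (𝕜 := ℝ))
    refine h2.congr fun k => ?_
    have hk : (0 : ℝ) < (k : ℝ) + 1 := by positivity
    simp only [Function.comp, h0, sub_zero, smul_zero]
    rw [Real.norm_of_nonneg (by positivity), one_div, inv_inv]
  have key : ∀ k : ℕ, ‖(NormedSpace.exp ((1 / ((k : ℝ) + 1)) • a) *
      NormedSpace.exp ((1 / ((k : ℝ) + 1)) • b)) ^ (k + 1) - NormedSpace.exp (a + b)‖ ≤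
      Real.exp (‖a‖ + ‖b‖) * (((k : ℝ) + 1) * ‖f (1 / ((k : ℝ) + 1))‖) := by
    intro k
    have hk : (0 : ℝ) < (k : ℝ) + 1 := by positivity
    set t : ℝ := 1 / ((k : ℝ) + 1) with ht
    have ht0 : 0 ≤ t := by positivity
    have htk : ((k : ℝ) + 1) * t = 1 := by rw [ht]; field_simp
    have e1 : NormedSpace.exp (a + b) = (NormedSpace.exp (t • (a + b))) ^ (k + 1) := by
      rw [← NormedSpace.exp_nsmul, ← Nat.cast_smul_eq_nsmul ℝ, smul_smul]
      push_cast; rw [htk, one_smul]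
    have hn : ∀ z : 𝔸, ‖t • z‖ = t * ‖z‖ := fun z => by
      rw [norm_smul, Real.norm_of_nonneg ht0]
    have hx : ‖NormedSpace.exp (t • a) * NormedSpace.exp (t • b)‖ ≤
        Real.exp (t * (‖a‖ + ‖b‖)) := by
      refine (norm_mul_le _ _).trans ?_
      rw [mul_add, Real.exp_add, ← hn, ← hn]
      exact mul_le_mul (norm_exp_le_exp_norm _) (norm_exp_le_exp_norm _) (norm_nonneg _)
        (Real.exp_pos _).le
    have hy : ‖NormedSpace.exp (t • (a + b))‖ ≤ Real.exp (t * (‖a‖ + ‖b‖)) := by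
      refine (norm_exp_le_exp_norm _).trans (Real.exp_le_exp.mpr ?_)
      rw [hn]
      exact mul_le_mul_of_nonneg_left (norm_add_le _ _) ht0
    rw [e1]
    refine (norm_pow_sub_pow_le _ _ hx hy k).trans ?_
    have hpow : Real.exp (t * (‖a‖ + ‖b‖)) ^ k ≤ Real.exp (‖a‖ + ‖b‖) := by
      rw [← Real.exp_nat_mul]
      refine Real.exp_le_exp.mpr ?_
      have : (k : ℝ) * t ≤ 1 := by nlinarith
      nlinarith [norm_nonneg a, norm_nonneg b]
    calc ((k : ℝ) + 1) * Real.exp (t * (‖a‖ + ‖b‖)) ^ k * ‖f t‖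
        ≤ ((k : ℝ) + 1) * Real.exp (‖a‖ + ‖b‖) * ‖f t‖ := by gcongr
      _ = _ := by ring
  rw [tendsto_iff_norm_sub_tendsto_zero]
  refine squeeze_zero (fun _ => norm_nonneg _) key ?_
  simpa using hlim.const_mul (Real.exp (‖a‖ + ‖b‖))

end LieProduct

/-! ### Trace inequalities for dyadic powers, and Golden–Thompson. -/

section GoldenThompson

variable {ι : Type*} [Fintype ι]

theorem trace_transpose_mul_self_nonneg (M : Matrix ι ι ℝ) : 0 ≤ (Mᵀ * M).trace := by
  simp only [Matrix.trace, Matrix.diag, Matrix.mul_apply, Matrix.transpose_apply]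
  exact Finset.sum_nonneg fun _ _ => Finset.sum_nonneg fun _ _ => mul_self_nonneg _

theorem two_mul_trace_mul_le (M N : Matrix ι ι ℝ) :
    2 * (M * N).trace ≤ (M * Mᵀ).trace + (N * Nᵀ).trace := by
  have h := trace_transpose_mul_self_nonneg (Mᵀ - N)
  have e1 : (Nᵀ * Mᵀ).trace = (M * N).trace := by
    rw [← Matrix.transpose_mul, Matrix.trace_transpose]
  have e2 : (Nᵀ * N).trace = (N * Nᵀ).trace := Matrix.trace_mul_comm _ _
  simp only [Matrix.transpose_sub, Matrix.transpose_transpose, Matrix.sub_mul, Matrix.mul_sub,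
    Matrix.trace_sub] at h
  linarith

variable [DecidableEq ι]

theorem trace_mul_pow_comm (M N : Matrix ι ι ℝ) (k : ℕ) :
    ((M * N) ^ k).trace = ((N * M) ^ k).trace := by
  cases k with
  | zero => simp
  | succ k =>
    have h : ∀ k : ℕ, (M * N) ^ k * M = M * (N * M) ^ k := by
      intro k
      induction k with
      | zero => simp
      | succ k ih => rw [pow_succ', pow_succ', Matrix.mul_assoc, ih]; simp only [Matrix.mul_assoc]
    rw [pow_succ, ← Matrix.mul_assoc, h, Matrix.trace_mul_comm, pow_succ']
    simp only [Matrix.mul_assoc]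

/-- The trace inequalities `tr M^(2^(j+1)) ≤ tr (M Mᵀ)^(2^j)` and, for symmetric `P`, `Q`,
`tr (P Q)^(2^j) ≤ tr P^(2^j) Q^(2^j)`. -/
theorem trace_pow_two_pow_le (j : ℕ) :
    (∀ M : Matrix ι ι ℝ, (M ^ 2 ^ (j + 1)).trace ≤ ((M * Mᵀ) ^ 2 ^ j).trace) ∧
    (∀ P Q : Matrix ι ι ℝ, Pᵀ = P → Qᵀ = Q →
      ((P * Q) ^ 2 ^ j).trace ≤ (P ^ 2 ^ j * Q ^ 2 ^ j).trace) := by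
  induction j with
  | zero =>
    refine ⟨fun M => ?_, fun P Q _ _ => by simp⟩
    have := two_mul_trace_mul_le M M
    simp only [zero_add, pow_one, pow_zero]
    rw [pow_two]; linarith
  | succ j ih =>
    have hPQ : ∀ P Q : Matrix ι ι ℝ, Pᵀ = P → Qᵀ = Q →
        ((P * Q) ^ 2 ^ (j + 1)).trace ≤ (P ^ 2 ^ (j + 1) * Q ^ 2 ^ (j + 1)).trace := by
      intro P Q hP hQ
      -- The first inequality leads to `P Q² P`; cyclicity turns it into `Q² P²`, to which the
      -- second inequality applies with the symmetric factors `Q²` and `P²`.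
      refine (ih.1 (P * Q)).trans ?_
      have e : P * Q * (P * Q)ᵀ = P * (Q * Q * P) := by
        rw [Matrix.transpose_mul, hP, hQ]; simp only [Matrix.mul_assoc]
      rw [e, trace_mul_pow_comm, Matrix.mul_assoc, Matrix.trace_mul_comm (P ^ _),
        show ∀ Z : Matrix ι ι ℝ, Z ^ 2 ^ (j + 1) = (Z * Z) ^ 2 ^ j from fun Z => by
          rw [← pow_two, ← pow_mul, pow_succ']]
      rw [show P ^ 2 ^ (j + 1) = (P * P) ^ 2 ^ j by rw [← pow_two, ← pow_mul, pow_succ']]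
      refine ih.2 (Q * Q) (P * P) ?_ ?_ <;> simp [Matrix.transpose_mul, hP, hQ]
    refine ⟨fun M => ?_, hPQ⟩
    have e0 : M ^ 2 ^ (j + 1 + 1) = (M * M) ^ 2 ^ (j + 1) := by
      rw [← pow_two, ← pow_mul, pow_succ' 2 (j + 1)]
    have e1 : M * M * (M * M)ᵀ = M * (M * Mᵀ * Mᵀ) := by
      rw [Matrix.transpose_mul]; simp only [Matrix.mul_assoc]
    rw [e0]
    refine (ih.1 (M * M)).trans ?_
    rw [e1, trace_mul_pow_comm, Matrix.mul_assoc]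
    have hs1 : (M * Mᵀ)ᵀ = M * Mᵀ := by simp [Matrix.transpose_mul]
    have hs2 : (Mᵀ * M)ᵀ = Mᵀ * M := by simp [Matrix.transpose_mul]
    refine (ih.2 _ _ hs1 hs2).trans ?_
    -- The two squares on the right have equal trace by cyclicity, so the arithmetic mean collapses
    -- to a single term.
    have h := two_mul_trace_mul_le ((M * Mᵀ) ^ 2 ^ j) ((Mᵀ * M) ^ 2 ^ j)
    rw [Matrix.transpose_pow, Matrix.transpose_pow, hs1, hs2, ← pow_two, ← pow_two, ← pow_mul,
      ← pow_mul, ← pow_succ, trace_mul_pow_comm Mᵀ M] at h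
    linarith

attribute [local instance] Matrix.linftyOpNormedRing Matrix.linftyOpNormedAlgebra

theorem exp_transpose_of_symm {A : Matrix ι ι ℝ} (hA : Aᵀ = A) :
    (NormedSpace.exp A)ᵀ = NormedSpace.exp A := by
  rw [← Matrix.exp_transpose, hA]

/-- The Golden–Thompson inequality. -/
theorem trace_exp_add_le {A B : Matrix ι ι ℝ} (hA : Aᵀ = A) (hB : Bᵀ = B) :
    (NormedSpace.exp (A + B)).trace ≤ (NormedSpace.exp A * NormedSpace.exp B).trace := by
  cases isEmpty_or_nonempty ι
  · simp [Matrix.trace]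
  have hc : Continuous (fun M : Matrix ι ι ℝ => M.trace) := continuous_id.matrix_trace
  -- The Lie formula is indexed by the exponent `k + 1`, so the dyadic exponents `2 ^ j` are its
  -- terms at `k = 2 ^ j - 1`.
  have hsub : Tendsto (fun j : ℕ => 2 ^ j - 1) atTop atTop := by
    refine tendsto_atTop_mono (fun j => ?_) tendsto_id
    have := Nat.lt_two_pow_self (n := j)
    simp only [id]; omega
  have hlim := (hc.tendsto _).comp ((tendsto_exp_mul_exp_pow A B).comp hsub)
  refine le_of_tendsto hlim (Eventually.of_forall fun j => ?_)
  simp only [Function.comp]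
  have h1 : (2 ^ j - 1) + 1 = 2 ^ j := Nat.sub_add_cancel Nat.one_le_two_pow
  have h2 : ((2 ^ j - 1 : ℕ) : ℝ) + 1 = 2 ^ j := by exact_mod_cast h1
  rw [h1, h2]
  have hp : ∀ Z : Matrix ι ι ℝ,
      NormedSpace.exp ((1 / (2 : ℝ) ^ j) • Z) ^ 2 ^ j = NormedSpace.exp Z := by
    intro Z
    rw [← Matrix.exp_nsmul, ← Nat.cast_smul_eq_nsmul ℝ, smul_smul]
    push_cast
    rw [mul_one_div_cancel (by positivity), one_smul]
  have := (trace_pow_two_pow_le j).2 (NormedSpace.exp ((1 / (2 : ℝ) ^ j) • A))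
    (NormedSpace.exp ((1 / (2 : ℝ) ^ j) • B))
    (exp_transpose_of_symm (by rw [Matrix.transpose_smul, hA]))
    (exp_transpose_of_symm (by rw [Matrix.transpose_smul, hB]))
  rwa [hp, hp] at this

end GoldenThompson

end MatrixCompletion

namespace MatrixCompletion

/-! ### The matrix Bernstein inequality -/

section Bernstein

variable {ι : Type*} [Fintype ι] [DecidableEq ι]

theorem exists_orthogonal_diagonalization {H : Matrix ι ι ℝ} (hH : Hᵀ = H) :
    ∃ (Q : Matrix ι ι ℝ) (d : ι → ℝ), Qᵀ * Q = 1 ∧ Q * Qᵀ = 1 ∧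
      H = Q * Matrix.diagonal d * Qᵀ := by
  have hh : H.IsHermitian := by
    rw [Matrix.IsHermitian, Matrix.conjTranspose_eq_transpose_of_trivial, hH]
  refine ⟨hh.eigenvectorUnitary, hh.eigenvalues, ?_, ?_, ?_⟩
  · have := Unitary.coe_star_mul_self hh.eigenvectorUnitary
    rwa [Matrix.star_eq_conjTranspose, Matrix.conjTranspose_eq_transpose_of_trivial] at this
  · have := Unitary.coe_mul_star_self hh.eigenvectorUnitary
    rwa [Unitary.coe_star, Matrix.star_eq_conjTranspose, Matrix.conjTranspose_eq_transpose_of_trivial] at this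
  · have := hh.spectral_theorem
    rw [Unitary.conjStarAlgAut_apply, Matrix.star_eq_conjTranspose,
      Matrix.conjTranspose_eq_transpose_of_trivial] at this
    simpa using this

theorem exp_orthogonal_conj_diagonal {Q : Matrix ι ι ℝ} (h1 : Qᵀ * Q = 1) (h2 : Q * Qᵀ = 1)
    (d : ι → ℝ) : NormedSpace.exp (Q * Matrix.diagonal d * Qᵀ) =
      Q * Matrix.diagonal (fun i => Real.exp (d i)) * Qᵀ := by
  let U : (Matrix ι ι ℝ)ˣ := ⟨Q, Qᵀ, h2, h1⟩
  have h := Matrix.exp_units_conj U (Matrix.diagonal d)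
  rw [Matrix.exp_diagonal, Pi.exp_def] at h
  simpa [U, Real.exp_eq_exp_ℝ] using h

theorem dotProduct_conj_diagonal_mulVec (Q : Matrix ι ι ℝ) (d x : ι → ℝ) :
    x ⬝ᵥ ((Q * Matrix.diagonal d * Qᵀ) *ᵥ x) = ∑ i, d i * (Qᵀ *ᵥ x) i ^ 2 := by
  rw [← Matrix.mulVec_mulVec, ← Matrix.mulVec_mulVec, Matrix.dotProduct_mulVec,
    ← Matrix.mulVec_transpose]
  simp only [dotProduct, Matrix.mulVec_diagonal]
  exact Finset.sum_congr rfl fun i _ => by ring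

theorem dotProduct_self_eq_sum {Q : Matrix ι ι ℝ} (h2 : Q * Qᵀ = 1) (x : ι → ℝ) :
    x ⬝ᵥ x = ∑ i, (Qᵀ *ᵥ x) i ^ 2 := by
  have h := dotProduct_conj_diagonal_mulVec Q 1 x
  have e : Matrix.diagonal (1 : ι → ℝ) = 1 := Matrix.diagonal_one
  rw [e, Matrix.mul_one, h2, Matrix.one_mulVec] at h
  simpa using h

/-- The columns of `Q` are unit eigenvectors; testing a quadratic-form bound on them turns it into a
bound on the eigenvalues. -/
theorem eigenvalue_eq_dotProduct {Q : Matrix ι ι ℝ} (h1 : Qᵀ * Q = 1) (d : ι → ℝ) (i : ι) :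
    (Q *ᵥ Pi.single i 1) ⬝ᵥ ((Q * Matrix.diagonal d * Qᵀ) *ᵥ (Q *ᵥ Pi.single i 1)) = d i ∧
      (Q *ᵥ Pi.single i 1) ⬝ᵥ (Q *ᵥ Pi.single i (1 : ℝ)) = 1 := by
  have h3 : ∀ j, (Qᵀ *ᵥ (Q *ᵥ Pi.single i 1)) j = (Pi.single i 1 : ι → ℝ) j := fun j => by
    rw [Matrix.mulVec_mulVec, h1, Matrix.one_mulVec]
  constructor
  · rw [dotProduct_conj_diagonal_mulVec]
    simp only [h3]
    simp [Pi.single_apply]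
  · rw [dotProduct_self_eq_sum (mul_eq_one_comm.mp h1)]
    simp only [h3]
    simp [Pi.single_apply]

theorem exp_le_one_add_add_sq {x : ℝ} (h1 : -1 ≤ x) (h2 : x ≤ 1) :
    Real.exp x ≤ 1 + x + x ^ 2 := by
  have := Real.abs_exp_sub_one_sub_id_le (abs_le.mpr ⟨h1, h2⟩)
  linarith [(abs_le.mp this).2]

/-- `exp H ≤ 1 + H + H²` for a symmetric matrix with `-1 ≤ H ≤ 1`. -/
theorem dotProduct_exp_mulVec_le {H : Matrix ι ι ℝ} (hH : Hᵀ = H)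
    (hu : ∀ x, x ⬝ᵥ (H *ᵥ x) ≤ x ⬝ᵥ x) (hl : ∀ x, -(x ⬝ᵥ x) ≤ x ⬝ᵥ (H *ᵥ x)) (x : ι → ℝ) :
    x ⬝ᵥ (NormedSpace.exp H *ᵥ x) ≤ x ⬝ᵥ x + x ⬝ᵥ (H *ᵥ x) + (H *ᵥ x) ⬝ᵥ (H *ᵥ x) := by
  obtain ⟨Q, d, h1, h2, rfl⟩ := exists_orthogonal_diagonalization hH
  have hsq : ((Q * Matrix.diagonal d * Qᵀ) *ᵥ x) ⬝ᵥ ((Q * Matrix.diagonal d * Qᵀ) *ᵥ x) =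
      ∑ i, d i ^ 2 * (Qᵀ *ᵥ x) i ^ 2 := by
    rw [dotProduct_self_eq_sum h2, Matrix.mulVec_mulVec, ← Matrix.mul_assoc, ← Matrix.mul_assoc,
      h1, Matrix.one_mul, ← Matrix.mulVec_mulVec]
    simp only [Matrix.mulVec_diagonal]
    exact Finset.sum_congr rfl fun i _ => by ring
  rw [exp_orthogonal_conj_diagonal h1 h2, hsq, dotProduct_conj_diagonal_mulVec,
    dotProduct_conj_diagonal_mulVec, dotProduct_self_eq_sum h2, ← Finset.sum_add_distrib,
    ← Finset.sum_add_distrib]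
  refine Finset.sum_le_sum fun i _ => ?_
  obtain ⟨e1, e2⟩ := eigenvalue_eq_dotProduct h1 d i
  have hd1 := hu (Q *ᵥ Pi.single i 1)
  have hd2 := hl (Q *ᵥ Pi.single i 1)
  rw [e1, e2] at hd1 hd2
  have := exp_le_one_add_add_sq hd2 hd1
  nlinarith [sq_nonneg ((Qᵀ *ᵥ x) i)]

/-- In an eigenbasis of `S` the trace is a sum of diagonal values of the form of `M` with the
positive weights `exp (d i)`. This lets Loewner inequalities be paired with `exp S`. -/
theorem trace_exp_mul_nonneg {S M : Matrix ι ι ℝ} (hS : Sᵀ = S)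
    (hM : ∀ x, 0 ≤ x ⬝ᵥ (M *ᵥ x)) : 0 ≤ (NormedSpace.exp S * M).trace := by
  obtain ⟨Q, d, h1, h2, rfl⟩ := exists_orthogonal_diagonalization hS
  rw [exp_orthogonal_conj_diagonal h1 h2, Matrix.mul_assoc, Matrix.mul_assoc,
    Matrix.trace_mul_comm, Matrix.mul_assoc]
  refine Finset.sum_nonneg fun i _ => ?_
  rw [Matrix.diag_apply, Matrix.diagonal_mul]
  refine mul_nonneg (Real.exp_pos _).le ?_
  have h := hM (Q *ᵥ Pi.single i 1)
  have e : (Qᵀ * M * Q) i i = Pi.single i 1 ⬝ᵥ ((Qᵀ * M * Q) *ᵥ Pi.single i 1) := by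
    simp
  rw [e, ← Matrix.mulVec_mulVec, ← Matrix.mulVec_mulVec, Matrix.dotProduct_mulVec,
    Matrix.vecMul_transpose]
  exact h

/-- The trace dominates each single `exp (d i)`, hence every eigenvalue is below `t`. This is the
matrix form of the exponential Markov step. -/
theorem dotProduct_mulVec_le_of_trace_exp_lt {S : Matrix ι ι ℝ} (hS : Sᵀ = S) {t : ℝ}
    (h : (NormedSpace.exp S).trace < Real.exp t) (x : ι → ℝ) :
    x ⬝ᵥ (S *ᵥ x) ≤ t * (x ⬝ᵥ x) := by
  obtain ⟨Q, d, h1, h2, rfl⟩ := exists_orthogonal_diagonalization hS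
  rw [exp_orthogonal_conj_diagonal h1 h2, Matrix.trace_mul_comm, ← Matrix.mul_assoc, h1,
    Matrix.one_mul, Matrix.trace_diagonal] at h
  rw [dotProduct_conj_diagonal_mulVec, dotProduct_self_eq_sum h2, Finset.mul_sum]
  refine Finset.sum_le_sum fun i _ => mul_le_mul_of_nonneg_right ?_ (sq_nonneg _)
  have := Finset.single_le_sum (f := fun i => Real.exp (d i)) (fun i _ => (Real.exp_pos _).le)
    (Finset.mem_univ i)
  exact Real.exp_le_exp.mp (this.trans h.le)

/-! ### Trace exponentials of sums of independent matrices. -/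

variable {α : Type*} [Fintype α]

/-- The Ahlswede–Winter bound for the trace of the exponential of a sum of independent, uniformly
sampled symmetric matrices. -/
theorem sum_trace_exp_sum_le {Y : α → Matrix ι ι ℝ} (hY : ∀ a, (Y a)ᵀ = Y a) {c : ℝ}
    (hc : 0 ≤ c) (hexp : ∀ x, ∑ a, x ⬝ᵥ (NormedSpace.exp (Y a) *ᵥ x) ≤ c * (x ⬝ᵥ x)) (m : ℕ) :
    ∑ ω : Fin m → α, (NormedSpace.exp (∑ k, Y (ω k))).trace ≤ Fintype.card ι * c ^ m := by
  induction m with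
  | zero => simp
  | succ m ih =>
    have hsum : ∀ ω : Fin m → α, (∑ k, Y (ω k))ᵀ = ∑ k, Y (ω k) := fun ω => by
      rw [Matrix.transpose_sum]; exact Finset.sum_congr rfl fun _ _ => hY _
    rw [← (Fin.consEquiv fun _ => α).sum_comp, Fintype.sum_prod_type_right]
    have hstep : ∀ ω : Fin m → α, ∑ a, (NormedSpace.exp
        (∑ k, Y ((Fin.consEquiv fun _ => α) (a, ω) k))).trace ≤
        c * (NormedSpace.exp (∑ k, Y (ω k))).trace := by
      intro ω
      set S := ∑ k, Y (ω k) with hS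
      have h1 : ∀ a, (NormedSpace.exp (∑ k, Y ((Fin.consEquiv fun _ => α) (a, ω) k))).trace ≤
          (NormedSpace.exp S * NormedSpace.exp (Y a)).trace := by
        intro a
        rw [Fin.sum_univ_succ]
        simp only [Fin.consEquiv, Equiv.coe_fn_mk, Fin.cons_zero, Fin.cons_succ]
        rw [add_comm]
        exact trace_exp_add_le (hsum ω) (hY a)
      refine (Finset.sum_le_sum fun a _ => h1 a).trans ?_
      -- Golden–Thompson has split off one sample; summing over its values leaves the matrix `∑ exp
      -- (Y a)`, which is at most `c` times the identity, and the positive factor `exp S` preserves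
      -- this under the trace.
      have h2 := trace_exp_mul_nonneg (hsum ω)
        (M := c • (1 : Matrix ι ι ℝ) - ∑ a, NormedSpace.exp (Y a)) (fun x => by
          rw [Matrix.sub_mulVec, Matrix.smul_mulVec, Matrix.one_mulVec, dotProduct_sub,
            dotProduct_smul, Matrix.sum_mulVec, dotProduct_sum, smul_eq_mul]
          linarith [hexp x])
      rw [Matrix.mul_sub, Matrix.mul_smul, Matrix.mul_one, Matrix.trace_sub, Matrix.trace_smul,
        Matrix.mul_sum, Matrix.trace_sum, smul_eq_mul] at h2
      linarith
    refine (Finset.sum_le_sum fun ω _ => hstep ω).trans ?_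
    rw [← Finset.mul_sum, pow_succ]
    nlinarith

open Classical in
/-- The matrix Bernstein inequality for sampling with replacement. -/
theorem card_bernstein_le {Y : α → Matrix ι ι ℝ} (hY : ∀ a, (Y a)ᵀ = Y a) {R v θ t : ℝ}
    (hθ : 0 ≤ θ) (hθR : θ * R ≤ 1)
    (hu : ∀ a x, x ⬝ᵥ (Y a *ᵥ x) ≤ R * (x ⬝ᵥ x)) (hl : ∀ a x, -(R * (x ⬝ᵥ x)) ≤ x ⬝ᵥ (Y a *ᵥ x))
    (hmean : ∀ x, ∑ a, x ⬝ᵥ (Y a *ᵥ x) = 0)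
    (hvar : ∀ x, ∑ a, (Y a *ᵥ x) ⬝ᵥ (Y a *ᵥ x) ≤ Fintype.card α * v * (x ⬝ᵥ x)) (m : ℕ) :
    ((Finset.univ.filter fun ω : Fin m → α =>
      ¬ ∀ x, x ⬝ᵥ ((∑ k, Y (ω k)) *ᵥ x) ≤ t * (x ⬝ᵥ x)).card : ℝ) ≤
      Fintype.card ι * Real.exp (-(θ * t) + θ ^ 2 * m * v) * (Fintype.card α : ℝ) ^ m := by
  have hdot : ∀ x : ι → ℝ, 0 ≤ x ⬝ᵥ x := fun x => Finset.sum_nonneg fun _ _ => mul_self_nonneg _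
  -- For `θ = 0` the right side is at least the number of all samples, or there are no coordinates;
  -- the main argument cancels `θ` and needs it positive.
  rcases hθ.eq_or_lt with rfl | hθ0
  · have h1 : ((Finset.univ.filter fun ω : Fin m → α =>
        ¬ ∀ x, x ⬝ᵥ ((∑ k, Y (ω k)) *ᵥ x) ≤ t * (x ⬝ᵥ x)).card : ℝ) ≤
        (Fintype.card α : ℝ) ^ m := by
      have := Finset.card_le_univ (Finset.univ.filter fun ω : Fin m → α =>
        ¬ ∀ x, x ⬝ᵥ ((∑ k, Y (ω k)) *ᵥ x) ≤ t * (x ⬝ᵥ x))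
      simp only [Fintype.card_fun, Fintype.card_fin] at this
      exact_mod_cast this
    cases isEmpty_or_nonempty ι
    · simp
    · have h2 : (1 : ℝ) ≤ Fintype.card ι := by exact_mod_cast Fintype.card_pos
      have h3 : (0 : ℝ) ≤ (Fintype.card α : ℝ) ^ m := by positivity
      simp only [zero_mul, neg_zero, ne_eq, OfNat.ofNat_ne_zero, not_false_eq_true, zero_pow,
        add_zero, Real.exp_zero, mul_one]
      nlinarith
  have hYθ : ∀ a, (θ • Y a)ᵀ = θ • Y a := fun a => by rw [Matrix.transpose_smul, hY]
  have hq : ∀ a x, x ⬝ᵥ ((θ • Y a) *ᵥ x) = θ * (x ⬝ᵥ (Y a *ᵥ x)) := fun a x => by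
    rw [Matrix.smul_mulVec, dotProduct_smul, smul_eq_mul]
  have hexp : ∀ x, ∑ a, x ⬝ᵥ (NormedSpace.exp (θ • Y a) *ᵥ x) ≤
      (Fintype.card α * Real.exp (θ ^ 2 * v)) * (x ⬝ᵥ x) := by
    intro x
    have h1 : ∀ a, x ⬝ᵥ (NormedSpace.exp (θ • Y a) *ᵥ x) ≤
        x ⬝ᵥ x + θ * (x ⬝ᵥ (Y a *ᵥ x)) + θ ^ 2 * ((Y a *ᵥ x) ⬝ᵥ (Y a *ᵥ x)) := by
      intro a
      refine (dotProduct_exp_mulVec_le (hYθ a) (fun x => ?_) (fun x => ?_) x).trans_eq ?_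
      · rw [hq]
        have := mul_le_mul_of_nonneg_left (hu a x) hθ
        nlinarith [hdot x]
      · rw [hq]
        have := mul_le_mul_of_nonneg_left (hl a x) hθ
        nlinarith [hdot x]
      · rw [hq, Matrix.smul_mulVec, dotProduct_smul, smul_dotProduct, smul_eq_mul, smul_eq_mul]
        ring
    refine (Finset.sum_le_sum fun a _ => h1 a).trans ?_
    rw [Finset.sum_add_distrib, Finset.sum_add_distrib, ← Finset.mul_sum, ← Finset.mul_sum, hmean]
    simp only [Finset.sum_const, Finset.card_univ, nsmul_eq_mul, mul_zero, add_zero]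
    have h2 := mul_le_mul_of_nonneg_left (hvar x) (sq_nonneg θ)
    have h3 := Real.add_one_le_exp (θ ^ 2 * v)
    have h4 : 0 ≤ (Fintype.card α : ℝ) * (x ⬝ᵥ x) := mul_nonneg (by positivity) (hdot x)
    nlinarith
  have htot := sum_trace_exp_sum_le hYθ (by positivity) hexp m
  have hSs : ∀ ω : Fin m → α, (∑ k, θ • Y (ω k))ᵀ = ∑ k, θ • Y (ω k) := fun ω => by
    rw [Matrix.transpose_sum]; exact Finset.sum_congr rfl fun _ _ => hYθ _
  have hpos : ∀ ω : Fin m → α, 0 ≤ (NormedSpace.exp (∑ k, θ • Y (ω k))).trace := fun ω => by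
    have := trace_exp_mul_nonneg (hSs ω) (M := 1) (fun x => by
      rw [Matrix.one_mulVec]; exact hdot x)
    rwa [Matrix.mul_one] at this
  have hbad : ∀ ω ∈ (Finset.univ.filter fun ω : Fin m → α =>
      ¬ ∀ x, x ⬝ᵥ ((∑ k, Y (ω k)) *ᵥ x) ≤ t * (x ⬝ᵥ x)),
      Real.exp (θ * t) ≤ (NormedSpace.exp (∑ k, θ • Y (ω k))).trace := by
    intro ω hω
    by_contra hlt
    refine (Finset.mem_filter.mp hω).2 fun x => ?_
    have := dotProduct_mulVec_le_of_trace_exp_lt (hSs ω) (not_le.mp hlt) x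
    rw [← Finset.smul_sum, Matrix.smul_mulVec, dotProduct_smul, smul_eq_mul, mul_assoc] at this
    exact le_of_mul_le_mul_left this hθ0
  have h5 := Finset.card_nsmul_le_sum _ _ _ hbad
  have h6 := Finset.sum_le_sum_of_subset_of_nonneg (Finset.filter_subset
    (fun ω : Fin m → α => ¬ ∀ x, x ⬝ᵥ ((∑ k, Y (ω k)) *ᵥ x) ≤ t * (x ⬝ᵥ x)) Finset.univ)
    (fun ω _ _ => hpos ω)
  have h7 := (h5.trans h6).trans htot
  rw [nsmul_eq_mul, mul_pow, ← Real.exp_nat_mul] at h7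
  have h8 := mul_le_mul_of_nonneg_right h7 (Real.exp_pos (-(θ * t))).le
  rw [mul_assoc, ← Real.exp_add, add_neg_cancel, Real.exp_zero, mul_one] at h8
  refine h8.trans_eq ?_
  rw [Real.exp_add, show (m : ℝ) * (θ ^ 2 * v) = θ ^ 2 * m * v by ring]
  ring

end Bernstein

end MatrixCompletion

namespace MatrixCompletion

variable {n m r : ℕ}

/-! ### The Frobenius inner product -/

section Frobenius

variable (A B C : Matrix (Fin n) (Fin n) ℝ)

theorem frobInner_eq_trace : frobInner A B = (Aᵀ * B).trace := by
  simp only [frobInner, Matrix.trace, Matrix.diag, Matrix.mul_apply, Matrix.transpose_apply]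
  exact Finset.sum_comm

theorem frobInner_comm : frobInner A B = frobInner B A := by
  simp only [frobInner, mul_comm]

theorem frobInner_add_left : frobInner (A + B) C = frobInner A C + frobInner B C := by
  simp only [frobInner, Matrix.add_apply, add_mul, Finset.sum_add_distrib]

theorem frobInner_add_right : frobInner A (B + C) = frobInner A B + frobInner A C := by
  simp only [frobInner, Matrix.add_apply, mul_add, Finset.sum_add_distrib]

theorem frobInner_sub_left : frobInner (A - B) C = frobInner A C - frobInner B C := by
  simp only [frobInner, Matrix.sub_apply, sub_mul, Finset.sum_sub_distrib]

theorem frobInner_sub_right : frobInner A (B - C) = frobInner A B - frobInner A C := by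
  simp only [frobInner, Matrix.sub_apply, mul_sub, Finset.sum_sub_distrib]

theorem frobInner_smul_left (c : ℝ) : frobInner (c • A) B = c * frobInner A B := by
  simp only [frobInner, Matrix.smul_apply, smul_eq_mul, Finset.mul_sum, mul_assoc]

theorem frobInner_smul_right (c : ℝ) : frobInner A (c • B) = c * frobInner A B := by
  rw [frobInner_comm, frobInner_smul_left, frobInner_comm]

theorem frobInner_self_nonneg : 0 ≤ frobInner A A :=
  Finset.sum_nonneg fun _ _ => Finset.sum_nonneg fun _ _ => mul_self_nonneg _

theorem frobNorm_nonneg : 0 ≤ frobNorm A := Real.sqrt_nonneg _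

theorem frobNorm_sq : frobNorm A ^ 2 = frobInner A A := Real.sq_sqrt (frobInner_self_nonneg A)

theorem abs_apply_le_frobNorm (i j : Fin n) : |A i j| ≤ frobNorm A := by
  refine Real.abs_le_sqrt ?_
  have h1 := Finset.single_le_sum (f := fun j => A i j * A i j) (fun j _ => mul_self_nonneg _)
    (Finset.mem_univ j)
  have h2 := Finset.single_le_sum (f := fun i => ∑ j, A i j * A i j)
    (fun i _ => Finset.sum_nonneg fun j _ => mul_self_nonneg _) (Finset.mem_univ i)
  rw [pow_two]
  exact h1.trans h2

theorem eq_zero_of_frobNorm_eq_zero {A : Matrix (Fin n) (Fin n) ℝ} (h : frobNorm A = 0) :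
    A = 0 := by
  ext i j
  have := abs_apply_le_frobNorm A i j
  rw [h] at this
  exact abs_nonpos_iff.mp this

theorem frobNorm_zero : frobNorm (0 : Matrix (Fin n) (Fin n) ℝ) = 0 := by
  simp [frobNorm, frobInner]

theorem abs_frobInner_le : |frobInner A B| ≤ frobNorm A * frobNorm B := by
  refine abs_le_of_sq_le_sq ?_ (mul_nonneg (frobNorm_nonneg _) (frobNorm_nonneg _))
  rw [mul_pow, frobNorm_sq, frobNorm_sq]
  simp only [frobInner, ← Fintype.sum_prod_type']
  have := Finset.sum_mul_sq_le_sq_mul_sq Finset.univ (fun x : Fin n × Fin n => A x.1 x.2)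
    (fun x : Fin n × Fin n => B x.1 x.2)
  simpa only [pow_two] using this

theorem frobInner_le : frobInner A B ≤ frobNorm A * frobNorm B :=
  (le_abs_self _).trans (abs_frobInner_le A B)

theorem frobNorm_add_le : frobNorm (A + B) ≤ frobNorm A + frobNorm B := by
  refine le_of_sq_le_sq ?_ (add_nonneg (frobNorm_nonneg _) (frobNorm_nonneg _))
  have h := frobInner_le A B
  rw [frobNorm_sq, frobInner_add_left, frobInner_add_right, frobInner_add_right,
    frobInner_comm B A, add_sq, frobNorm_sq, frobNorm_sq]
  linarith

theorem frobNorm_smul (c : ℝ) : frobNorm (c • A) = |c| * frobNorm A := by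
  rw [frobNorm, frobInner_smul_left, frobInner_smul_right, ← mul_assoc,
    Real.sqrt_mul (mul_self_nonneg c), Real.sqrt_mul_self_eq_abs, frobNorm]

theorem frobNorm_neg : frobNorm (-A) = frobNorm A := by
  have := frobNorm_smul A (-1)
  simpa using this

theorem frobNorm_sub_comm : frobNorm (A - B) = frobNorm (B - A) := by
  rw [← frobNorm_neg, neg_sub]

theorem frobNorm_sub_le : frobNorm (A - B) ≤ frobNorm A + frobNorm B := by
  rw [sub_eq_add_neg, ← frobNorm_neg B]
  exact frobNorm_add_le _ _

theorem frobNorm_transpose : frobNorm Aᵀ = frobNorm A := by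
  simp only [frobNorm, frobInner, Matrix.transpose_apply]
  rw [Finset.sum_comm]

theorem frobNorm_mul_le : frobNorm (A * B) ≤ frobNorm A * frobNorm B := by
  refine le_of_sq_le_sq ?_ (mul_nonneg (frobNorm_nonneg _) (frobNorm_nonneg _))
  rw [mul_pow, frobNorm_sq, frobNorm_sq, frobNorm_sq]
  have h : ∀ i j, (A * B) i j * (A * B) i j ≤ (∑ k, A i k * A i k) * ∑ k, B k j * B k j := by
    intro i j
    have := Finset.sum_mul_sq_le_sq_mul_sq Finset.univ (fun k => A i k) (fun k => B k j)
    simpa only [Matrix.mul_apply, pow_two] using this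
  refine (Finset.sum_le_sum fun i _ => Finset.sum_le_sum fun j _ => h i j).trans_eq ?_
  simp only [frobInner]
  rw [Finset.sum_comm (f := fun i j => B i j * B i j), Finset.sum_mul_sum]

theorem frobInner_mul_left (P : Matrix (Fin n) (Fin n) ℝ) :
    frobInner (P * A) B = frobInner A (Pᵀ * B) := by
  simp only [frobInner_eq_trace, Matrix.transpose_mul, Matrix.mul_assoc]

theorem frobInner_mul_right (P : Matrix (Fin n) (Fin n) ℝ) :
    frobInner (A * P) B = frobInner A (B * Pᵀ) := by
  simp only [frobInner_eq_trace, Matrix.transpose_mul]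
  rw [Matrix.mul_assoc, Matrix.trace_mul_comm, Matrix.mul_assoc]

end Frobenius

/-! ### Orthogonal projections -/

/-- `P` is the matrix of an orthogonal projection. -/
structure IsOrthProj (P : Matrix (Fin n) (Fin n) ℝ) : Prop where
  symm : Pᵀ = P
  idem : P * P = P

theorem isOrthProj_mul_transpose {U : Matrix (Fin n) (Fin r) ℝ} (hU : Uᵀ * U = 1) :
    IsOrthProj (U * Uᵀ) where
  symm := by simp [Matrix.transpose_mul]
  idem := by
    rw [Matrix.mul_assoc, ← Matrix.mul_assoc Uᵀ, hU, Matrix.one_mul]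

namespace IsOrthProj

variable {P Q : Matrix (Fin n) (Fin n) ℝ}

theorem compl (hP : IsOrthProj P) : IsOrthProj (1 - P) where
  symm := by rw [Matrix.transpose_sub, Matrix.transpose_one, hP.symm]
  idem := by rw [Matrix.sub_mul, Matrix.mul_sub, Matrix.mul_sub, hP.idem]; simp

theorem frobInner_mul_self (hP : IsOrthProj P) (A : Matrix (Fin n) (Fin n) ℝ) :
    frobInner (P * A) (P * A) = frobInner A (P * A) := by
  rw [frobInner_mul_left, hP.symm, ← Matrix.mul_assoc, hP.idem]

theorem frobNorm_mul_left_le (hP : IsOrthProj P) (A : Matrix (Fin n) (Fin n) ℝ) :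
    frobNorm (P * A) ≤ frobNorm A := by
  have h := hP.frobInner_mul_self A
  have h2 := frobInner_le A (P * A)
  rw [← h, ← frobNorm_sq] at h2
  nlinarith [frobNorm_nonneg (P * A), frobNorm_nonneg A]

theorem frobNorm_mul_right_le (hP : IsOrthProj P) (A : Matrix (Fin n) (Fin n) ℝ) :
    frobNorm (A * P) ≤ frobNorm A := by
  rw [← frobNorm_transpose, Matrix.transpose_mul, hP.symm, ← frobNorm_transpose A]
  exact hP.frobNorm_mul_left_le _

/-- Two orthogonal projections of the same rank: the distance is controlled by the sine. -/
theorem frobNorm_sub_le_of_trace_eq (hP : IsOrthProj P) (hQ : IsOrthProj Q)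
    (h : P.trace = Q.trace) : frobNorm (P - Q) ≤ 2 * frobNorm ((1 - P) * Q) := by
  have e1 : frobInner (P - Q) (P - Q) = 2 * (Q.trace - (P * Q).trace) := by
    rw [frobInner_sub_left, frobInner_sub_right, frobInner_sub_right, frobInner_comm Q P]
    simp only [frobInner_eq_trace, hP.symm, hQ.symm, hP.idem, hQ.idem, h]
    ring
  have e2 : frobInner ((1 - P) * Q) ((1 - P) * Q) = Q.trace - (P * Q).trace := by
    rw [hP.compl.frobInner_mul_self, frobInner_eq_trace, hQ.symm, ← Matrix.mul_assoc,
      Matrix.trace_mul_comm, ← Matrix.mul_assoc, hQ.idem, Matrix.mul_sub, Matrix.mul_one,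
      Matrix.trace_sub, Matrix.trace_mul_comm Q P]
  -- The computation gives the exact factor `√2`, which is relaxed to `2`.
  refine le_of_sq_le_sq ?_ (mul_nonneg zero_le_two (frobNorm_nonneg _))
  rw [mul_pow, frobNorm_sq, frobNorm_sq, e1, e2]
  have := frobInner_self_nonneg ((1 - P) * Q)
  rw [e2] at this
  linarith

end IsOrthProj

/-! ### Tangent spaces -/

section Tangent

variable {U V : Matrix (Fin n) (Fin r) ℝ}

theorem tangentProj_add (Z W : Matrix (Fin n) (Fin n) ℝ) :
    tangentProj U V (Z + W) = tangentProj U V Z + tangentProj U V W := by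
  simp only [tangentProj, Matrix.mul_add, Matrix.add_mul]; abel

theorem tangentProj_smul (c : ℝ) (Z : Matrix (Fin n) (Fin n) ℝ) :
    tangentProj U V (c • Z) = c • tangentProj U V Z := by
  simp only [tangentProj, Matrix.mul_smul, Matrix.smul_mul, smul_add, smul_sub]

/-- The complementary projection factors into two commuting one-sided projections; idempotence,
self-adjointness and the second-order estimate below are read off from this. -/
theorem sub_tangentProj (Z : Matrix (Fin n) (Fin n) ℝ) :
    Z - tangentProj U V Z = (1 - U * Uᵀ) * Z * (1 - V * Vᵀ) := by
  simp only [tangentProj, Matrix.sub_mul, Matrix.mul_sub, Matrix.one_mul, Matrix.mul_one]; abel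

theorem tangentProj_idem (hU : Uᵀ * U = 1) (hV : Vᵀ * V = 1) (Z : Matrix (Fin n) (Fin n) ℝ) :
    tangentProj U V (tangentProj U V Z) = tangentProj U V Z := by
  have h : tangentProj U V (Z - tangentProj U V Z) = 0 := by
    have h1 : (Z - tangentProj U V Z) - tangentProj U V (Z - tangentProj U V Z) =
        Z - tangentProj U V Z := by
      rw [sub_tangentProj, sub_tangentProj]
      have e1 := (isOrthProj_mul_transpose hU).compl.idem
      have e2 := (isOrthProj_mul_transpose hV).compl.idem
      rw [Matrix.mul_assoc _ _ (1 - V * Vᵀ), Matrix.mul_assoc _ _ (1 - V * Vᵀ), e2,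
        ← Matrix.mul_assoc, ← Matrix.mul_assoc, e1]
    exact sub_eq_self.mp h1
  have h2 := tangentProj_add (U := U) (V := V) (Z - tangentProj U V Z) (tangentProj U V Z)
  rw [sub_add_cancel, h, zero_add] at h2
  exact h2.symm

theorem frobInner_tangentProj (hU : Uᵀ * U = 1) (hV : Vᵀ * V = 1)
    (Z W : Matrix (Fin n) (Fin n) ℝ) :
    frobInner (tangentProj U V Z) W = frobInner Z (tangentProj U V W) := by
  have h : frobInner (Z - tangentProj U V Z) W = frobInner Z (W - tangentProj U V W) := by
    rw [sub_tangentProj, sub_tangentProj, frobInner_mul_right,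
      frobInner_mul_left, (isOrthProj_mul_transpose hU).compl.symm,
      (isOrthProj_mul_transpose hV).compl.symm, Matrix.mul_assoc]
  rw [frobInner_sub_left, frobInner_sub_right] at h
  linarith

theorem frobNorm_tangentProj_le (hU : Uᵀ * U = 1) (hV : Vᵀ * V = 1)
    (Z : Matrix (Fin n) (Fin n) ℝ) : frobNorm (tangentProj U V Z) ≤ frobNorm Z := by
  have h := frobInner_tangentProj hU hV Z (tangentProj U V Z)
  rw [tangentProj_idem hU hV, ← frobNorm_sq] at h
  have h2 := frobInner_le Z (tangentProj U V Z)
  nlinarith [frobNorm_nonneg (tangentProj U V Z), frobNorm_nonneg Z]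

theorem IsThinSVD.transpose {Z : Matrix (Fin n) (Fin n) ℝ} {s : Fin r → ℝ}
    (h : IsThinSVD Z U s V) : IsThinSVD Zᵀ V s U where
  left_orthonormal := h.right_orthonormal
  right_orthonormal := h.left_orthonormal
  nonneg := h.nonneg
  eq := by
    rw [h.eq]
    simp only [Matrix.transpose_mul, Matrix.transpose_transpose, Matrix.diagonal_transpose,
      Matrix.mul_assoc]

theorem IsThinSVD.left_mul {Z : Matrix (Fin n) (Fin n) ℝ} {s : Fin r → ℝ}
    (h : IsThinSVD Z U s V) : U * Uᵀ * Z = Z := by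
  have e := h.eq
  rw [Matrix.mul_assoc] at e
  rw [e, Matrix.mul_assoc, ← Matrix.mul_assoc Uᵀ, h.left_orthonormal, Matrix.one_mul]

theorem IsThinSVD.right_mul {Z : Matrix (Fin n) (Fin n) ℝ} {s : Fin r → ℝ}
    (h : IsThinSVD Z U s V) : Z * (V * Vᵀ) = Z := by
  have := congrArg Matrix.transpose h.transpose.left_mul
  simpa [Matrix.transpose_mul, Matrix.mul_assoc] using this

/-- Right multiplication by a matrix with singular values at most `c`. -/
theorem frobNorm_mul_svd_le (hU : Uᵀ * U = 1) (hV : Vᵀ * V = 1) {d : Fin r → ℝ} {c : ℝ}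
    (hc : 0 ≤ c) (hd : ∀ i, |d i| ≤ c) (M : Matrix (Fin n) (Fin n) ℝ) :
    frobNorm (M * (V * Matrix.diagonal d * Uᵀ)) ≤ c * frobNorm M := by
  refine le_of_sq_le_sq ?_ (mul_nonneg hc (frobNorm_nonneg _))
  have e1 : frobInner (M * (V * Matrix.diagonal d * Uᵀ)) (M * (V * Matrix.diagonal d * Uᵀ)) =
      (Matrix.diagonal d * (Vᵀ * (Mᵀ * M) * V) * Matrix.diagonal d).trace := by
    rw [frobInner_eq_trace, Matrix.trace_mul_comm]
    simp only [Matrix.transpose_mul, Matrix.transpose_transpose, Matrix.diagonal_transpose]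
    have : M * (V * Matrix.diagonal d * Uᵀ) * (U * (Matrix.diagonal d * Vᵀ) * Mᵀ) =
        (M * V * Matrix.diagonal d) * (Matrix.diagonal d * Vᵀ * Mᵀ) := by
      calc _ = M * V * Matrix.diagonal d * (Uᵀ * U) * (Matrix.diagonal d * Vᵀ * Mᵀ) := by
            simp only [Matrix.mul_assoc]
        _ = _ := by rw [hU, Matrix.mul_one]
    rw [this, Matrix.trace_mul_comm]
    simp only [Matrix.mul_assoc]
  have e2 : (Vᵀ * (Mᵀ * M) * V).trace = frobInner (M * (V * Vᵀ)) (M * (V * Vᵀ)) := by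
    rw [frobInner_mul_right, (isOrthProj_mul_transpose hV).symm, Matrix.mul_assoc M,
      (isOrthProj_mul_transpose hV).idem, frobInner_eq_trace, Matrix.mul_assoc,
      Matrix.trace_mul_comm]
    simp only [Matrix.mul_assoc]
  have e3 : (Matrix.diagonal d * (Vᵀ * (Mᵀ * M) * V) * Matrix.diagonal d).trace ≤
      c ^ 2 * (Vᵀ * (Mᵀ * M) * V).trace := by
    simp only [Matrix.trace, Matrix.diag_apply, Matrix.mul_diagonal, Matrix.diagonal_mul,
      Finset.mul_sum]
    refine Finset.sum_le_sum fun i _ => ?_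
    have h0 : 0 ≤ (Vᵀ * (Mᵀ * M) * V) i i := by
      have : Vᵀ * (Mᵀ * M) * V = (M * V)ᵀ * (M * V) := by
        rw [Matrix.transpose_mul]; simp only [Matrix.mul_assoc]
      rw [this, Matrix.mul_apply]
      exact Finset.sum_nonneg fun _ _ => mul_self_nonneg _
    have h1 : d i ^ 2 ≤ c ^ 2 := by
      rw [← sq_abs]
      exact pow_le_pow_left₀ (abs_nonneg _) (hd i) 2
    nlinarith
  rw [mul_pow, frobNorm_sq, e1]
  refine e3.trans (mul_le_mul_of_nonneg_left ?_ (sq_nonneg c))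
  rw [e2, ← frobNorm_sq]
  exact pow_le_pow_left₀ (frobNorm_nonneg _)
    ((isOrthProj_mul_transpose hV).frobNorm_mul_right_le M) 2

variable {X Y : Matrix (Fin n) (Fin n) ℝ} {σ s : Fin r → ℝ} {U' V' : Matrix (Fin n) (Fin r) ℝ}
  {c : ℝ}

/-- A sine theorem for the column spaces. -/
theorem IsThinSVD.frobNorm_compl_mul_le (hX : IsThinSVD X U σ V) (hY : IsThinSVD Y U' s V')
    (hc : 0 < c) (hσ : ∀ i, c ≤ σ i) :
    frobNorm ((1 - U' * U'ᵀ) * (U * Uᵀ)) ≤ frobNorm (Y - X) / c := by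
  -- The right factor is the pseudoinverse of `X`: it turns `X` into `U Uᵀ` and has norm at most
  -- `c⁻¹`, while `1 - U' U'ᵀ` annihilates `Y`.
  have e : (1 - U' * U'ᵀ) * (U * Uᵀ) =
      ((1 - U' * U'ᵀ) * (X - Y)) * (V * Matrix.diagonal (fun i => (σ i)⁻¹) * Uᵀ) := by
    have h1 : X * (V * Matrix.diagonal (fun i => (σ i)⁻¹) * Uᵀ) = U * Uᵀ := by
      rw [hX.eq]
      calc _ = U * (Matrix.diagonal σ * (Vᵀ * V) * Matrix.diagonal (fun i => (σ i)⁻¹)) * Uᵀ := by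
            simp only [Matrix.mul_assoc]
        _ = U * Uᵀ := by
            rw [hX.right_orthonormal, Matrix.mul_one, Matrix.diagonal_mul_diagonal]
            have : (fun i => σ i * (σ i)⁻¹) = fun _ => (1 : ℝ) := funext fun i =>
              mul_inv_cancel₀ (hc.trans_le (hσ i)).ne'
            rw [this, Matrix.diagonal_one, Matrix.mul_one]
    have h2 : (1 - U' * U'ᵀ) * (X - Y) = (1 - U' * U'ᵀ) * X := by
      rw [Matrix.mul_sub, Matrix.sub_mul 1 _ Y, hY.left_mul, Matrix.one_mul, sub_self, sub_zero]
    rw [h2, Matrix.mul_assoc, h1]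
  rw [e]
  refine (frobNorm_mul_svd_le hX.left_orthonormal hX.right_orthonormal (c := c⁻¹)
    (by positivity) (fun i => ?_) _).trans ?_
  · rw [abs_inv, abs_of_pos (hc.trans_le (hσ i))]
    exact inv_anti₀ hc (hσ i)
  · rw [frobNorm_sub_comm Y X, div_eq_inv_mul]
    exact mul_le_mul_of_nonneg_left ((isOrthProj_mul_transpose
      hY.left_orthonormal).compl.frobNorm_mul_left_le _) (by positivity)

theorem IsThinSVD.frobNorm_proj_sub_le (hX : IsThinSVD X U σ V) (hY : IsThinSVD Y U' s V')
    (hc : 0 < c) (hσ : ∀ i, c ≤ σ i) :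
    frobNorm (U' * U'ᵀ - U * Uᵀ) ≤ 2 * (frobNorm (Y - X) / c) := by
  refine ((isOrthProj_mul_transpose hY.left_orthonormal).frobNorm_sub_le_of_trace_eq
    (isOrthProj_mul_transpose hX.left_orthonormal) ?_).trans
    (mul_le_mul_of_nonneg_left (hX.frobNorm_compl_mul_le hY hc hσ) zero_le_two)
  rw [Matrix.trace_mul_comm, hY.left_orthonormal, Matrix.trace_mul_comm, hX.left_orthonormal]

theorem IsThinSVD.frobNorm_tangentProj_sub_le (hX : IsThinSVD X U σ V)
    (hY : IsThinSVD Y U' s V') (hc : 0 < c) (hσ : ∀ i, c ≤ σ i)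
    (Z : Matrix (Fin n) (Fin n) ℝ) :
    frobNorm (tangentProj U' V' Z - tangentProj U V Z) ≤
      4 * (frobNorm (Y - X) / c) * frobNorm Z := by
  -- A telescoping of the two complementary projections: each term contains the change of only one
  -- factor.
  have e : tangentProj U' V' Z - tangentProj U V Z =
      (U' * U'ᵀ - U * Uᵀ) * (Z * (1 - V' * V'ᵀ)) + ((1 - U * Uᵀ) * Z) * (V' * V'ᵀ - V * Vᵀ) := by
    simp only [tangentProj, Matrix.sub_mul, Matrix.mul_sub, Matrix.one_mul, Matrix.mul_one,
      Matrix.mul_assoc]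
    abel
  have hA := hX.frobNorm_proj_sub_le hY hc hσ
  have hB := hX.transpose.frobNorm_proj_sub_le hY.transpose hc hσ
  rw [← Matrix.transpose_sub, frobNorm_transpose] at hB
  have h1 := (isOrthProj_mul_transpose hY.right_orthonormal).compl.frobNorm_mul_right_le Z
  have h2 := (isOrthProj_mul_transpose hX.left_orthonormal).compl.frobNorm_mul_left_le Z
  have h0 : 0 ≤ frobNorm (Y - X) / c := div_nonneg (frobNorm_nonneg _) hc.le
  rw [e]
  refine (frobNorm_add_le _ _).trans ((add_le_add (frobNorm_mul_le _ _)
    (frobNorm_mul_le _ _)).trans ?_)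
  have h3 := mul_le_mul hA h1 (frobNorm_nonneg _) (by positivity)
  have h4 := mul_le_mul h2 hB (frobNorm_nonneg _) (frobNorm_nonneg _)
  linarith

/-- The curvature estimate: the normal part of `X` contains both the tilt of the column space and
the difference `X - Y`, so it is quadratic in the distance. -/
theorem IsThinSVD.frobNorm_sub_tangentProj_le (hX : IsThinSVD X U σ V)
    (hY : IsThinSVD Y U' s V') (hc : 0 < c) (hσ : ∀ i, c ≤ σ i) :
    frobNorm (X - tangentProj U' V' X) ≤ frobNorm (Y - X) / c * frobNorm (Y - X) := by
  have e : X - tangentProj U' V' X =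
      ((1 - U' * U'ᵀ) * (U * Uᵀ)) * ((X - Y) * (1 - V' * V'ᵀ)) := by
    rw [sub_tangentProj]
    have h1 : (X - Y) * (1 - V' * V'ᵀ) = X * (1 - V' * V'ᵀ) := by
      rw [Matrix.sub_mul, Matrix.mul_sub Y, hY.right_mul, Matrix.mul_one, sub_self, sub_zero]
    rw [h1, Matrix.mul_assoc (1 - U' * U'ᵀ) (U * Uᵀ), ← Matrix.mul_assoc (U * Uᵀ), hX.left_mul,
      Matrix.mul_assoc]
  rw [e]
  refine (frobNorm_mul_le _ _).trans (mul_le_mul (hX.frobNorm_compl_mul_le hY hc hσ) ?_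
    (frobNorm_nonneg _) (div_nonneg (frobNorm_nonneg _) hc.le))
  rw [frobNorm_sub_comm Y X]
  exact (isOrthProj_mul_transpose hY.right_orthonormal).compl.frobNorm_mul_right_le _

end Tangent

end MatrixCompletion

namespace MatrixCompletion

variable {n m r : ℕ}

/-! ### Hard thresholding -/

section HardThreshold

theorem card_filter_val_lt (h : r ≤ n) :
    (Finset.univ.filter fun i : Fin n => (i : ℕ) < r).card = r := by
  have := Fin.card_filter_val_lt (n := n) (m := r)
  omega

/-- Among weights in `[0,1]` of total mass `r`, the largest weighted sum of a decreasing sequence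
is the sum of its first `r` terms. -/
theorem sum_mul_le_sum_first {b a : Fin n → ℝ} (hb : Antitone b) (hb0 : ∀ i, 0 ≤ b i)
    (ha0 : ∀ i, 0 ≤ a i) (ha1 : ∀ i, a i ≤ 1) (ha : ∑ i, a i ≤ r) :
    ∑ i, b i * a i ≤ ∑ i : Fin n, if (i : ℕ) < r then b i else 0 := by
  by_cases hr : r < n
  · set c := b ⟨r, hr⟩ with hc
    -- Comparison with the cut-off value `c`: beyond the first `r` indices `b` is at most `c`, and
    -- before them giving up the weight `1 - a i` costs at least `c (1 - a i)`.
    have h : ∀ i : Fin n, b i * a i ≤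
        (if (i : ℕ) < r then b i else 0) - (if (i : ℕ) < r then c else 0) + c * a i := by
      intro i
      by_cases hi : (i : ℕ) < r
      · have h1 : c ≤ b i := hb (Fin.le_def.mpr hi.le)
        simp only [hi, if_true]
        nlinarith [ha1 i]
      · have h1 : b i ≤ c := hb (Fin.le_def.mpr (not_lt.mp hi))
        simp only [hi, if_false, sub_zero, zero_add]
        exact mul_le_mul_of_nonneg_right h1 (ha0 i)
    refine (Finset.sum_le_sum fun i _ => h i).trans ?_
    rw [Finset.sum_add_distrib, Finset.sum_sub_distrib, ← Finset.mul_sum,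
      ← Finset.sum_filter (fun i : Fin n => (i : ℕ) < r) (fun _ => c), Finset.sum_const, card_filter_val_lt hr.le,
      nsmul_eq_mul]
    have := mul_le_mul_of_nonneg_left ha (hb0 ⟨r, hr⟩)
    rw [← hc] at this
    linarith
  · refine Finset.sum_le_sum fun i _ => ?_
    rw [if_pos (by omega)]
    nlinarith [ha1 i, hb0 i]

variable {P Q : Matrix (Fin n) (Fin n) ℝ}

theorem frobInner_conj_diagonal (hQ : Qᵀ * Q = 1) (A : Matrix (Fin n) (Fin n) ℝ)
    (d : Fin n → ℝ) :
    frobInner (P * Matrix.diagonal d * Qᵀ) (A * (P * Matrix.diagonal d * Qᵀ)) =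
      ∑ i, d i ^ 2 * (Pᵀ * A * P) i i := by
  have : frobInner (P * Matrix.diagonal d * Qᵀ) (A * (P * Matrix.diagonal d * Qᵀ)) =
      (Matrix.diagonal d * (Pᵀ * A * P) * Matrix.diagonal d).trace := by
    rw [frobInner_eq_trace, Matrix.transpose_mul, Matrix.transpose_transpose, Matrix.mul_assoc Q,
      Matrix.trace_mul_comm, Matrix.transpose_mul, Matrix.diagonal_transpose]
    calc _ = (Matrix.diagonal d * Pᵀ * A * P * Matrix.diagonal d * (Qᵀ * Q)).trace := by
          simp only [Matrix.mul_assoc]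
      _ = _ := by rw [hQ, Matrix.mul_one]; simp only [Matrix.mul_assoc]
  rw [this, Matrix.trace]
  refine Finset.sum_congr rfl fun i _ => ?_
  rw [Matrix.diag_apply, Matrix.mul_diagonal, Matrix.diagonal_mul]
  ring

theorem frobNorm_sq_conj_diagonal (hP : Pᵀ * P = 1) (hQ : Qᵀ * Q = 1) (d : Fin n → ℝ) :
    frobNorm (P * Matrix.diagonal d * Qᵀ) ^ 2 = ∑ i, d i ^ 2 := by
  have := frobInner_conj_diagonal (P := P) hQ 1 d
  rw [Matrix.one_mul, Matrix.mul_one, hP] at this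
  rw [frobNorm_sq, this]
  simp

variable {X W Y : Matrix (Fin n) (Fin n) ℝ} {U V : Matrix (Fin n) (Fin r) ℝ} {σ : Fin r → ℝ}

/-- The Eckart–Young theorem for the Frobenius norm. -/
theorem IsHardThreshold.frobNorm_sub_le (hY : IsHardThreshold r W Y) (hX : IsThinSVD X U σ V) :
    frobNorm (Y - W) ≤ frobNorm (X - W) := by
  obtain ⟨P, s, Q, hsvd, rfl⟩ := hY
  have hA := isOrthProj_mul_transpose hX.left_orthonormal
  set A := U * Uᵀ with hAdef
  have hPA : Pᵀ * A * P = (A * P)ᵀ * (A * P) := by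
    rw [Matrix.transpose_mul, hA.symm, Matrix.mul_assoc Pᵀ A (A * P), ← Matrix.mul_assoc A A,
      hA.idem, Matrix.mul_assoc]
  have hPA' : Pᵀ * (1 - A) * P = ((1 - A) * P)ᵀ * ((1 - A) * P) := by
    rw [Matrix.transpose_mul, hA.compl.symm, Matrix.mul_assoc Pᵀ (1 - A) ((1 - A) * P),
      ← Matrix.mul_assoc (1 - A) (1 - A), hA.compl.idem, Matrix.mul_assoc]
  have hdiag : ∀ (B : Matrix (Fin n) (Fin n) ℝ) i, 0 ≤ (Bᵀ * B) i i := fun B i => by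
    rw [Matrix.mul_apply]
    exact Finset.sum_nonneg fun _ _ => mul_self_nonneg _
  have ha0 : ∀ i, 0 ≤ (Pᵀ * A * P) i i := fun i => hPA ▸ hdiag _ i
  have ha1 : ∀ i, (Pᵀ * A * P) i i ≤ 1 := fun i => by
    have h := hdiag ((1 - A) * P) i
    rw [← hPA', Matrix.mul_sub, Matrix.mul_one, Matrix.sub_mul, hsvd.left_orthogonal,
      Matrix.sub_apply, Matrix.one_apply_eq] at h
    linarith
  have hasum : ∑ i, (Pᵀ * A * P) i i ≤ r := by
    have : (Pᵀ * A * P).trace = r := by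
      rw [Matrix.mul_assoc, Matrix.trace_mul_comm, Matrix.mul_assoc,
        mul_eq_one_comm.mp hsvd.left_orthogonal, Matrix.mul_one, hAdef, Matrix.trace_mul_comm,
        hX.left_orthonormal, Matrix.trace_one, Fintype.card_fin]
    exact this.le
  have hb : Antitone fun i => s i ^ 2 := fun i j hij =>
    pow_le_pow_left₀ (hsvd.nonneg j) (hsvd.antitone hij) 2
  have key := sum_mul_le_sum_first (r := r) hb (fun i => sq_nonneg _) ha0 ha1 hasum
  refine le_of_sq_le_sq ?_ (frobNorm_nonneg _)
  have e1 : frobNorm (P * Matrix.diagonal (fun i : Fin n => if (i : ℕ) < r then s i else 0) * Qᵀ -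
      W) ^ 2 = ∑ i : Fin n, (s i ^ 2 - if (i : ℕ) < r then s i ^ 2 else 0) := by
    rw [hsvd.eq, ← Matrix.sub_mul, ← Matrix.mul_sub, Matrix.diagonal_sub,
      frobNorm_sq_conj_diagonal hsvd.left_orthogonal hsvd.right_orthogonal]
    refine Finset.sum_congr rfl fun i _ => ?_
    split_ifs <;> ring
  -- Projecting away the column space of `X` leaves only the part of `W` outside it; the weights
  -- `(Pᵀ A P) i i` lie in `[0, 1]` and sum to `r`.
  have e2 : frobNorm ((1 - A) * (X - W)) ^ 2 = ∑ i, (s i ^ 2 - s i ^ 2 * (Pᵀ * A * P) i i) := by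
    have : (1 - A) * (X - W) = -((1 - A) * W) := by
      rw [Matrix.mul_sub, Matrix.sub_mul 1 A X, hX.left_mul, Matrix.one_mul, sub_self, zero_sub]
    rw [this, frobNorm_neg, frobNorm_sq, hA.compl.frobInner_mul_self, Matrix.sub_mul,
      Matrix.one_mul, frobInner_sub_right, ← frobNorm_sq, hsvd.eq, frobInner_conj_diagonal
      hsvd.right_orthogonal, frobNorm_sq_conj_diagonal hsvd.left_orthogonal hsvd.right_orthogonal,
      Finset.sum_sub_distrib]
  have h3 := pow_le_pow_left₀ (frobNorm_nonneg _) (hA.compl.frobNorm_mul_left_le (X - W)) 2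
  rw [e2] at h3
  rw [e1]
  refine le_trans ?_ h3
  rw [Finset.sum_sub_distrib, Finset.sum_sub_distrib]
  linarith

theorem IsHardThreshold.frobNorm_sub_le_two_mul (hY : IsHardThreshold r W Y)
    (hX : IsThinSVD X U σ V) : frobNorm (Y - X) ≤ 2 * frobNorm (W - X) := by
  have h1 := hY.frobNorm_sub_le hX
  have h2 := frobNorm_add_le (Y - W) (W - X)
  rw [sub_add_sub_cancel] at h2
  rw [frobNorm_sub_comm X W] at h1
  linarith

theorem IsHardThreshold.exists_thinSVD (hY : IsHardThreshold r W Y) (hr : r ≤ n) :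
    ∃ (A B : Matrix (Fin n) (Fin r) ℝ) (s : Fin r → ℝ), IsThinSVD Y A s B := by
  obtain ⟨P, s, Q, hsvd, rfl⟩ := hY
  have hsub : ∀ {M : Matrix (Fin n) (Fin n) ℝ}, Mᵀ * M = 1 →
      (M.submatrix id (Fin.castLE hr))ᵀ * M.submatrix id (Fin.castLE hr) = 1 := by
    intro M hM
    ext i j
    have := congrFun (congrFun hM (Fin.castLE hr i)) (Fin.castLE hr j)
    simp only [Matrix.mul_apply, Matrix.transpose_apply, Matrix.submatrix_apply, id,
      Matrix.one_apply] at this ⊢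
    rw [this]
    simp [Fin.ext_iff]
  refine ⟨P.submatrix id (Fin.castLE hr), Q.submatrix id (Fin.castLE hr),
    fun i => s (Fin.castLE hr i), hsub hsvd.left_orthogonal, hsub hsvd.right_orthogonal,
    fun i => hsvd.nonneg _, ?_⟩
  ext i j
  rw [Matrix.mul_apply, Matrix.mul_apply]
  simp only [Matrix.mul_diagonal, Matrix.transpose_apply, Matrix.submatrix_apply, id]
  have h := Finset.sum_map (Finset.univ : Finset (Fin r)) (Fin.castLEEmb hr)
    (fun k => P i k * s k * Q j k)
  simp only [Fin.coe_castLEEmb] at h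
  rw [← h, ← Finset.sum_subset (Finset.subset_univ (Finset.univ.map (Fin.castLEEmb hr)))]
  · refine Finset.sum_congr rfl fun k hk => ?_
    obtain ⟨l, _, rfl⟩ := Finset.mem_map.mp hk
    simp
  · intro k _ hk
    rw [if_neg, mul_zero, zero_mul]
    intro hkr
    exact hk (Finset.mem_map.mpr ⟨⟨k, hkr⟩, Finset.mem_univ _, Fin.ext rfl⟩)

/-- Apply the spectral bound to each row of `P`; the squared lengths of the rows add up to the
trace, that is, to the rank. This is how a spectral bound costs only `√r` in Frobenius norm. -/
theorem IsOrthProj.frobNorm_sq_mul_le {P N : Matrix (Fin n) (Fin n) ℝ} (hP : IsOrthProj P)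
    {τ : ℝ} (hN : ∀ x, (Nᵀ *ᵥ x) ⬝ᵥ (Nᵀ *ᵥ x) ≤ τ ^ 2 * (x ⬝ᵥ x)) :
    frobNorm (P * N) ^ 2 ≤ τ ^ 2 * P.trace := by
  have e1 : frobNorm (P * N) ^ 2 = ∑ i, (Nᵀ *ᵥ fun j => P i j) ⬝ᵥ (Nᵀ *ᵥ fun j => P i j) := by
    rw [frobNorm_sq, frobInner]
    refine Finset.sum_congr rfl fun i _ => Finset.sum_congr rfl fun j _ => ?_
    simp only [Matrix.mul_apply, Matrix.mulVec, dotProduct, Matrix.transpose_apply, mul_comm]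
  have e2 : P.trace = ∑ i, (fun j => P i j) ⬝ᵥ (fun j => P i j) := by
    rw [← congrArg Matrix.trace hP.idem, Matrix.trace]
    refine Finset.sum_congr rfl fun i _ => ?_
    rw [Matrix.diag_apply, Matrix.mul_apply, dotProduct]
    refine Finset.sum_congr rfl fun j _ => ?_
    rw [← congrFun (congrFun hP.symm j) i, Matrix.transpose_apply]
  rw [e1, e2, Finset.mul_sum]
  exact Finset.sum_le_sum fun i _ => hN _

/-- Hard thresholding of a spectrally small perturbation of a matrix of rank `r`. -/
theorem IsHardThreshold.frobNorm_sub_le_of_spectral (hY : IsHardThreshold r W Y)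
    (hX : IsThinSVD X U σ V) (hr : r ≤ n) {τ : ℝ} (hτ : 0 < τ)
    (hN : ∀ u v : Fin n → ℝ, 2 * (u ⬝ᵥ ((W - X) *ᵥ v)) ≤ τ * (u ⬝ᵥ u + v ⬝ᵥ v)) :
    frobNorm (Y - X) ≤ 4 * √r * τ := by
  set N := W - X with hNdef
  -- The hypothesis on `N` bounds its symmetric dilation. Testing it with `τ⁻¹ Nᵀ x` or `τ⁻¹ N x` as
  -- the second vector balances the two squares and yields the operator norm bound, with `a` and `b`
  -- the squared lengths of the image and of `x`.
  have hbound : ∀ a b : ℝ, 2 * (τ⁻¹ * a) ≤ τ * (b + τ⁻¹ * (τ⁻¹ * a)) → a ≤ τ ^ 2 * b := by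
    intro a b h
    have h1 : τ * (2 * (τ⁻¹ * a)) ≤ τ * (τ * (b + τ⁻¹ * (τ⁻¹ * a))) :=
      mul_le_mul_of_nonneg_left h hτ.le
    field_simp at h1
    linarith
  have hN1 : ∀ x, (Nᵀ *ᵥ x) ⬝ᵥ (Nᵀ *ᵥ x) ≤ τ ^ 2 * (x ⬝ᵥ x) := by
    intro x
    have h := hN x (τ⁻¹ • (Nᵀ *ᵥ x))
    rw [Matrix.dotProduct_mulVec, ← Matrix.mulVec_transpose, dotProduct_smul, dotProduct_smul,
      smul_dotProduct] at h
    exact hbound _ _ h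
  have hN2 : ∀ x, (N *ᵥ x) ⬝ᵥ (N *ᵥ x) ≤ τ ^ 2 * (x ⬝ᵥ x) := by
    intro x
    have h := hN (τ⁻¹ • (N *ᵥ x)) x
    rw [smul_dotProduct, dotProduct_smul, smul_dotProduct, add_comm] at h
    exact hbound _ _ h
  obtain ⟨A, B, s, hs⟩ := hY.exists_thinSVD hr
  have hA := isOrthProj_mul_transpose hs.left_orthonormal
  have hB := isOrthProj_mul_transpose hX.right_orthonormal
  have htr : ∀ {M : Matrix (Fin n) (Fin r) ℝ}, Mᵀ * M = 1 → (M * Mᵀ).trace = r := fun hM => by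
    rw [Matrix.trace_mul_comm, hM, Matrix.trace_one, Fintype.card_fin]
  have hfin : ∀ a : ℝ, a ^ 2 ≤ τ ^ 2 * r → a ≤ √r * τ := by
    intro a h
    refine le_of_sq_le_sq ?_ (by positivity)
    rw [mul_pow, Real.sq_sqrt (Nat.cast_nonneg r), mul_comm]
    exact h
  have h1 : frobNorm ((A * Aᵀ) * N) ≤ √r * τ := hfin _ (by
    rw [← htr hs.left_orthonormal]; exact hA.frobNorm_sq_mul_le hN1)
  have h2 : frobNorm (N * (V * Vᵀ)) ≤ √r * τ := hfin _ (by
    rw [← htr hX.right_orthonormal, ← frobNorm_transpose, Matrix.transpose_mul, hB.symm]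
    exact hB.frobNorm_sq_mul_le (by simpa using hN2))
  -- The column part of `Y - X` lies in the range of `A`, and the rest equals `-(1 - A Aᵀ) X`, whose
  -- rows lie in the range of `V`. So `N` enters only through two compressions of rank at most `r`.
  have h3 : frobInner N (Y - X) =
      frobInner ((A * Aᵀ) * N) (Y - X) + frobInner (N * (V * Vᵀ)) ((1 - A * Aᵀ) * (Y - X)) := by
    have e : (1 - A * Aᵀ) * (Y - X) * (V * Vᵀ) = (1 - A * Aᵀ) * (Y - X) := by
      have : (1 - A * Aᵀ) * (Y - X) = -((1 - A * Aᵀ) * X) := by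
        rw [Matrix.mul_sub, Matrix.sub_mul 1 _ Y, hs.left_mul, Matrix.one_mul, sub_self, zero_sub]
      rw [this, Matrix.neg_mul, Matrix.mul_assoc, hX.right_mul]
    rw [frobInner_mul_left, frobInner_mul_right, hA.symm, hB.symm, e, ← frobInner_add_right,
      ← Matrix.add_mul, add_sub_cancel, Matrix.one_mul]
  -- Eckart–Young reads `‖D - N‖ ≤ ‖N‖` for `D = Y - X`; expanding the squares removes `‖N‖²`, which
  -- is not controlled by the rank.
  have h4 : frobNorm (Y - X) ^ 2 ≤ 2 * frobInner N (Y - X) := by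
    have h := pow_le_pow_left₀ (frobNorm_nonneg _) (hY.frobNorm_sub_le hX) 2
    rw [show Y - W = (Y - X) - N by rw [hNdef]; abel, show X - W = -N by rw [hNdef]; abel] at h
    generalize Y - X = D at h ⊢
    rw [frobNorm_neg, frobNorm_sq, frobNorm_sq, frobInner_sub_left, frobInner_sub_right D D N,
      frobInner_sub_right N D N, frobInner_comm D N] at h
    rw [frobNorm_sq]
    linarith
  have h5 := frobInner_le ((A * Aᵀ) * N) (Y - X)
  have h6 := frobInner_le (N * (V * Vᵀ)) ((1 - A * Aᵀ) * (Y - X))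
  have h7 := hA.compl.frobNorm_mul_left_le (Y - X)
  have h8 := frobNorm_nonneg (Y - X)
  have h9 : frobInner N (Y - X) ≤ 2 * (√r * τ) * frobNorm (Y - X) := by
    rw [h3]
    have a1 := mul_le_mul_of_nonneg_right h1 h8
    have a2 := mul_le_mul h2 h7 (frobNorm_nonneg _) (by positivity)
    linarith
  by_contra hlt
  rw [not_le] at hlt
  have : 0 < frobNorm (Y - X) := lt_of_le_of_lt (by positivity) hlt
  nlinarith

end HardThreshold

end MatrixCompletion

namespace MatrixCompletion

variable {n m r : ℕ}

/-! ### The sampling form -/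

section SampleForm

variable (ω : Fin m → Fin n × Fin n)

/-- The number of occurrences of `(i, j)` in the sample. -/
def sampleCount (i j : Fin n) : ℕ := (Finset.univ.filter fun k => ω k = (i, j)).card

/-- A square root of the sampling operator. -/
noncomputable def sqrtSample (Z : Matrix (Fin n) (Fin n) ℝ) : Matrix (Fin n) (Fin n) ℝ :=
  Matrix.of fun i j => √(sampleCount ω i j) * Z i j

theorem frobInner_sample (Z W : Matrix (Fin n) (Fin n) ℝ) :
    frobInner Z (sample ω W) = frobInner (sqrtSample ω Z) (sqrtSample ω W) := by
  simp only [frobInner, sample, sqrtSample, Matrix.of_apply]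
  refine Finset.sum_congr rfl fun i _ => Finset.sum_congr rfl fun j _ => ?_
  have := Real.mul_self_sqrt (Nat.cast_nonneg (α := ℝ) (sampleCount ω i j))
  change Z i j * ((sampleCount ω i j : ℝ) * W i j) = _
  linear_combination (-(Z i j * W i j)) * this

theorem sqrtSample_add (Z W : Matrix (Fin n) (Fin n) ℝ) :
    sqrtSample ω (Z + W) = sqrtSample ω Z + sqrtSample ω W := by
  ext i j; simp [sqrtSample, mul_add]

theorem sqrtSample_sub (Z W : Matrix (Fin n) (Fin n) ℝ) :
    sqrtSample ω (Z - W) = sqrtSample ω Z - sqrtSample ω W := by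
  ext i j; simp [sqrtSample, mul_sub]

theorem sqrtSample_smul (c : ℝ) (Z : Matrix (Fin n) (Fin n) ℝ) :
    sqrtSample ω (c • Z) = c • sqrtSample ω Z := by
  ext i j; simp [sqrtSample, mul_left_comm]

theorem frobInner_sample_comm (Z W : Matrix (Fin n) (Fin n) ℝ) :
    frobInner Z (sample ω W) = frobInner W (sample ω Z) := by
  rw [frobInner_sample, frobInner_comm, ← frobInner_sample]

theorem frobInner_sample_self (Z : Matrix (Fin n) (Fin n) ℝ) :
    frobInner Z (sample ω Z) = frobNorm (sqrtSample ω Z) ^ 2 := by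
  rw [frobInner_sample, frobNorm_sq]

/-- The only estimate used for matrices outside a tangent space. A negative `L` is possible only
when there are no entries. -/
theorem frobNorm_sqrtSample_le {L : ℝ} (hL : ∀ i j, (sampleCount ω i j : ℝ) ≤ L)
    (Z : Matrix (Fin n) (Fin n) ℝ) : frobNorm (sqrtSample ω Z) ≤ √L * frobNorm Z := by
  rw [frobNorm, frobNorm]
  by_cases hL0 : 0 ≤ L
  · rw [← Real.sqrt_mul hL0]
    refine Real.sqrt_le_sqrt ?_
    simp only [frobInner, Finset.mul_sum, sqrtSample, Matrix.of_apply]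
    refine Finset.sum_le_sum fun i _ => Finset.sum_le_sum fun j _ => ?_
    have := Real.mul_self_sqrt (Nat.cast_nonneg (α := ℝ) (sampleCount ω i j))
    nlinarith [mul_le_mul_of_nonneg_right (hL i j) (mul_self_nonneg (Z i j))]
  · have h0 : frobInner (sqrtSample ω Z) (sqrtSample ω Z) = 0 :=
      Finset.sum_eq_zero fun i _ => absurd ((Nat.cast_nonneg _).trans (hL i i)) hL0
    rw [h0, Real.sqrt_zero]
    positivity

end SampleForm

/-! ### One step of the methods -/

section Step

variable {ω : Fin m → Fin n × Fin n} {T : Submodule ℝ (Matrix (Fin n) (Fin n) ℝ)} {p δ : ℝ}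

/-- The sampling operator acts on `T` like `p` times the identity, up to a relative error `δ`. -/
def NearIsometry (ω : Fin m → Fin n × Fin n) (p δ : ℝ)
    (T : Submodule ℝ (Matrix (Fin n) (Fin n) ℝ)) : Prop :=
  ∀ Z ∈ T, ∀ W ∈ T, |frobInner Z (sample ω W) - p * frobInner Z W| ≤
    δ * p * (frobNorm Z * frobNorm W)

/-- Polarization. -/
theorem nearIsometry_of_sq
    (h : ∀ Z ∈ T, |frobInner Z (sample ω Z) - p * frobInner Z Z| ≤ δ * p * frobNorm Z ^ 2) :
    NearIsometry ω p δ T := by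
  have hpol : ∀ Z ∈ T, ∀ W ∈ T, |frobInner Z (sample ω W) - p * frobInner Z W| ≤
      δ * p * ((frobNorm Z ^ 2 + frobNorm W ^ 2) / 2) := by
    intro Z hZ W hW
    have h1 := abs_le.mp (h _ (T.add_mem hZ hW))
    have h2 := abs_le.mp (h _ (T.sub_mem hZ hW))
    simp only [frobInner_sample, frobNorm_sq, sqrtSample_add, sqrtSample_sub, frobInner_add_left,
      frobInner_add_right, frobInner_sub_left, frobInner_sub_right, frobInner_comm W Z,
      frobInner_comm (sqrtSample ω W) (sqrtSample ω Z)] at h1 h2 ⊢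
    rw [abs_le]
    constructor <;> linarith [h1.1, h1.2, h2.1, h2.2]
  intro Z hZ W hW
  rcases (frobNorm_nonneg Z).eq_or_lt with hz | hz
  · rw [eq_zero_of_frobNorm_eq_zero hz.symm]
    simp [frobInner, frobNorm]
  rcases (frobNorm_nonneg W).eq_or_lt with hw | hw
  · rw [eq_zero_of_frobNorm_eq_zero hw.symm]
    simp [frobInner, frobNorm, sample]
  -- Rescaling `Z` and `W` to equal norms turns the mean of the squares into the product of the
  -- norms.
  have h3 := hpol _ (T.smul_mem (frobNorm W) hZ) _ (T.smul_mem (frobNorm Z) hW)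
  simp only [frobInner_sample, sqrtSample_smul, frobInner_smul_left, frobInner_smul_right,
    frobNorm_smul, abs_of_pos hz, abs_of_pos hw] at h3
  rw [frobInner_sample]
  have e : frobNorm Z * (frobNorm W * frobInner (sqrtSample ω Z) (sqrtSample ω W)) -
      p * (frobNorm Z * (frobNorm W * frobInner Z W)) =
      (frobNorm W * frobNorm Z) * (frobInner (sqrtSample ω Z) (sqrtSample ω W) -
        p * frobInner Z W) := by ring
  rw [e, abs_mul, abs_of_pos (mul_pos hw hz)] at h3
  refine le_of_mul_le_mul_left (h3.trans_eq ?_) (mul_pos hw hz)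
  ring

theorem NearIsometry.sq_le (h : NearIsometry ω p δ T) {Z : Matrix (Fin n) (Fin n) ℝ}
    (hZ : Z ∈ T) : (1 - δ) * p * frobNorm Z ^ 2 ≤ frobInner Z (sample ω Z) ∧
      frobInner Z (sample ω Z) ≤ (1 + δ) * p * frobNorm Z ^ 2 := by
  have := abs_le.mp (h Z hZ Z hZ)
  rw [← frobNorm_sq] at this
  constructor <;> nlinarith [this.1, this.2]

/-- The effect of the exact line search along a direction that is conjugate to its difference from
the gradient. -/
theorem NearIsometry.stepsize_smul_sub_le (h : NearIsometry ω p δ T) (hp : 0 < p)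
    (hδ1 : δ < 1) {G D : Matrix (Fin n) (Fin n) ℝ} (hG : G ∈ T) (hD : D ∈ T)
    (horth : frobInner (D - G) (sample ω D) = 0) :
    frobNorm (stepsize ω G D • D - p⁻¹ • D) ≤ p⁻¹ * (δ / (1 - δ)) * frobNorm G := by
  have hδ' : 0 < 1 - δ := by linarith
  -- The sign of `δ` is not assumed; near isometry at `G` itself forces this product to be
  -- nonnegative.
  have hδG : 0 ≤ δ * frobNorm G := by
    have h0 := (abs_nonneg _).trans (h G hG G hG)
    rcases (frobNorm_nonneg G).eq_or_lt with hz | hz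
    · rw [← hz, mul_zero]
    · have : 0 ≤ (p * frobNorm G) * (δ * frobNorm G) := by linarith
      exact nonneg_of_mul_nonneg_right this (by positivity)
  have hrhs : 0 ≤ p⁻¹ * (δ / (1 - δ)) * frobNorm G := by
    have : p⁻¹ * (δ / (1 - δ)) * frobNorm G = p⁻¹ * ((δ * frobNorm G) / (1 - δ)) := by ring
    rw [this]; positivity
  rw [← sub_smul, frobNorm_smul]
  rcases (frobNorm_nonneg D).eq_or_lt with hz | hz
  · rw [← hz, mul_zero]; exact hrhs
  have hDD := (h.sq_le hD).1
  have hpos : 0 < frobInner D (sample ω D) := lt_of_lt_of_le (by positivity) hDD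
  -- Conjugacy makes the numerator of the ideal Rayleigh quotient equal to the denominator `B`, so
  -- the stepsize differs from `p⁻¹` only by the near-isometry error of the pair `G`, `D`.
  have hGD : frobInner G (sample ω D) = frobInner D (sample ω D) := by
    rw [frobInner_sub_left] at horth; linarith
  have h1 := h G hG D hD
  rw [hGD] at h1
  set B := frobInner D (sample ω D) with hB
  have e : stepsize ω G D - p⁻¹ = -(p⁻¹ * ((B - p * frobInner G D) / B)) := by
    rw [stepsize, ← hB]; field_simp; ring
  rw [e, abs_neg, abs_mul, abs_div, abs_of_pos hpos, abs_of_pos (inv_pos.mpr hp), mul_assoc,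
    mul_assoc]
  refine mul_le_mul_of_nonneg_left ?_ (inv_pos.mpr hp).le
  rw [div_mul_eq_mul_div, div_mul_eq_mul_div, div_le_div_iff₀ hpos hδ']
  have h2 := mul_le_mul_of_nonneg_right h1 (mul_nonneg hz.le hδ'.le)
  have h3 := mul_le_mul_of_nonneg_left hDD hδG
  linarith

/-- By conjugacy, Cauchy–Schwarz for the sampling form shows that `D` is no longer than `G` in that
form. Near isometry converts this to Frobenius norms with ratio `√((1 + δ) / (1 - δ))`, which is at
most `1 + 2δ` in the given range. -/
theorem NearIsometry.frobNorm_direction_le (h : NearIsometry ω p δ T) (hp : 0 < p) (hδ0 : 0 ≤ δ)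
    (hδ1 : δ ≤ 1 / 4) {G D : Matrix (Fin n) (Fin n) ℝ} (hG : G ∈ T) (hD : D ∈ T)
    (horth : frobInner (D - G) (sample ω D) = 0) : frobNorm D ≤ (1 + 2 * δ) * frobNorm G := by
  have h1 := (h.sq_le hD).1
  have h2 := (h.sq_le hG).2
  have h3 : frobInner D (sample ω D) ≤ frobInner G (sample ω G) := by
    rw [frobInner_sub_left] at horth
    have h4 := frobInner_le (sqrtSample ω G) (sqrtSample ω D)
    rw [← frobInner_sample, ← sub_eq_zero.mp horth] at h4
    rw [frobInner_sample_self] at h4 ⊢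
    rw [frobInner_sample_self]
    have a1 := frobNorm_nonneg (sqrtSample ω D)
    have a2 := frobNorm_nonneg (sqrtSample ω G)
    refine pow_le_pow_left₀ a1 ?_ 2
    by_contra hlt
    rw [not_le] at hlt
    nlinarith
  have hG0 := frobNorm_nonneg G
  refine le_of_sq_le_sq ?_ (by positivity)
  have h5 : (1 - δ) * frobNorm D ^ 2 ≤ (1 + δ) * frobNorm G ^ 2 := by
    refine le_of_mul_le_mul_left ?_ hp
    linarith
  have h6 : (1 + δ) ≤ (1 - δ) * (1 + 2 * δ) ^ 2 := by nlinarith [mul_nonneg hδ0 hδ0]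
  have h7 := mul_le_mul_of_nonneg_right h6 (sq_nonneg (frobNorm G))
  refine le_of_mul_le_mul_left (a := 1 - δ) ?_ (by linarith)
  rw [mul_pow]
  linarith

variable {κ₁ κ₂ : ℝ}

/-- The weight is the Gram–Schmidt coefficient for the sampling form; after a restart the added
multiple of `Q` is zero. A vanishing denominator also gives weight zero. -/
theorem restartedWeight_orthogonal (G Q : Matrix (Fin n) (Fin n) ℝ) :
    frobInner (restartedWeight κ₁ κ₂ ω G Q • Q)
      (sample ω (G + restartedWeight κ₁ κ₂ ω G Q • Q)) = 0 := by
  unfold restartedWeight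
  split_ifs
  · rw [frobInner_sample_comm ω G Q]
    generalize hβ : -(frobInner Q (sample ω G) / frobInner Q (sample ω Q)) = β
    rw [frobInner_smul_left, frobInner_sample, sqrtSample_add, sqrtSample_smul,
      frobInner_add_right, frobInner_smul_right, ← frobInner_sample, ← frobInner_sample, ← hβ]
    by_cases h0 : frobInner Q (sample ω Q) = 0
    · simp [h0]
    · field_simp
      ring
  · simp [frobInner]

/-- The first restart test bounds the Frobenius angle, near isometry transfers it to the sampling
form at the price of `δ`, and the second test replaces `‖G‖` by `κ₂ ‖Q‖`. -/
theorem NearIsometry.frobNorm_restartedWeight_smul_le (h : NearIsometry ω p δ T) (hp : 0 < p)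
    (hδ0 : 0 ≤ δ) (hδ1 : δ < 1) (hκ₁ : 0 ≤ κ₁) (hκ₂ : 0 ≤ κ₂)
    {G Q : Matrix (Fin n) (Fin n) ℝ} (hG : G ∈ T) (hQ : Q ∈ T) :
    frobNorm (restartedWeight κ₁ κ₂ ω G Q • Q) ≤
      (κ₁ + δ) / (1 - δ) * κ₂ * frobNorm Q := by
  have hδ' : 0 < 1 - δ := by linarith
  have hrhs : 0 ≤ (κ₁ + δ) / (1 - δ) * κ₂ * frobNorm Q := by
    have := frobNorm_nonneg Q
    positivity
  rw [frobNorm_smul]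
  rcases (frobNorm_nonneg Q).eq_or_lt with hz | hz
  · rw [← hz]; simp
  unfold restartedWeight
  split_ifs with hk
  · obtain ⟨hk1, hk2⟩ := hk
    have hin : |frobInner G Q| ≤ κ₁ * (frobNorm G * frobNorm Q) := by
      rcases (frobNorm_nonneg G).eq_or_lt with hg | hg
      · rw [eq_zero_of_frobNorm_eq_zero hg.symm]; simp [frobInner, frobNorm]
      · rwa [div_le_iff₀ (mul_pos hg hz)] at hk1
    have hQQ := (h.sq_le hQ).1
    have hpos : 0 < frobInner Q (sample ω Q) := lt_of_lt_of_le (by positivity) hQQ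
    have h1 := abs_le.mp (h G hG Q hQ)
    have h2 : |frobInner G (sample ω Q)| ≤ (κ₁ + δ) * p * (frobNorm G * frobNorm Q) := by
      have h3 := abs_le.mp hin
      rw [abs_le]
      constructor <;> nlinarith [mul_le_mul_of_nonneg_left h3.1 hp.le,
        mul_le_mul_of_nonneg_left h3.2 hp.le, h1.1, h1.2]
    rw [abs_neg, abs_div, abs_of_pos hpos, mul_assoc, div_mul_eq_mul_div, div_mul_eq_mul_div,
      div_le_div_iff₀ hpos hδ']
    have h4 : |frobInner G (sample ω Q)| ≤ (κ₁ + δ) * p * (κ₂ * frobNorm Q * frobNorm Q) :=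
      h2.trans (mul_le_mul_of_nonneg_left (mul_le_mul_of_nonneg_right hk2 hz.le)
        (by positivity))
    have h5 := mul_le_mul_of_nonneg_right h4 (mul_nonneg hz.le hδ'.le)
    have h6 := mul_le_mul_of_nonneg_left hQQ
      (show 0 ≤ (κ₁ + δ) * (κ₂ * frobNorm Q) by positivity)
    linarith
  · simpa using hrhs

/-- The distance to the target after the line search. -/
theorem NearIsometry.frobNorm_sub_stepsize_le (h : NearIsometry ω p δ T) (hp : 0 < p)
    (hδ0 : 0 ≤ δ) (hδ1 : δ ≤ 1 / 4) {E G D : Matrix (Fin n) (Fin n) ℝ} (hG : G ∈ T) (hD : D ∈ T)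
    (horth : frobInner (D - G) (sample ω D) = 0)
    (hE : frobNorm (p⁻¹ • G - E) ≤ δ * frobNorm E) :
    frobNorm (stepsize ω G D • D - E) ≤ 3 * δ * frobNorm E + p⁻¹ * frobNorm (D - G) := by
  have h1 := h.stepsize_smul_sub_le hp (by linarith) hG hD horth
  have e : stepsize ω G D • D - E =
      (stepsize ω G D • D - p⁻¹ • D) + p⁻¹ • (D - G) + (p⁻¹ • G - E) := by
    rw [smul_sub]; abel
  have h2 : p⁻¹ * frobNorm G ≤ (1 + δ) * frobNorm E := by
    have h3 := frobNorm_add_le (p⁻¹ • G - E) E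
    rw [sub_add_cancel, frobNorm_smul, abs_of_pos (inv_pos.mpr hp)] at h3
    linarith
  have h4 : δ / (1 - δ) ≤ 4 / 3 * δ := by
    rw [div_le_iff₀ (by linarith)]; nlinarith
  have hE0 := frobNorm_nonneg E
  have hG0 : 0 ≤ p⁻¹ * frobNorm G := mul_nonneg (inv_pos.mpr hp).le (frobNorm_nonneg G)
  have h5 : p⁻¹ * (δ / (1 - δ)) * frobNorm G ≤ 4 / 3 * δ * ((1 + δ) * frobNorm E) := by
    calc p⁻¹ * (δ / (1 - δ)) * frobNorm G = δ / (1 - δ) * (p⁻¹ * frobNorm G) := by ring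
      _ ≤ _ := mul_le_mul h4 h2 hG0 (by positivity)
  -- Since `δ ≤ 1/4`, the factor `4/3 (1 + δ)` is at most `5/3`; together with the gradient error
  -- `δ` this stays below `3δ`.
  have h6 : 4 / 3 * δ * ((1 + δ) * frobNorm E) ≤ 2 * δ * frobNorm E := by
    have : 0 ≤ δ * frobNorm E := by positivity
    nlinarith
  rw [e]
  refine (frobNorm_add_le _ _).trans ((add_le_add_left (frobNorm_add_le _ _) _).trans ?_)
  rw [frobNorm_smul, abs_of_pos (inv_pos.mpr hp)]
  linarith

end Step

/-! ### Convergence for good samples -/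

section Convergence

/-- The tangent space `{U Z₁ᵀ + Z₂ Vᵀ}` as the fixed space of its projection. -/
def tangentSpace (U V : Matrix (Fin n) (Fin r) ℝ) : Submodule ℝ (Matrix (Fin n) (Fin n) ℝ) where
  carrier := {Z | tangentProj U V Z = Z}
  add_mem' := fun {Z W} hZ hW => by
    simp only [Set.mem_ofPred_eq] at *
    rw [tangentProj_add, hZ, hW]
  zero_mem' := by simp [tangentProj]
  smul_mem' := fun c Z hZ => by
    simp only [Set.mem_ofPred_eq] at *
    rw [tangentProj_smul, hZ]

theorem mem_tangentSpace {U V : Matrix (Fin n) (Fin r) ℝ} {Z : Matrix (Fin n) (Fin n) ℝ} :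
    Z ∈ tangentSpace U V ↔ tangentProj U V Z = Z := Iff.rfl

/-- The deterministic properties of the sample that imply convergence: bounded multiplicities,
near isometry on the tangent space of the target, and a good initial guess. Here `p` is the sampling
density and `c` a lower bound for the singular values of the target. -/
structure IsGoodSample (ω : Fin m → Fin n × Fin n) (X : Matrix (Fin n) (Fin n) ℝ)
    (U V : Matrix (Fin n) (Fin r) ℝ) (p a c L : ℝ) : Prop where
  count_le : ∀ i j, (sampleCount ω i j : ℝ) ≤ L
  near_isometry : ∀ Z ∈ tangentSpace U V,
    |frobInner Z (sample ω Z) - p * frobInner Z Z| ≤ a * p * frobNorm Z ^ 2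
  init : ∀ X₀, IsOneStepInit r ω X X₀ → frobNorm (X₀ - X) * √L ≤ a * c * √p

variable {ω : Fin m → Fin n × Fin n} {X Y : Matrix (Fin n) (Fin n) ℝ}
  {U V U' V' : Matrix (Fin n) (Fin r) ℝ} {σ s : Fin r → ℝ} {p a c L : ℝ}

theorem tangentProj_sub (Z W : Matrix (Fin n) (Fin n) ℝ) :
    tangentProj U V (Z - W) = tangentProj U V Z - tangentProj U V W := by
  rw [sub_eq_add_neg, tangentProj_add, ← neg_one_smul ℝ W, tangentProj_smul, neg_one_smul,
    ← sub_eq_add_neg]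

theorem IsThinSVD.mem_tangentSpace (hY : IsThinSVD Y U s V) : Y ∈ tangentSpace U V := by
  rw [MatrixCompletion.mem_tangentSpace, tangentProj, hY.left_mul, hY.right_mul,
    add_sub_cancel_right]

/-- Write `Z` in the new tangent space as its projection `W` to the old one plus a remainder of
relative size `4‖Y - X‖ / c`. The closeness hypothesis is scaled so that the remainder contributes
at most `4a √p ‖Z‖` in the sampling form, even with the crude bound `√L`. -/
theorem IsGoodSample.nearIsometry (h : IsGoodSample ω X U V p a c L) (hX : IsThinSVD X U σ V)
    (hY : IsThinSVD Y U' s V') (hp : 0 < p) (hpL : p ≤ L) (ha0 : 0 ≤ a) (ha1 : a ≤ 1 / 100)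
    (hc : 0 < c) (hσ : ∀ i, c ≤ σ i) (hclose : frobNorm (Y - X) * √L ≤ a * c * √p) :
    NearIsometry ω p (20 * a) (tangentSpace U' V') := by
  refine nearIsometry_of_sq fun Z hZ => ?_
  set W := tangentProj U V Z with hW
  have hWT : W ∈ tangentSpace U V :=
    tangentProj_idem hX.left_orthonormal hX.right_orthonormal Z
  have hs : 0 < √p := Real.sqrt_pos.mpr hp
  have hs2 : √p ^ 2 = p := Real.sq_sqrt hp.le
  have hsL : √p ≤ √L := Real.sqrt_le_sqrt hpL
  have hz := frobNorm_nonneg Z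
  have he := frobNorm_nonneg (Y - X)
  have hec : √L * (frobNorm (Y - X) / c) ≤ a * √p := by
    rw [← mul_div_assoc, div_le_iff₀ hc]; linarith
  have hec' : frobNorm (Y - X) / c ≤ a := by
    have h0 : 0 ≤ frobNorm (Y - X) / c := by positivity
    have : √p * (frobNorm (Y - X) / c) ≤ √p * a :=
      (mul_le_mul_of_nonneg_right hsL h0).trans (by linarith)
    exact le_of_mul_le_mul_left this hs
  have hd := hX.frobNorm_tangentProj_sub_le hY hc hσ Z
  rw [MatrixCompletion.mem_tangentSpace.mp hZ, ← hW] at hd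
  have hWZ : frobNorm W ≤ frobNorm Z :=
    frobNorm_tangentProj_le hX.left_orthonormal hX.right_orthonormal Z
  have hWZ' : (1 - 4 * a) * frobNorm Z ≤ frobNorm W := by
    have h1 := frobNorm_add_le (Z - W) W
    rw [sub_add_cancel] at h1
    have := mul_le_mul_of_nonneg_right hec' hz
    linarith
  have hRd : frobNorm (sqrtSample ω (Z - W)) ≤ 4 * a * √p * frobNorm Z := by
    refine (frobNorm_sqrtSample_le ω h.count_le _).trans ?_
    have h1 := mul_le_mul_of_nonneg_left hd (Real.sqrt_nonneg L)
    have h2 := mul_le_mul_of_nonneg_right hec hz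
    linarith
  have hiso := abs_le.mp (h.near_isometry W hWT)
  rw [frobInner_sample_self, ← frobNorm_sq] at hiso
  have hw := frobNorm_nonneg W
  have hRW1 : frobNorm (sqrtSample ω W) ≤ √p * ((1 + a) * frobNorm W) := by
    refine le_of_sq_le_sq ?_ (by positivity)
    have : 0 ≤ a * (p * frobNorm W ^ 2) := by positivity
    rw [mul_pow, mul_pow, hs2]
    nlinarith [hiso.2, mul_nonneg ha0 this]
  have hRW2 : √p * ((1 - a) * frobNorm W) ≤ frobNorm (sqrtSample ω W) := by
    refine le_of_sq_le_sq ?_ (frobNorm_nonneg _)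
    have : 0 ≤ a * (p * frobNorm W ^ 2) := by positivity
    rw [mul_pow, mul_pow, hs2]
    nlinarith [hiso.1, mul_nonneg (show 0 ≤ 1 - a by linarith) this]
  have e1 : frobNorm (sqrtSample ω Z) ≤ √p * ((1 + 5 * a) * frobNorm Z) := by
    have h1 := frobNorm_add_le (sqrtSample ω (Z - W)) (sqrtSample ω W)
    rw [← sqrtSample_add, sub_add_cancel] at h1
    have := mul_le_mul_of_nonneg_left hWZ (show 0 ≤ √p * (1 + a) by positivity)
    linarith
  have e2 : √p * ((1 - 9 * a) * frobNorm Z) ≤ frobNorm (sqrtSample ω Z) := by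
    have h1 := frobNorm_sub_le (sqrtSample ω Z) (sqrtSample ω (Z - W))
    rw [← sqrtSample_sub, sub_sub_cancel] at h1
    have h2 := mul_le_mul_of_nonneg_left hWZ'
      (show 0 ≤ √p * (1 - a) from mul_nonneg hs.le (by linarith))
    have h3 : 0 ≤ a * a * (√p * frobNorm Z) := by positivity
    linarith
  have q1 := pow_le_pow_left₀ (frobNorm_nonneg _) e1 2
  have q2 := pow_le_pow_left₀ (mul_nonneg hs.le (mul_nonneg (by linarith) hz)) e2 2
  rw [mul_pow, mul_pow, hs2] at q1 q2
  have hpz : 0 ≤ p * frobNorm Z ^ 2 := by positivity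
  rw [frobInner_sample_self, ← frobNorm_sq Z, abs_le]
  constructor
  · nlinarith [mul_nonneg ha0 hpz, mul_nonneg (mul_nonneg ha0 ha0) hpz]
  · nlinarith [mul_nonneg ha0 hpz, mul_nonneg (mul_nonneg ha0 (show 0 ≤ 1 - 25 * a by linarith)) hpz]

/-- The normal part `E - F` of the error is quadratically small, and for the tangential part near
isometry applies. The sum of the losses is `22a + a`, rounded up to `25a`. -/
theorem IsGoodSample.frobNorm_grad_sub_le (h : IsGoodSample ω X U V p a c L)
    (hX : IsThinSVD X U σ V) (hY : IsThinSVD Y U' s V') (hp : 0 < p) (hpL : p ≤ L) (ha0 : 0 ≤ a)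
    (ha1 : a ≤ 1 / 100) (hc : 0 < c) (hσ : ∀ i, c ≤ σ i)
    (hclose : frobNorm (Y - X) * √L ≤ a * c * √p) :
    frobNorm (p⁻¹ • tangentGrad ω X Y U' V' - (X - Y)) ≤ 25 * a * frobNorm (X - Y) := by
  have hiso := h.nearIsometry hX hY hp hpL ha0 ha1 hc hσ hclose
  have hU' := hY.left_orthonormal
  have hV' := hY.right_orthonormal
  have hs : 0 < √p := Real.sqrt_pos.mpr hp
  have hs2 : √p * √p = p := Real.mul_self_sqrt hp.le
  have hsL : √p ≤ √L := Real.sqrt_le_sqrt hpL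
  have he := frobNorm_nonneg (Y - X)
  have hec : √L * (frobNorm (Y - X) / c) ≤ a * √p := by
    rw [← mul_div_assoc, div_le_iff₀ hc]; linarith
  have hec' : frobNorm (Y - X) / c ≤ a := by
    have h0 : 0 ≤ frobNorm (Y - X) / c := by positivity
    have : √p * (frobNorm (Y - X) / c) ≤ √p * a :=
      (mul_le_mul_of_nonneg_right hsL h0).trans (by linarith)
    exact le_of_mul_le_mul_left this hs
  set E := X - Y with hE
  have heE : frobNorm (Y - X) = frobNorm E := frobNorm_sub_comm _ _
  rw [heE] at he hec hec'
  set F := tangentProj U' V' E with hF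
  have hFT : F ∈ tangentSpace U' V' := tangentProj_idem hU' hV' E
  have hperp : E - F = X - tangentProj U' V' X := by
    rw [hF, hE, tangentProj_sub, MatrixCompletion.mem_tangentSpace.mp hY.mem_tangentSpace]; abel
  have hperp1 : frobNorm (E - F) ≤ frobNorm E / c * frobNorm E := by
    rw [hperp, ← heE]; exact hX.frobNorm_sub_tangentProj_le hY hc hσ
  have hperp2 : frobNorm (E - F) ≤ a * frobNorm E :=
    hperp1.trans (mul_le_mul_of_nonneg_right hec' he)
  have hperp3 : frobNorm (sqrtSample ω (E - F)) ≤ a * √p * frobNorm E := by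
    refine (frobNorm_sqrtSample_le ω h.count_le _).trans ?_
    have h1 := mul_le_mul_of_nonneg_left hperp1 (Real.sqrt_nonneg L)
    have h2 := mul_le_mul_of_nonneg_right hec he
    linarith
  set H := p⁻¹ • tangentGrad ω X Y U' V' - F with hH
  have hHT : H ∈ tangentSpace U' V' :=
    Submodule.sub_mem _ (Submodule.smul_mem _ _ (tangentProj_idem hU' hV' _)) hFT
  -- `H` is tested against itself: being tangential, it can absorb the projection in the gradient,
  -- which leaves a near-isometry defect and the sampled normal part.
  have hHH : frobNorm H ^ 2 = p⁻¹ * (frobInner H (sample ω F) - p * frobInner H F) +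
      p⁻¹ * frobInner (sqrtSample ω H) (sqrtSample ω (E - F)) := by
    have e1 : frobInner H (tangentGrad ω X Y U' V') = frobInner H (sample ω E) := by
      rw [tangentGrad, ← frobInner_tangentProj hU' hV', MatrixCompletion.mem_tangentSpace.mp hHT]
    rw [frobNorm_sq]
    have e2 : frobInner H H = p⁻¹ * frobInner H (sample ω E) - frobInner H F := by
      rw [← e1, ← frobInner_smul_right, ← frobInner_sub_right]
    rw [e2, frobInner_sample, frobInner_sample, sqrtSample_sub ω E F, frobInner_sub_right]
    field_simp
    ring
  have hHn := frobNorm_nonneg H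
  have hFn : frobNorm F ≤ frobNorm E := frobNorm_tangentProj_le hU' hV' E
  have t1 := (abs_le.mp (hiso H hHT F hFT)).2
  have t2 : frobNorm (sqrtSample ω H) ≤ √p * (2 * frobNorm H) := by
    have h2 := (hiso.sq_le hHT).2
    rw [frobInner_sample_self] at h2
    refine le_of_sq_le_sq (h2.trans ?_) (by positivity)
    rw [mul_pow, pow_two √p, hs2, mul_pow]
    have : 0 ≤ p * frobNorm H ^ 2 := by positivity
    nlinarith
  have t3 : frobInner (sqrtSample ω H) (sqrtSample ω (E - F)) ≤
      p * (2 * a * frobNorm H * frobNorm E) := by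
    refine (frobInner_le _ _).trans ((mul_le_mul t2 hperp3 (frobNorm_nonneg _)
      (by positivity)).trans_eq ?_)
    linear_combination (2 * a * frobNorm H * frobNorm E) * hs2
  have t4 : frobInner H (sample ω F) - p * frobInner H F ≤
      p * (20 * a * frobNorm H * frobNorm E) := by
    have := mul_le_mul_of_nonneg_left hFn (show 0 ≤ 20 * a * p * frobNorm H by positivity)
    linarith
  have t5 : frobNorm H ^ 2 ≤ 22 * a * frobNorm H * frobNorm E := by
    have u1 := mul_le_mul_of_nonneg_left t3 (inv_pos.mpr hp).le
    have u2 := mul_le_mul_of_nonneg_left t4 (inv_pos.mpr hp).le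
    rw [inv_mul_cancel_left₀ hp.ne'] at u1 u2
    linarith
  have t6 : frobNorm H ≤ 22 * a * frobNorm E := by
    rcases hHn.eq_or_lt with hz | hz
    · rw [← hz]; positivity
    · refine le_of_mul_le_mul_left (a := frobNorm H) ?_ hz
      linarith
  have t7 := frobNorm_sub_le H (E - F)
  have e3 : p⁻¹ • tangentGrad ω X Y U' V' - E = H - (E - F) := by rw [hH]; abel
  rw [e3]
  have : 0 ≤ a * frobNorm E := by positivity
  linarith

theorem tendsto_of_frobNorm_sub_tendsto {Z : ℕ → Matrix (Fin n) (Fin n) ℝ}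
    (h : Tendsto (fun l => frobNorm (Z l - X)) atTop (𝓝 0)) : Tendsto Z atTop (𝓝 X) := by
  refine tendsto_pi_nhds.mpr fun i => tendsto_pi_nhds.mpr fun j => ?_
  rw [tendsto_iff_norm_sub_tendsto_zero]
  exact squeeze_zero (fun _ => norm_nonneg _)
    (fun l => abs_apply_le_frobNorm (Z l - X) i j) h

/-- A sequence that satisfies a contractive two-term recursion inside a ball tends to zero. -/
theorem tendsto_zero_of_two_term_recursion {e : ℕ → ℝ} {A B ρ : ℝ} (he : ∀ l, 0 ≤ e l)
    (hA : 0 ≤ A) (hB : 0 ≤ B) (hAB : A + B < 1) (h0 : e 0 ≤ ρ) (h1 : e 1 ≤ A * e 0)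
    (hs : ∀ l, e l ≤ ρ → e (l + 1) ≤ ρ → e (l + 2) ≤ A * e (l + 1) + B * e l) :
    Tendsto e atTop (𝓝 0) := by
  -- The square root appears because the factor `A + B` is gained over two indices; `A ≤ A + B = θ²
  -- ≤ θ` handles the first step.
  set θ := √(A + B) with hθ
  have hθ0 : 0 ≤ θ := Real.sqrt_nonneg _
  have hθ2 : θ ^ 2 = A + B := Real.sq_sqrt (by positivity)
  have hθ1 : θ < 1 := by
    rw [hθ, Real.sqrt_lt' one_pos]; linarith
  have hρ : 0 ≤ ρ := (he 0).trans h0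
  have hAθ : A ≤ θ := by nlinarith
  have key : ∀ l, e l ≤ ρ * θ ^ l ∧ e (l + 1) ≤ ρ * θ ^ (l + 1) := by
    intro l
    induction l with
    | zero =>
      refine ⟨by simpa using h0, h1.trans ?_⟩
      have := mul_le_mul hAθ h0 (he 0) hθ0
      simpa [mul_comm] using this
    | succ l ih =>
      refine ⟨ih.2, ?_⟩
      have hl : θ ^ l ≤ 1 := pow_le_one₀ hθ0 hθ1.le
      have hl' : θ ^ (l + 1) ≤ 1 := pow_le_one₀ hθ0 hθ1.le
      have hll : θ ^ (l + 1) ≤ θ ^ l := pow_le_pow_of_le_one hθ0 hθ1.le (Nat.le_succ l)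
      have h2 := hs l (ih.1.trans (by nlinarith)) (ih.2.trans (by nlinarith))
      have h3 : e (l + 1) ≤ ρ * θ ^ l := ih.2.trans (mul_le_mul_of_nonneg_left hll hρ)
      calc e (l + 2) ≤ A * (ρ * θ ^ l) + B * (ρ * θ ^ l) :=
            h2.trans (add_le_add (mul_le_mul_of_nonneg_left h3 hA)
              (mul_le_mul_of_nonneg_left ih.1 hB))
        _ = ρ * θ ^ (l + 2) := by rw [pow_add, hθ2]; ring
  refine squeeze_zero he (fun l => (key l).1) ?_
  simpa using (tendsto_pow_atTop_nhds_zero_of_lt_one hθ0 hθ1).const_mul ρ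

/-- Line search with `δ = 25a` reduces the error by `3δ`, and hard thresholding doubles it: the
contraction factor is `150a`, which also keeps the iterates in the ball where the sample is good. -/
theorem IsGoodSample.rgradConverges (h : IsGoodSample ω X U V p a c L) (hX : IsThinSVD X U σ V)
    (hp : 0 < p) (hpL : p ≤ L) (hL : 0 < L) (ha0 : 0 ≤ a) (ha1 : 150 * a < 1) (hc : 0 < c)
    (hσ : ∀ i, c ≤ σ i) : RGradConverges r X ω := by
  intro Y hY
  refine tendsto_of_frobNorm_sub_tendsto ?_
  have hsL : 0 < √L := Real.sqrt_pos.mpr hL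
  have step : ∀ l, frobNorm (Y l - X) ≤ a * c * √p / √L →
      frobNorm (Y (l + 1) - X) ≤ 150 * a * frobNorm (Y l - X) := by
    intro l hl
    rw [le_div_iff₀ hsL] at hl
    obtain ⟨U', V', s, hs, G, hG, hnext⟩ := hY.step l
    have hiso := h.nearIsometry hX hs hp hpL ha0 (by linarith) hc hσ hl
    have hgrad := h.frobNorm_grad_sub_le hX hs hp hpL ha0 (by linarith) hc hσ hl
    rw [← hG] at hgrad
    have hGT : G ∈ tangentSpace U' V' := by
      rw [hG]; exact tangentProj_idem hs.left_orthonormal hs.right_orthonormal _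
    have hiso' : NearIsometry ω p (25 * a) (tangentSpace U' V') := fun Z hZ W hW =>
      (hiso Z hZ W hW).trans (mul_le_mul_of_nonneg_right (by nlinarith)
        (mul_nonneg (frobNorm_nonneg _) (frobNorm_nonneg _)))
    have h1 := hiso'.frobNorm_sub_stepsize_le hp (by positivity) (by linarith) hGT hGT
      (by simp [frobInner]) hgrad
    rw [sub_self, frobNorm_zero, mul_zero, add_zero, frobNorm_sub_comm X] at h1
    have h2 := hnext.frobNorm_sub_le_two_mul hX
    rw [show Y l + stepsize ω G G • G - X = stepsize ω G G • G - (X - Y l) by abel] at h2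
    linarith
  refine tendsto_zero_of_two_term_recursion (A := 150 * a) (B := 0) (ρ := a * c * √p / √L)
    (fun l => frobNorm_nonneg _) (by positivity) le_rfl (by linarith) ?_ ?_ ?_
  · rw [le_div_iff₀ hsL]; exact h.init _ hY.init
  · exact step 0 (by rw [le_div_iff₀ hsL]; exact h.init _ hY.init)
  · intro l _ hl
    have := step (l + 1) hl
    linarith

/-- The direction carried over has length about `p` times the previous error, so bounding the weight
gives a two-term recursion for the errors. The first step has no old direction, as `D 0 = 0`. -/
theorem IsGoodSample.rcgConverges (h : IsGoodSample ω X U V p a c L) (hX : IsThinSVD X U σ V)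
    (hp : 0 < p) (hpL : p ≤ L) (hL : 0 < L) (ha0 : 0 ≤ a) (ha1 : 300 * a ≤ 1) (hc : 0 < c)
    (hσ : ∀ i, c ≤ σ i) {κ₁ κ₂ : ℝ} (hκ₁ : 0 ≤ κ₁) (hκ₂ : 0 ≤ κ₂)
    (hκ : 150 * a + 3 * (κ₁ + 25 * a) * κ₂ < 1) : RCGConverges κ₁ κ₂ r X ω := by
  intro Y D hY
  refine tendsto_of_frobNorm_sub_tendsto ?_
  have hsL : 0 < √L := Real.sqrt_pos.mpr hL
  have step : ∀ l, frobNorm (Y l - X) ≤ a * c * √p / √L →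
      p⁻¹ * frobNorm (D (l + 1)) ≤ (1 + 50 * a) ^ 2 * frobNorm (Y l - X) ∧
      frobNorm (Y (l + 1) - X) ≤ 150 * a * frobNorm (Y l - X) +
        2 * ((κ₁ + 25 * a) / (1 - 25 * a) * κ₂ * (p⁻¹ * frobNorm (D l))) := by
    intro l hl
    rw [le_div_iff₀ hsL] at hl
    obtain ⟨U', V', s, hs, G, Q, hG, hQ, hD, hnext⟩ := hY.step l
    have hiso := h.nearIsometry hX hs hp hpL ha0 (by linarith) hc hσ hl
    have hgrad := h.frobNorm_grad_sub_le hX hs hp hpL ha0 (by linarith) hc hσ hl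
    rw [← hG] at hgrad
    have hGT : G ∈ tangentSpace U' V' := by
      rw [hG]; exact tangentProj_idem hs.left_orthonormal hs.right_orthonormal _
    have hQT : Q ∈ tangentSpace U' V' := by
      rw [hQ]; exact tangentProj_idem hs.left_orthonormal hs.right_orthonormal _
    have hDT : D (l + 1) ∈ tangentSpace U' V' := by
      rw [hD]; exact Submodule.add_mem _ hGT (Submodule.smul_mem _ _ hQT)
    have hQD : frobNorm Q ≤ frobNorm (D l) := by
      rw [hQ]; exact frobNorm_tangentProj_le hs.left_orthonormal hs.right_orthonormal _
    rw [mem_tangentSpace.mp hDT] at hnext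
    have hiso' : NearIsometry ω p (25 * a) (tangentSpace U' V') := fun Z hZ W hW =>
      (hiso Z hZ W hW).trans (mul_le_mul_of_nonneg_right (by nlinarith)
        (mul_nonneg (frobNorm_nonneg _) (frobNorm_nonneg _)))
    have hDG : D (l + 1) - G = restartedWeight κ₁ κ₂ ω G Q • Q := by
      rw [hD, add_sub_cancel_left]
    have horth : frobInner (D (l + 1) - G) (sample ω (D (l + 1))) = 0 := by
      rw [hDG, hD]; exact restartedWeight_orthogonal G Q
    have h1 := hiso'.frobNorm_sub_stepsize_le hp (by positivity) (by linarith) hGT hDT horth hgrad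
    have h2 := hnext.frobNorm_sub_le_two_mul hX
    have h3 := hiso'.frobNorm_restartedWeight_smul_le hp (by positivity) (by linarith) hκ₁ hκ₂
      hGT hQT
    have h4 := hiso'.frobNorm_direction_le hp (by positivity) (by linarith) hGT hDT horth
    rw [show Y l + stepsize ω G (D (l + 1)) • D (l + 1) - X =
      stepsize ω G (D (l + 1)) • D (l + 1) - (X - Y l) by abel] at h2
    rw [hDG, frobNorm_sub_comm X] at h1
    rw [frobNorm_sub_comm X (Y l)] at hgrad
    have hp' : 0 < p⁻¹ := inv_pos.mpr hp
    have hYn := frobNorm_nonneg (Y l - X)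
    constructor
    · have h5 : p⁻¹ * frobNorm G ≤ (1 + 25 * a) * frobNorm (Y l - X) := by
        have h6 := frobNorm_add_le (p⁻¹ • G - (X - Y l)) (X - Y l)
        rw [sub_add_cancel, frobNorm_smul, abs_of_pos hp', frobNorm_sub_comm X (Y l)] at h6
        linarith
      have h7 := mul_le_mul_of_nonneg_left h4 hp'.le
      have h8 := mul_le_mul_of_nonneg_left h5 (show 0 ≤ 1 + 2 * (25 * a) by positivity)
      have h9 : 0 ≤ a * frobNorm (Y l - X) := by positivity
      nlinarith [mul_nonneg ha0 h9]
    · have hk : 0 ≤ (κ₁ + 25 * a) / (1 - 25 * a) * κ₂ :=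
        mul_nonneg (div_nonneg (by positivity) (by linarith)) hκ₂
      have h5 := mul_le_mul_of_nonneg_left
        (h3.trans (mul_le_mul_of_nonneg_left hQD hk)) hp'.le
      linarith
  have hstep2 : ∀ l, frobNorm (Y l - X) ≤ a * c * √p / √L →
      frobNorm (Y (l + 1) - X) ≤ a * c * √p / √L →
      frobNorm (Y (l + 2) - X) ≤ 150 * a * frobNorm (Y (l + 1) - X) +
        3 * (κ₁ + 25 * a) * κ₂ * frobNorm (Y l - X) := by
    intro l h1 h2
    have h3 := (step l h1).1
    have h4 := (step (l + 1) h2).2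
    have hYn := frobNorm_nonneg (Y l - X)
    -- The bound `300 a ≤ 1` is what makes the accumulated factor `2 (1 + 50a)² / (1 - 25a)` at most
    -- `3`.
    have h5 : (1 + 50 * a) ^ 2 ≤ 3 / 2 * (1 - 25 * a) := by nlinarith
    have h6 : 0 ≤ (κ₁ + 25 * a) / (1 - 25 * a) * κ₂ :=
      mul_nonneg (div_nonneg (by positivity) (by linarith)) hκ₂
    have h7 := mul_le_mul_of_nonneg_left
      (h3.trans (mul_le_mul_of_nonneg_right h5 hYn)) h6
    have h8 : (κ₁ + 25 * a) / (1 - 25 * a) * κ₂ * (3 / 2 * (1 - 25 * a) * frobNorm (Y l - X)) =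
        3 / 2 * (κ₁ + 25 * a) * κ₂ * frobNorm (Y l - X) := by
      have : (1 - 25 * a) ≠ 0 := by linarith
      field_simp
    rw [h8] at h7
    linarith
  refine tendsto_zero_of_two_term_recursion (A := 150 * a) (B := 3 * (κ₁ + 25 * a) * κ₂)
    (ρ := a * c * √p / √L) (fun l => frobNorm_nonneg _) (by positivity) (by positivity) hκ ?_ ?_
    hstep2
  · rw [le_div_iff₀ hsL]; exact h.init _ hY.init
  · have := (step 0 (by rw [le_div_iff₀ hsL]; exact h.init _ hY.init)).2
    rw [hY.init_dir, frobNorm_zero] at this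
    linarith

end Convergence

end MatrixCompletion

namespace MatrixCompletion

variable {n m r : ℕ}

/-! ### Probabilities under the sampling law -/

section Law

instance [NeZero n] : IsProbabilityMeasure (samplingLaw n m) := by
  unfold samplingLaw; infer_instance

-- A product of uniform laws is uniform, so probabilities are counts and the counting form of
-- Bernstein's inequality applies.
open Classical in
theorem samplingLaw_real_eq (S : Set (Fin m → Fin n × Fin n)) :
    (samplingLaw n m).real S =
      ((Finset.univ.filter fun ω => ω ∈ S).card : ℝ) / ((n : ℝ) * n) ^ m := by
  have h : samplingLaw n m = uniformOn Set.univ := by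
    rw [samplingLaw, ← uniformOn_pi, Set.pi_univ]
  have hS : S = ((Finset.univ.filter fun ω => ω ∈ S : Finset (Fin m → Fin n × Fin n)) :
      Set (Fin m → Fin n × Fin n)) := by ext; simp
  rw [h, Measure.real, uniformOn_univ]
  nth_rewrite 1 [hS]
  rw [Measure.count_apply_finset, ENNReal.toReal_div]
  simp

theorem one_sub_le_samplingLaw_real [NeZero n] {S B₁ B₂ B₃ B₄ : Set (Fin m → Fin n × Fin n)}
    (h : ∀ ω, ω ∉ B₁ → ω ∉ B₂ → ω ∉ B₃ → ω ∉ B₄ → ω ∈ S) :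
    1 - ((samplingLaw n m).real B₁ + (samplingLaw n m).real B₂ + (samplingLaw n m).real B₃ +
      (samplingLaw n m).real B₄) ≤ (samplingLaw n m).real S := by
  have h1 : (Set.univ : Set (Fin m → Fin n × Fin n)) ⊆ S ∪ (B₁ ∪ B₂ ∪ B₃ ∪ B₄) := fun ω _ => by
    by_contra hc
    simp only [Set.mem_union, not_or] at hc
    exact hc.1 (h ω hc.2.1.1.1 hc.2.1.1.2 hc.2.1.2 hc.2.2)
  have h2 := measureReal_mono (μ := samplingLaw n m) h1
  rw [probReal_univ] at h2
  have h3 := measureReal_union_le (μ := samplingLaw n m) S (B₁ ∪ B₂ ∪ B₃ ∪ B₄)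
  have h4 := measureReal_union_le (μ := samplingLaw n m) (B₁ ∪ B₂ ∪ B₃) B₄
  have h5 := measureReal_union_le (μ := samplingLaw n m) (B₁ ∪ B₂) B₃
  have h6 := measureReal_union_le (μ := samplingLaw n m) B₁ B₂
  linarith

/-- A Chernoff bound for the multiplicities of the sample. -/
theorem samplingLaw_real_exists_sampleCount_gt_le [NeZero n] (hm : m ≤ n ^ 2) (L : ℝ) :
    (samplingLaw n m).real {ω | ¬ ∀ i j, (sampleCount ω i j : ℝ) ≤ L} ≤
      (n : ℝ) ^ 2 * Real.exp (2 - L) := by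
  classical
  have hn : (0 : ℝ) < n := by exact_mod_cast NeZero.pos n
  have hone : ∀ a : Fin n × Fin n,
      (samplingLaw n m).real {ω | L < (sampleCount ω a.1 a.2 : ℝ)} ≤ Real.exp (2 - L) := by
    intro a
    -- The exponential moment of a multiplicity is a product over the draws. Each factor has mean `1
    -- + (e - 1) / n² ≤ exp (2 / n²)`, and `m ≤ n²` makes the product at most `e²`.
    set f : Fin n × Fin n → ℝ := fun b => if b = a then Real.exp 1 else 1 with hf
    have hprod : ∀ ω : Fin m → Fin n × Fin n,
        ∏ k, f (ω k) = Real.exp (sampleCount ω a.1 a.2) := by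
      intro ω
      rw [hf, Finset.prod_ite, Finset.prod_const, Finset.prod_const_one, mul_one,
        ← Real.exp_nat_mul, mul_one, sampleCount]
    have hsum : ∑ b, f b ≤ (n : ℝ) * n * Real.exp (2 / (n * n)) := by
      have h1 : ∑ b, f b = ∑ b, (1 + if b = a then (Real.exp 1 - 1) else 0) := by
        refine Finset.sum_congr rfl fun b _ => ?_
        rw [hf]; dsimp only; split_ifs <;> ring
      rw [h1, Finset.sum_add_distrib, Finset.sum_ite_eq' Finset.univ a]
      simp only [Finset.sum_const, Finset.card_univ, Fintype.card_prod, Fintype.card_fin,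
        nsmul_eq_mul, Finset.mem_univ, if_true, mul_one]
      have h2 := Real.add_one_le_exp (2 / ((n : ℝ) * n))
      have h3 := mul_le_mul_of_nonneg_left h2 (mul_pos hn hn).le
      have h4 : (n : ℝ) * n * (2 / (n * n) + 1) = 2 + n * n := by field_simp
      have := Real.exp_one_lt_three
      push_cast
      linarith
    have htot : ∑ ω : Fin m → Fin n × Fin n, Real.exp (sampleCount ω a.1 a.2) ≤
        ((n : ℝ) * n) ^ m * Real.exp 2 := by
      simp_rw [← hprod]
      rw [← Fintype.sum_pow]
      have h0 : 0 ≤ ∑ b, f b := Finset.sum_nonneg fun b _ => by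
        rw [hf]; dsimp only; split_ifs <;> positivity
      refine (pow_le_pow_left₀ h0 hsum m).trans ?_
      rw [mul_pow, ← Real.exp_nat_mul]
      refine mul_le_mul_of_nonneg_left (Real.exp_le_exp.mpr ?_) (by positivity)
      have hm' : (m : ℝ) ≤ n * n := by
        have : (m : ℝ) ≤ (n : ℝ) ^ 2 := by exact_mod_cast hm
        linarith
      rw [mul_div_assoc', div_le_iff₀ (by positivity)]
      linarith
    rw [samplingLaw_real_eq, div_le_iff₀ (by positivity)]
    have h5 := Finset.card_nsmul_le_sum (Finset.univ.filter fun ω : Fin m → Fin n × Fin n =>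
      ω ∈ {ω | L < (sampleCount ω a.1 a.2 : ℝ)}) (fun ω => Real.exp (sampleCount ω a.1 a.2))
      (Real.exp L) (fun ω hω => Real.exp_le_exp.mpr
        (by simpa using (Finset.mem_filter.mp hω).2 : L < _).le)
    have h6 := Finset.sum_le_sum_of_subset_of_nonneg (Finset.filter_subset
      (fun ω : Fin m → Fin n × Fin n => ω ∈ {ω | L < (sampleCount ω a.1 a.2 : ℝ)}) Finset.univ)
      (fun ω _ _ => (Real.exp_pos (sampleCount ω a.1 a.2 : ℝ)).le)
    have h7 := (h5.trans h6).trans htot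
    rw [nsmul_eq_mul] at h7
    rw [Real.exp_sub, div_mul_eq_mul_div, le_div_iff₀ (Real.exp_pos L)]
    linarith
  have hsub : {ω : Fin m → Fin n × Fin n | ¬ ∀ i j, (sampleCount ω i j : ℝ) ≤ L} ⊆
      ⋃ a : Fin n × Fin n, {ω | L < (sampleCount ω a.1 a.2 : ℝ)} := by
    intro ω hω
    simp only [Set.mem_ofPred_eq, not_forall, not_le] at hω
    obtain ⟨i, j, hij⟩ := hω
    exact Set.mem_iUnion.mpr ⟨(i, j), hij⟩
  refine (measureReal_mono hsub).trans ((measureReal_iUnion_fintype_le _).trans ?_)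
  refine (Finset.sum_le_sum fun a _ => hone a).trans_eq ?_
  simp [pow_two]

variable {ι : Type*} [Fintype ι] [DecidableEq ι]

theorem sum_sub_mean_sq_le {α : Type*} [Fintype α] (w : α → ℝ) :
    ∑ a, (w a - (Fintype.card α : ℝ)⁻¹ * ∑ b, w b) ^ 2 ≤ ∑ a, w a ^ 2 := by
  cases isEmpty_or_nonempty α
  · simp
  have hN : (0 : ℝ) < Fintype.card α := by exact_mod_cast Fintype.card_pos
  set s := ∑ b, w b with hs
  have : ∑ a, (w a - (Fintype.card α : ℝ)⁻¹ * s) ^ 2 =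
      ∑ a, w a ^ 2 - (Fintype.card α : ℝ)⁻¹ * s ^ 2 := by
    simp only [sub_sq, Finset.sum_add_distrib, Finset.sum_sub_distrib, Finset.sum_const,
      Finset.card_univ, nsmul_eq_mul]
    rw [← Finset.sum_mul, ← Finset.mul_sum, ← hs]
    field_simp
    ring
  rw [this]
  have : 0 ≤ (Fintype.card α : ℝ)⁻¹ * s ^ 2 := by positivity
  linarith

/-- The matrix Bernstein inequality for a sum of independent samples and its mean. -/
theorem samplingLaw_real_bernstein_le [NeZero n] {M : Fin n × Fin n → Matrix ι ι ℝ}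
    (hM : ∀ a, (M a)ᵀ = M a) {R v θ t : ℝ} (hθ : 0 ≤ θ) (hθR : 2 * θ * R ≤ 1)
    (hR : ∀ a x, |x ⬝ᵥ (M a *ᵥ x)| ≤ R * (x ⬝ᵥ x))
    (hvar : ∀ x, ∑ a, (M a *ᵥ x) ⬝ᵥ (M a *ᵥ x) ≤ (n : ℝ) ^ 2 * v * (x ⬝ᵥ x)) :
    (samplingLaw n m).real {ω | ¬ ∀ x, ∑ k, x ⬝ᵥ (M (ω k) *ᵥ x) -
      (m : ℝ) / (n : ℝ) ^ 2 * ∑ a, x ⬝ᵥ (M a *ᵥ x) ≤ t * (x ⬝ᵥ x)} ≤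
      Fintype.card ι * Real.exp (-(θ * t) + θ ^ 2 * m * v) := by
  classical
  have hn : (0 : ℝ) < n := by exact_mod_cast NeZero.pos n
  have hcard : (Fintype.card (Fin n × Fin n) : ℝ) = (n : ℝ) ^ 2 := by simp [pow_two]
  set c : ℝ := ((n : ℝ) ^ 2)⁻¹ with hc
  have hc0 : 0 ≤ c := by positivity
  let Y : Fin n × Fin n → Matrix ι ι ℝ := fun a => M a - c • ∑ b, M b
  have hY : ∀ a, (Y a)ᵀ = Y a := fun a => by
    simp only [Y, Matrix.transpose_sub, Matrix.transpose_smul, Matrix.transpose_sum, hM]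
  have hYv : ∀ a x, Y a *ᵥ x = M a *ᵥ x - c • ∑ b, M b *ᵥ x := fun a x => by
    simp only [Y, Matrix.sub_mulVec, Matrix.smul_mulVec, Matrix.sum_mulVec]
  have hYq : ∀ a x, x ⬝ᵥ (Y a *ᵥ x) = x ⬝ᵥ (M a *ᵥ x) - c * ∑ b, x ⬝ᵥ (M b *ᵥ x) := fun a x => by
    rw [hYv, dotProduct_sub, dotProduct_smul, dotProduct_sum, smul_eq_mul]
  have hmeanabs : ∀ x, |c * ∑ b, x ⬝ᵥ (M b *ᵥ x)| ≤ R * (x ⬝ᵥ x) := by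
    intro x
    rw [abs_mul, abs_of_nonneg hc0]
    have h1 := (Finset.abs_sum_le_sum_abs (fun b => x ⬝ᵥ (M b *ᵥ x)) Finset.univ).trans
      (Finset.sum_le_sum fun b _ => hR b x)
    rw [Finset.sum_const, Finset.card_univ, nsmul_eq_mul, hcard] at h1
    refine (mul_le_mul_of_nonneg_left h1 hc0).trans_eq ?_
    rw [hc]; field_simp
  -- Centring at most doubles the uniform bound, hence `2 * R`, and does not increase the second
  -- moment.
  have hbern := card_bernstein_le hY (R := 2 * R) (v := v) (θ := θ) (t := t) hθ (by linarith)
    (fun a x => by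
      rw [hYq]
      linarith [(abs_le.mp (hR a x)).2, (abs_le.mp (hmeanabs x)).1])
    (fun a x => by
      rw [hYq]
      linarith [(abs_le.mp (hR a x)).1, (abs_le.mp (hmeanabs x)).2])
    (fun x => by
      simp only [hYq, Finset.sum_sub_distrib, Finset.sum_const, Finset.card_univ, nsmul_eq_mul]
      rw [hcard, hc]; field_simp; ring)
    (fun x => by
      rw [hcard]
      refine le_trans ?_ (hvar x)
      simp only [dotProduct]
      rw [Finset.sum_comm, Finset.sum_comm (f := fun a i => (M a *ᵥ x) i * (M a *ᵥ x) i)]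
      refine Finset.sum_le_sum fun i _ => ?_
      have := sum_sub_mean_sq_le fun a => (M a *ᵥ x) i
      rw [hcard, ← hc] at this
      simp only [← pow_two]
      refine le_trans (le_of_eq ?_) this
      refine Finset.sum_congr rfl fun a _ => ?_
      rw [hYv, Pi.sub_apply, Pi.smul_apply, Finset.sum_apply, smul_eq_mul]) m
  rw [samplingLaw_real_eq, div_le_iff₀ (by positivity)]
  have hNN : (Fintype.card (Fin n × Fin n) : ℝ) = (n : ℝ) * n := by simp
  rw [hNN] at hbern
  refine le_trans (le_of_eq ?_) hbern
  congr 2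
  ext ω
  simp only [Set.mem_ofPred_eq, Finset.mem_filter, Finset.mem_univ, true_and]
  refine not_congr (forall_congr' fun x => ?_)
  rw [Matrix.sum_mulVec, dotProduct_sum]
  simp only [hYq, Finset.sum_sub_distrib, Finset.sum_const, Finset.card_univ, Fintype.card_fin,
    nsmul_eq_mul]
  rw [hc, ← mul_assoc, div_eq_mul_inv]

end Law

/-! ### Near isometry on the tangent space of an incoherent matrix -/

section Isometry

theorem sum_apply_sample {ω : Fin m → Fin n × Fin n} (f : Fin n × Fin n → ℝ) :
    ∑ k, f (ω k) = ∑ i, ∑ j, (sampleCount ω i j : ℝ) * f (i, j) := by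
  classical
  have h : ∀ k, f (ω k) = ∑ a : Fin n × Fin n, if ω k = a then f a else 0 := fun k => by simp
  simp_rw [h]
  rw [Finset.sum_comm, Fintype.sum_prod_type]
  refine Finset.sum_congr rfl fun i _ => Finset.sum_congr rfl fun j _ => ?_
  rw [← Finset.sum_filter, Finset.sum_const, nsmul_eq_mul, sampleCount]

theorem frobInner_single (Z : Matrix (Fin n) (Fin n) ℝ) (i j : Fin n) :
    frobInner Z (Matrix.single i j 1) = Z i j := by
  simp [frobInner, Matrix.single_apply, ite_and, Finset.sum_ite_eq]

variable {U V : Matrix (Fin n) (Fin r) ℝ}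

/-- The coordinates of the projections of the matrix units to the tangent space. -/
def tangentFrame (U V : Matrix (Fin n) (Fin r) ℝ) (a : Fin n × Fin n) : Fin n × Fin n → ℝ :=
  fun b => tangentProj U V (Matrix.single a.1 a.2 1) b.1 b.2

theorem dotProduct_tangentFrame (hU : Uᵀ * U = 1) (hV : Vᵀ * V = 1) (a : Fin n × Fin n)
    (x : Fin n × Fin n → ℝ) : x ⬝ᵥ tangentFrame U V a =
      tangentProj U V (Matrix.of fun i j => x (i, j)) a.1 a.2 := by
  rw [← frobInner_single (tangentProj U V _) a.1 a.2, frobInner_tangentProj hU hV, frobInner,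
    dotProduct, Fintype.sum_prod_type]
  rfl

/-- Parseval: by self-adjointness the sum is the squared norm of the projection of `x`. -/
theorem sum_dotProduct_tangentFrame_sq (hU : Uᵀ * U = 1) (hV : Vᵀ * V = 1)
    (x : Fin n × Fin n → ℝ) : ∑ a, (x ⬝ᵥ tangentFrame U V a) ^ 2 ≤ x ⬝ᵥ x := by
  simp_rw [dotProduct_tangentFrame hU hV]
  have h := pow_le_pow_left₀ (frobNorm_nonneg _)
    (frobNorm_tangentProj_le hU hV (Matrix.of fun i j => x (i, j))) 2
  rw [frobNorm_sq, frobNorm_sq] at h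
  rw [Fintype.sum_prod_type, dotProduct, Fintype.sum_prod_type]
  simpa only [frobInner, pow_two, Matrix.of_apply] using h

/-- For a projection the squared norm of the image of a matrix unit is its own diagonal coefficient,
here `A i i + B j j - A i i * B j j`. This is where incoherence enters. -/
theorem tangentFrame_dotProduct_self_le (hU : Uᵀ * U = 1) (hV : Vᵀ * V = 1) {ρ : ℝ}
    (hUρ : ∀ i, (U * Uᵀ) i i ≤ ρ) (hVρ : ∀ j, (V * Vᵀ) j j ≤ ρ) (a : Fin n × Fin n) :
    tangentFrame U V a ⬝ᵥ tangentFrame U V a ≤ 2 * ρ := by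
  have e : (Matrix.of fun i j => tangentFrame U V a (i, j)) =
      tangentProj U V (Matrix.single a.1 a.2 1) := rfl
  rw [dotProduct_tangentFrame hU hV, e, tangentProj_idem hU hV]
  have hdiag : ∀ (W : Matrix (Fin n) (Fin r) ℝ) i, 0 ≤ (W * Wᵀ) i i := fun W i => by
    rw [Matrix.mul_apply]
    exact Finset.sum_nonneg fun _ _ => mul_self_nonneg _
  have h1 : tangentProj U V (Matrix.single a.1 a.2 1) a.1 a.2 =
      (U * Uᵀ) a.1 a.1 + (V * Vᵀ) a.2 a.2 - (U * Uᵀ) a.1 a.1 * (V * Vᵀ) a.2 a.2 := by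
    unfold tangentProj
    generalize (U * Uᵀ : Matrix (Fin n) (Fin n) ℝ) = A
    generalize (V * Vᵀ : Matrix (Fin n) (Fin n) ℝ) = B
    have h2 : (A * Matrix.single a.1 a.2 (1 : ℝ) * B : Matrix (Fin n) (Fin n) ℝ) a.1 a.2 = A a.1 a.1 * B a.2 a.2 := by
      rw [Matrix.mul_apply, Finset.sum_eq_single a.2]
      · simp
      · intro k _ hk
        simp [Matrix.mul_apply, hk.symm]
      · simp
    rw [Matrix.sub_apply, Matrix.add_apply, h2]
    simp
  rw [h1]
  have := mul_nonneg (hdiag U a.1) (hdiag V a.2)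
  linarith [hUρ a.1, hVρ a.2]

/-- A tangential `Z` has entries `⟨Z, P_T e_a⟩`, so its sampling form is a sum of random rank-one
forms, to which Bernstein applies. The sign `sg` treats both tails at once. -/
theorem samplingLaw_real_not_near_isometry_le [NeZero n] (hU : Uᵀ * U = 1) (hV : Vᵀ * V = 1)
    {ρ : ℝ} (hρ : 0 < ρ) (hUρ : ∀ i, (U * Uᵀ) i i ≤ ρ) (hVρ : ∀ j, (V * Vᵀ) j j ≤ ρ) {δ : ℝ}
    (hδ0 : 0 ≤ δ) (hδ1 : δ ≤ 1) {sg : ℝ} (hsg : |sg| = 1) :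
    (samplingLaw n m).real {ω | ¬ ∀ Z ∈ tangentSpace U V,
      sg * (frobInner Z (sample ω Z) - (m : ℝ) / (n : ℝ) ^ 2 * frobInner Z Z) ≤
        δ * ((m : ℝ) / (n : ℝ) ^ 2) * frobNorm Z ^ 2} ≤
      (n : ℝ) ^ 2 * Real.exp (-(δ ^ 2 * ((m : ℝ) / (n : ℝ) ^ 2) / (8 * ρ))) := by
  have hn : (0 : ℝ) < n := by exact_mod_cast NeZero.pos n
  let M : Fin n × Fin n → Matrix (Fin n × Fin n) (Fin n × Fin n) ℝ := fun a =>
    sg • Matrix.vecMulVec (tangentFrame U V a) (tangentFrame U V a)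
  have hMv : ∀ a x, M a *ᵥ x = (sg * (x ⬝ᵥ tangentFrame U V a)) • tangentFrame U V a := by
    intro a x
    simp only [M, Matrix.smul_mulVec, Matrix.vecMulVec_mulVec, dotProduct_comm x, mul_smul]
    simp
  have hMq : ∀ a x, x ⬝ᵥ (M a *ᵥ x) = sg * (x ⬝ᵥ tangentFrame U V a) ^ 2 := fun a x => by
    rw [hMv, dotProduct_smul, smul_eq_mul]; ring
  have hsg2 : sg ^ 2 = 1 := by rw [← sq_abs, hsg, one_pow]
  have hframe := tangentFrame_dotProduct_self_le hU hV hUρ hVρ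
  have hcs : ∀ a x, (x ⬝ᵥ tangentFrame U V a) ^ 2 ≤ 2 * ρ * (x ⬝ᵥ x) := by
    intro a x
    have h1 := Finset.sum_mul_sq_le_sq_mul_sq Finset.univ x (tangentFrame U V a)
    have h2 : ∀ y : Fin n × Fin n → ℝ, ∑ i, y i ^ 2 = y ⬝ᵥ y := fun y => by
      simp only [dotProduct, pow_two]
    rw [h2, h2] at h1
    have h3 : 0 ≤ x ⬝ᵥ x := Finset.sum_nonneg fun _ _ => mul_self_nonneg _
    have := mul_le_mul_of_nonneg_left (hframe a) h3
    exact h1.trans (by linarith)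
  have hb := samplingLaw_real_bernstein_le (m := m) (M := M)
    (fun a => by simp only [M, Matrix.transpose_smul, Matrix.transpose_vecMulVec])
    -- This `θ` minimises the exponent `-θ t + θ² m v`; the condition `2 θ R ≤ 1` then reads `δ ≤
    -- 1`.
    (R := 2 * ρ) (v := 2 * ρ / (n : ℝ) ^ 2) (θ := δ / (4 * ρ))
    (t := δ * ((m : ℝ) / (n : ℝ) ^ 2)) (by positivity)
    (by rw [show 2 * (δ / (4 * ρ)) * (2 * ρ) = δ by field_simp; ring]; exact hδ1)
    (fun a x => by
      rw [hMq, abs_mul, hsg, one_mul, abs_of_nonneg (sq_nonneg _)]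
      exact hcs a x)
    (fun x => by
      have h1 : ∀ a, (M a *ᵥ x) ⬝ᵥ (M a *ᵥ x) ≤ 2 * ρ * (x ⬝ᵥ tangentFrame U V a) ^ 2 := by
        intro a
        rw [hMv, dotProduct_smul, smul_dotProduct, smul_eq_mul, smul_eq_mul]
        have := mul_le_mul_of_nonneg_left (hframe a)
          (sq_nonneg (sg * (x ⬝ᵥ tangentFrame U V a)))
        refine le_trans (le_of_eq ?_) (this.trans_eq ?_)
        · ring
        · rw [mul_pow, hsg2]; ring
      refine (Finset.sum_le_sum fun a _ => h1 a).trans ?_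
      rw [← Finset.mul_sum, mul_div_cancel₀ _ (by positivity)]
      exact mul_le_mul_of_nonneg_left (sum_dotProduct_tangentFrame_sq hU hV x) (by positivity))
  have hexp : -(δ / (4 * ρ) * (δ * ((m : ℝ) / (n : ℝ) ^ 2))) +
      (δ / (4 * ρ)) ^ 2 * m * (2 * ρ / (n : ℝ) ^ 2) =
      -(δ ^ 2 * ((m : ℝ) / (n : ℝ) ^ 2) / (8 * ρ)) := by
    field_simp; ring
  rw [hexp] at hb
  have hcard : (Fintype.card (Fin n × Fin n) : ℝ) = (n : ℝ) ^ 2 := by simp [pow_two]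
  rw [hcard] at hb
  refine (measureReal_mono ?_).trans hb
  intro ω hω hgood
  refine hω fun Z hZ => ?_
  have h := hgood fun a => Z a.1 a.2
  have e1 : ∀ a : Fin n × Fin n, (fun a : Fin n × Fin n => Z a.1 a.2) ⬝ᵥ tangentFrame U V a =
      Z a.1 a.2 := fun a => by
    rw [dotProduct_tangentFrame hU hV]
    exact congrFun (congrFun (mem_tangentSpace.mp hZ) a.1) a.2
  have e2 : (fun a : Fin n × Fin n => Z a.1 a.2) ⬝ᵥ (fun a : Fin n × Fin n => Z a.1 a.2) =
      frobInner Z Z := by rw [dotProduct, Fintype.sum_prod_type]; rfl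
  have e3 : ∑ a : Fin n × Fin n, Z a.1 a.2 ^ 2 = frobInner Z Z := by
    rw [Fintype.sum_prod_type]; simp only [frobInner, pow_two]
  have e4 : ∑ k, Z (ω k).1 (ω k).2 ^ 2 = frobInner Z (sample ω Z) := by
    rw [sum_apply_sample (ω := ω) fun a => Z a.1 a.2 ^ 2, frobInner]
    refine Finset.sum_congr rfl fun i _ => Finset.sum_congr rfl fun j _ => ?_
    simp only [sample, Matrix.of_apply, sampleCount]; ring
  simp only [hMq, e1] at h
  rw [← Finset.mul_sum, ← Finset.mul_sum, e2, e3, e4] at h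
  rw [frobNorm_sq]
  linarith

end Isometry

/-! ### Spectral concentration of the sampled matrix -/

section Spectral

/-- The symmetric dilation of `c` times a matrix unit. -/
def dilatedUnit (c : ℝ) (a : Fin n × Fin n) : Matrix (Fin n ⊕ Fin n) (Fin n ⊕ Fin n) ℝ :=
  Matrix.fromBlocks 0 (Matrix.single a.1 a.2 c) (Matrix.single a.2 a.1 c) 0

theorem dilatedUnit_mulVec (c : ℝ) (a : Fin n × Fin n) (x : Fin n ⊕ Fin n → ℝ) :
    dilatedUnit c a *ᵥ x = Sum.elim (Pi.single a.1 (c * x (Sum.inr a.2)))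
      (Pi.single a.2 (c * x (Sum.inl a.1))) := by
  rw [dilatedUnit, Matrix.fromBlocks_mulVec]
  simp only [Matrix.zero_mulVec, zero_add, add_zero, Matrix.single_mulVec]
  rfl

/-- Dilation makes the sampled entries symmetric matrices. Each row or column index occurs in `n` of
the `n²` positions, which gives the variance `ξ² / n`. -/
theorem samplingLaw_real_not_spectral_le [NeZero n] {X : Matrix (Fin n) (Fin n) ℝ} {ξ θ t : ℝ}
    (hX : ∀ i j, |X i j| ≤ ξ) (hθ : 0 ≤ θ) (hθξ : 2 * θ * ξ ≤ 1) :
    (samplingLaw n m).real {ω | ¬ ∀ u v : Fin n → ℝ,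
      2 * (u ⬝ᵥ ((sample ω X - ((m : ℝ) / (n : ℝ) ^ 2) • X) *ᵥ v)) ≤ t * (u ⬝ᵥ u + v ⬝ᵥ v)} ≤
      2 * n * Real.exp (-(θ * t) + θ ^ 2 * m * (ξ ^ 2 / n)) := by
  have hn : (0 : ℝ) < n := by exact_mod_cast NeZero.pos n
  have hξ : 0 ≤ ξ := (abs_nonneg _).trans (hX (Fin.ofNat n 0) (Fin.ofNat n 0))
  let M : Fin n × Fin n → Matrix (Fin n ⊕ Fin n) (Fin n ⊕ Fin n) ℝ := fun a =>
    dilatedUnit (X a.1 a.2) a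
  have hMq : ∀ a x, x ⬝ᵥ (M a *ᵥ x) = 2 * (X a.1 a.2 * (x (Sum.inl a.1) * x (Sum.inr a.2))) := by
    intro a x
    simp only [M, dilatedUnit_mulVec, dotProduct, Fintype.sum_sum_type, Sum.elim_inl, Sum.elim_inr]
    simp only [Pi.single_apply, mul_ite, mul_zero, Finset.sum_ite_eq', Finset.mem_univ, if_true]
    ring
  have hMn : ∀ a x, (M a *ᵥ x) ⬝ᵥ (M a *ᵥ x) =
      X a.1 a.2 ^ 2 * (x (Sum.inl a.1) ^ 2 + x (Sum.inr a.2) ^ 2) := by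
    intro a x
    simp only [M, dilatedUnit_mulVec, dotProduct, Fintype.sum_sum_type, Sum.elim_inl, Sum.elim_inr]
    simp only [Pi.single_apply, mul_ite, mul_zero, Finset.sum_ite_eq', Finset.mem_univ, if_true]
    ring
  have hxx : ∀ x : Fin n ⊕ Fin n → ℝ,
      x ⬝ᵥ x = ∑ i, x (Sum.inl i) ^ 2 + ∑ j, x (Sum.inr j) ^ 2 := fun x => by
    simp only [dotProduct, Fintype.sum_sum_type, pow_two]
  have hb := samplingLaw_real_bernstein_le (m := m) (M := M)
    (fun a => by
      simp only [M, dilatedUnit, Matrix.fromBlocks_transpose, Matrix.transpose_zero,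
        Matrix.transpose_single])
    (R := ξ) (v := ξ ^ 2 / n) (θ := θ) (t := t) hθ hθξ
    (fun a x => by
      rw [hMq, hxx]
      have h1 := Finset.single_le_sum (f := fun i => x (Sum.inl i) ^ 2)
        (fun i _ => sq_nonneg _) (Finset.mem_univ a.1)
      have h2 := Finset.single_le_sum (f := fun i => x (Sum.inr i) ^ 2)
        (fun i _ => sq_nonneg _) (Finset.mem_univ a.2)
      have h3 : |2 * (x (Sum.inl a.1) * x (Sum.inr a.2))| ≤
          x (Sum.inl a.1) ^ 2 + x (Sum.inr a.2) ^ 2 := by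
        rw [abs_le]
        constructor
        · nlinarith [sq_nonneg (x (Sum.inl a.1) + x (Sum.inr a.2))]
        · nlinarith [sq_nonneg (x (Sum.inl a.1) - x (Sum.inr a.2))]
      rw [mul_left_comm, abs_mul]
      refine (mul_le_mul (hX _ _) h3 (abs_nonneg _) hξ).trans ?_
      exact mul_le_mul_of_nonneg_left (add_le_add h1 h2) hξ)
    (fun x => by
      have h1 : ∀ a, (M a *ᵥ x) ⬝ᵥ (M a *ᵥ x) ≤
          ξ ^ 2 * (x (Sum.inl a.1) ^ 2 + x (Sum.inr a.2) ^ 2) := by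
        intro a
        rw [hMn]
        refine mul_le_mul_of_nonneg_right ?_ (by positivity)
        rw [← sq_abs]
        exact pow_le_pow_left₀ (abs_nonneg _) (hX _ _) 2
      refine (Finset.sum_le_sum fun a _ => h1 a).trans_eq ?_
      rw [← Finset.mul_sum, hxx, Fintype.sum_prod_type]
      simp only [Finset.sum_add_distrib, Finset.sum_const, Finset.card_univ, Fintype.card_fin,
        nsmul_eq_mul]
      rw [← Finset.mul_sum]
      field_simp)
  have hcard : (Fintype.card (Fin n ⊕ Fin n) : ℝ) = 2 * n := by
    simp only [Fintype.card_sum, Fintype.card_fin]; push_cast; ring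
  rw [hcard] at hb
  refine (measureReal_mono ?_).trans hb
  intro ω hω hgood
  refine hω fun u v => ?_
  have h := hgood (Sum.elim u v)
  simp only [hMq, Sum.elim_inl, Sum.elim_inr] at h
  have e1 : Sum.elim u v ⬝ᵥ Sum.elim u v = u ⬝ᵥ u + v ⬝ᵥ v := by
    simp only [dotProduct, Fintype.sum_sum_type, Sum.elim_inl, Sum.elim_inr]
  rw [e1, sum_apply_sample (ω := ω) fun a => 2 * (X a.1 a.2 * (u a.1 * v a.2)),
    Fintype.sum_prod_type] at h
  refine le_trans (le_of_eq ?_) h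
  rw [Finset.mul_sum, ← Finset.sum_sub_distrib, dotProduct, Finset.mul_sum]
  refine Finset.sum_congr rfl fun i _ => ?_
  rw [Finset.mul_sum, ← Finset.sum_sub_distrib, Matrix.mulVec, dotProduct, Finset.mul_sum,
    Finset.mul_sum]
  refine Finset.sum_congr rfl fun j _ => ?_
  simp only [Matrix.sub_apply, Matrix.smul_apply, sample, Matrix.of_apply, sampleCount, smul_eq_mul]
  ring

end Spectral

end MatrixCompletion

namespace MatrixCompletion

variable {n m r : ℕ}

/-! ### The measured matrix -/

section Measured

variable {X : Matrix (Fin n) (Fin n) ℝ} {U V : Matrix (Fin n) (Fin r) ℝ} {σ : Fin r → ℝ}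
  {μ₀ μ₁ : ℝ}

/-- The diagonal entry of a projection is the squared length of its column. The bound is left as `√q
^ 2` because the sign of `q` is not yet known. -/
theorem IsOrthProj.diag_le_of_norm_le {P : Matrix (Fin n) (Fin n) ℝ} (hP : IsOrthProj P) {q : ℝ}
    {i : Fin n} (h : ‖WithLp.toLp 2 (P *ᵥ Pi.single i (1 : ℝ))‖ ≤ √q) : P i i ≤ √q ^ 2 := by
  have h1 := pow_le_pow_left₀ (norm_nonneg _) h 2
  rw [EuclideanSpace.real_norm_sq_eq] at h1
  refine le_trans (le_of_eq ?_) h1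
  nth_rewrite 1 [← hP.idem]
  rw [Matrix.mul_apply]
  refine Finset.sum_congr rfl fun j _ => ?_
  rw [Matrix.mulVec_single_one]
  change P i j * P j i = P j i ^ 2
  rw [pow_two, ← congrFun (congrFun hP.symm i) j, Matrix.transpose_apply]

/-- The diagonal of the projection sums to its rank `r`, while each entry is at most `μ₀ r / n`. -/
theorem IsMeasuredMatrix.one_le_incoherence (h : IsMeasuredMatrix X U σ V μ₀ μ₁) (hr : 1 ≤ r)
    (hn : 0 < n) : 1 ≤ μ₀ := by
  have hU := isOrthProj_mul_transpose h.svd.left_orthonormal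
  have hr' : (0 : ℝ) < r := by exact_mod_cast hr
  have hn' : (0 : ℝ) < n := by exact_mod_cast hn
  have htr : ∑ i, (U * Uᵀ) i i = r := by
    have : (U * Uᵀ).trace = r := by
      rw [Matrix.trace_mul_comm, h.svd.left_orthonormal, Matrix.trace_one, Fintype.card_fin]
    exact this
  have h1 := Finset.sum_le_sum fun i (_ : i ∈ Finset.univ) =>
    hU.diag_le_of_norm_le (h.incoherent_left i)
  rw [htr, Finset.sum_const, Finset.card_univ, Fintype.card_fin, nsmul_eq_mul] at h1
  rcases le_or_gt 0 (μ₀ * r / n) with hq | hq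
  · rw [Real.sq_sqrt hq, mul_div_cancel₀ _ hn'.ne'] at h1
    nlinarith
  · rw [Real.sqrt_eq_zero_of_nonpos hq.le] at h1
    simp only [ne_eq, OfNat.ofNat_ne_zero, not_false_eq_true, zero_pow, mul_zero] at h1
    linarith

theorem sigmaMin_le (σ : Fin r → ℝ) (i : Fin r) : sigmaMin σ ≤ σ i :=
  ciInf_le (Set.finite_range σ).bddBelow i

theorem le_sigmaMax (σ : Fin r → ℝ) (i : Fin r) : σ i ≤ sigmaMax σ :=
  le_ciSup (Set.finite_range σ).bddAbove i

theorem sigmaMin_pos (hσ : ∀ i, 0 < σ i) (hr : 1 ≤ r) : 0 < sigmaMin σ := by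
  have : Nonempty (Fin r) := ⟨⟨0, hr⟩⟩
  obtain ⟨i, hi⟩ := exists_eq_ciInf_of_finite (f := σ)
  rw [sigmaMin, ← hi]
  exact hσ i

theorem one_le_condNumber (hσ : ∀ i, 0 < σ i) (hr : 1 ≤ r) : 1 ≤ condNumber σ := by
  rw [condNumber, one_le_div (sigmaMin_pos hσ hr)]
  exact (sigmaMin_le σ ⟨0, hr⟩).trans (le_sigmaMax σ ⟨0, hr⟩)

theorem IsMeasuredMatrix.spikiness_pos (h : IsMeasuredMatrix X U σ V μ₀ μ₁) (hr : 1 ≤ r) :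
    0 < μ₁ * √(r / (n : ℝ) ^ 2) * sigmaMax σ := by
  by_contra hle
  rw [not_lt] at hle
  have hX : X = 0 := by
    ext i j
    exact abs_nonpos_iff.mp ((h.not_spiky i j).trans hle)
  have h1 : Matrix.diagonal σ = 0 := by
    have e : Uᵀ * X * V = Matrix.diagonal σ := by
      rw [h.svd.eq]
      calc _ = (Uᵀ * U) * Matrix.diagonal σ * (Vᵀ * V) := by simp only [Matrix.mul_assoc]
        _ = _ := by
          rw [h.svd.left_orthonormal, h.svd.right_orthonormal, Matrix.one_mul, Matrix.mul_one]
    rw [← e, hX, Matrix.mul_zero, Matrix.zero_mul]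
  have h2 := congrFun (congrFun h1 ⟨0, hr⟩) ⟨0, hr⟩
  rw [Matrix.diagonal_apply_eq] at h2
  exact (h.pos ⟨0, hr⟩).ne' h2

end Measured

/-! ### Good samples are likely -/

section Probability

variable {X : Matrix (Fin n) (Fin n) ℝ} {U V : Matrix (Fin n) (Fin r) ℝ} {σ : Fin r → ℝ}
  {μ₀ μ₁ : ℝ}

/-- From spectral concentration of the sampled matrix to a good initial guess. -/
theorem frobNorm_init_sub_le {ω : Fin m → Fin n × Fin n} {X₀ : Matrix (Fin n) (Fin n) ℝ}
    (hX : IsThinSVD X U σ V) (hr : r ≤ n) {p t : ℝ} (hp : (m : ℝ) / (n : ℝ) ^ 2 = p) (hp0 : 0 < p)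
    (ht : 0 < t) (h : ∀ u v : Fin n → ℝ, 2 * (u ⬝ᵥ ((sample ω X - p • X) *ᵥ v)) ≤
      t * (u ⬝ᵥ u + v ⬝ᵥ v)) (hX₀ : IsOneStepInit r ω X X₀) :
    frobNorm (X₀ - X) ≤ 4 * √r * (p⁻¹ * t) := by
  rw [IsOneStepInit, hp] at hX₀
  refine hX₀.frobNorm_sub_le_of_spectral hX hr (by positivity) fun u v => ?_
  have e : p⁻¹ • sample ω X - X = p⁻¹ • (sample ω X - p • X) := by
    rw [smul_sub, smul_smul, inv_mul_cancel₀ hp0.ne', one_smul]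
  rw [e, Matrix.smul_mulVec, dotProduct_smul, smul_eq_mul]
  have := mul_le_mul_of_nonneg_left (h u v) (inv_pos.mpr hp0).le
  linarith

theorem natCast_pow_mul_exp_eq_rpow (hn : 0 < n) (k : ℕ) (b : ℝ) :
    (n : ℝ) ^ k * Real.exp (-(b * Real.log n)) = (n : ℝ) ^ ((k : ℝ) - b) := by
  have hn' : (0 : ℝ) < n := by exact_mod_cast hn
  rw [Real.rpow_sub hn', Real.rpow_natCast, Real.exp_neg, mul_comm b, ← Real.rpow_def_of_pos hn',
    div_eq_mul_inv]

/-- A union bound over four events: large multiplicities and the two tails of near isometry cost `n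
^ (2 - 2β)` each, the spectral bound `2 n ^ (1 - β)`. The multiplicity bound `2 β log n + 2` is
chosen so that the Chernoff estimate gives exactly the first of these. -/
theorem samplingLaw_real_isGoodSample_ge (hX : IsMeasuredMatrix X U σ V μ₀ μ₁) (hr : 1 ≤ r)
    (hn : 3 ≤ n) (hm : m ≤ n ^ 2) {ε β : ℝ} (hε : 0 < ε) (hε1 : ε ≤ 1) (hβ : 1 < β)
    (hm₀ : 10000 * β * (μ₀ / ε ^ 2) * n * r * Real.log n ≤ m)
    (hm₁ : 10000 * β * (μ₁ / ε) * condNumber σ * (n * √n) * r * Real.log n ≤ m) :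
    1 - 3 * (n : ℝ) ^ (2 - 2 * β) - 2 * (n : ℝ) ^ (1 - β) ≤
      (samplingLaw n m).real {ω | IsGoodSample ω X U V ((m : ℝ) / (n : ℝ) ^ 2) (ε / 20)
        (sigmaMin σ) (2 * β * Real.log n + 2)} := by
  have : NeZero n := ⟨by omega⟩
  have hn0 : 0 < n := by omega
  have hn' : (0 : ℝ) < n := by exact_mod_cast hn0
  have hr' : (1 : ℝ) ≤ r := by exact_mod_cast hr
  have hlog : 1 ≤ Real.log n := by
    rw [Real.le_log_iff_exp_le hn']
    have h3 : (3 : ℝ) ≤ n := by exact_mod_cast hn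
    linarith [Real.exp_one_lt_three]
  have hμ₀ := hX.one_le_incoherence hr hn0
  have hrn : r ≤ n := by
    have h1 := Matrix.rank_one (R := ℝ) (n := Fin r)
    rw [← hX.svd.left_orthonormal, Fintype.card_fin] at h1
    have h2 := (Matrix.rank_mul_le_left Uᵀ U).trans (Matrix.rank_le_width Uᵀ)
    omega
  set q := β * Real.log n with hq
  have hq1 : 1 ≤ q := by nlinarith
  have hm4 : 10000 * (q * n) ≤ m := by
    have h1 : 1 ≤ μ₀ / ε ^ 2 := by
      rw [one_le_div (by positivity)]
      nlinarith
    have h2 : 1 ≤ μ₀ / ε ^ 2 * r := by nlinarith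
    have h3 := mul_le_mul_of_nonneg_left h2 (show 0 ≤ 10000 * (q * n) by positivity)
    refine le_trans (le_trans (by linarith) h3) (le_trans (le_of_eq ?_) hm₀)
    rw [hq]; ring
  have hm0 : (0 : ℝ) < m := lt_of_lt_of_le (by positivity) hm4
  set p := (m : ℝ) / (n : ℝ) ^ 2 with hp
  have hp0 : 0 < p := by positivity
  set σ₀ := sigmaMin σ with hσ₀
  have hσ₀pos : 0 < σ₀ := sigmaMin_pos hX.pos hr
  set ξ := μ₁ * √(r / (n : ℝ) ^ 2) * sigmaMax σ with hξ
  have hξ0 : 0 < ξ := hX.spikiness_pos hr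
  set ρ := μ₀ * r / n with hρ
  have hρ0 : 0 < ρ := by positivity
  have hdU : ∀ i, (U * Uᵀ) i i ≤ ρ := fun i => by
    have := (isOrthProj_mul_transpose hX.svd.left_orthonormal).diag_le_of_norm_le
      (hX.incoherent_left i)
    rwa [Real.sq_sqrt hρ0.le] at this
  have hdV : ∀ i, (V * Vᵀ) i i ≤ ρ := fun i => by
    have := (isOrthProj_mul_transpose hX.svd.right_orthonormal).diag_le_of_norm_le
      (hX.incoherent_right i)
    rwa [Real.sq_sqrt hρ0.le] at this
  have hsn : 0 < √(n : ℝ) := Real.sqrt_pos.mpr hn'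
  have hsm : 0 < √(m : ℝ) := Real.sqrt_pos.mpr hm0
  have hsq : 0 < √q := Real.sqrt_pos.mpr (by linarith)
  have hsr : 0 ≤ √(r : ℝ) := Real.sqrt_nonneg _
  have hsn2 : √(n : ℝ) ^ 2 = n := Real.sq_sqrt hn'.le
  have hsm2 : √(m : ℝ) ^ 2 = m := Real.sq_sqrt hm0.le
  have hsq2 : √q ^ 2 = q := Real.sq_sqrt (by linarith)
  have hsr2 : √(r : ℝ) ^ 2 = r := Real.sq_sqrt (by linarith)
  -- With `θ` below, `θ t = 2q` and `θ² m ξ² / n = q`, so the Bernstein exponent is `-q = -β log n`.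
  set t := 2 * ξ * (√q * √m / √n) with ht
  have ht0 : 0 < t := by positivity
  set θ := √q * √n / √m / ξ with hθ
  -- the multiplicities
  have P1 := samplingLaw_real_exists_sampleCount_gt_le hm (2 * β * Real.log n + 2)
  have e1 : (n : ℝ) ^ 2 * Real.exp (2 - (2 * β * Real.log n + 2)) = (n : ℝ) ^ (2 - 2 * β) := by
    have := natCast_pow_mul_exp_eq_rpow hn0 2 (2 * β)
    push_cast at this
    rw [← this]
    congr 2; ring
  rw [e1] at P1
  -- the near isometry
  have P2 : ∀ sg : ℝ, |sg| = 1 → (samplingLaw n m).real {ω | ¬ ∀ Z ∈ tangentSpace U V,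
      sg * (frobInner Z (sample ω Z) - p * frobInner Z Z) ≤
        ε / 20 * p * frobNorm Z ^ 2} ≤ (n : ℝ) ^ (2 - 2 * β) := by
    intro sg hsg
    refine (samplingLaw_real_not_near_isometry_le hX.svd.left_orthonormal
      hX.svd.right_orthonormal hρ0 hdU hdV (δ := ε / 20) (by positivity) (by linarith) hsg).trans ?_
    have := natCast_pow_mul_exp_eq_rpow hn0 2 (2 * β)
    push_cast at this
    rw [← this]
    refine mul_le_mul_of_nonneg_left (Real.exp_le_exp.mpr (neg_le_neg ?_)) (by positivity)
    rw [le_div_iff₀ (by positivity), hρ, ← hp]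
    -- The sample size yields the factor `25` where the exponent requires only `16 = 2 * 8`.
    have h1 := mul_le_mul_of_nonneg_left hm₀ (show 0 ≤ ε ^ 2 / (400 * n ^ 2) by positivity)
    have h2 : ε ^ 2 / (400 * (n : ℝ) ^ 2) * (10000 * β * (μ₀ / ε ^ 2) * n * r * Real.log n) =
        25 * (β * Real.log n * (μ₀ * r / n)) := by
      field_simp; ring
    have h3 : ε ^ 2 / (400 * (n : ℝ) ^ 2) * m = (ε / 20) ^ 2 * p := by
      rw [hp]; field_simp; ring
    rw [h2, h3] at h1
    have h4 : 0 ≤ β * Real.log n * (μ₀ * r / n) := by positivity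
    linarith
  -- the spectral bound
  have P3 : (samplingLaw n m).real {ω | ¬ ∀ u v : Fin n → ℝ,
      2 * (u ⬝ᵥ ((sample ω X - p • X) *ᵥ v)) ≤ t * (u ⬝ᵥ u + v ⬝ᵥ v)} ≤
      2 * (n : ℝ) ^ (1 - β) := by
    have hθξ : 2 * θ * ξ ≤ 1 := by
      have h1 : 2 * θ * ξ = 2 * (√q * √n) / √m := by rw [hθ]; field_simp
      rw [h1, div_le_one hsm]
      refine le_of_sq_le_sq ?_ hsm.le
      rw [mul_pow, mul_pow, hsq2, hsn2, hsm2]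
      nlinarith
    refine (samplingLaw_real_not_spectral_le hX.not_spiky (by positivity) hθξ).trans_eq ?_
    have h2 : -(θ * t) + θ ^ 2 * m * (ξ ^ 2 / n) = -(β * Real.log n) := by
      have key : ∀ x y z N M : ℝ, 0 < x → 0 < y → x ^ 2 = N → y ^ 2 = M →
          -(z * x / y / ξ * (2 * ξ * (z * y / x))) + (z * x / y / ξ) ^ 2 * M * (ξ ^ 2 / N) =
            -z ^ 2 := by
        rintro x y z _ _ hx hy rfl rfl
        field_simp
        ring
      rw [← hq, ← hsq2, hθ, ht]
      exact key _ _ _ _ _ hsn hsm hsn2 hsm2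
    have := natCast_pow_mul_exp_eq_rpow hn0 1 β
    push_cast at this
    rw [h2, ← this]
    ring
  have hL0 : 0 ≤ 2 * β * Real.log n + 2 := by positivity
  have hsL : √(2 * β * Real.log n + 2) ≤ 2 * √q := by
    refine le_of_sq_le_sq ?_ (by positivity)
    rw [Real.sq_sqrt hL0, mul_pow, hsq2]
    linarith
  -- The left side scales like `1 / √m` and the right side like `√m / n`; comparing them produces
  -- the requirement `m ≳ β μ₁ κ n^(3/2) r log n / ε`.
  have hinit : 4 * √r * (p⁻¹ * t) * √(2 * β * Real.log n + 2) ≤ ε / 20 * σ₀ * √p := by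
    have hsp : √p = √m / n := by
      rw [hp, Real.sqrt_div hm0.le, Real.sqrt_sq hn'.le]
    have hξ' : ξ = μ₁ * (√r / n) * (condNumber σ * σ₀) := by
      rw [hξ, Real.sqrt_div (by linarith), Real.sqrt_sq hn'.le, condNumber, ← hσ₀,
        div_mul_cancel₀ _ hσ₀pos.ne']
    have h1 := mul_le_mul_of_nonneg_left hsL (show 0 ≤ 4 * √r * (p⁻¹ * t) by positivity)
    refine h1.trans ?_
    have h2 : 4 * √r * (p⁻¹ * t) * (2 * √q) =
        16 * (β * μ₁ * condNumber σ * (n * √n) * r * Real.log n) * (σ₀ / (n * √m)) := by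
      have key : ∀ x y z w N M k : ℝ, 0 < x → 0 < y → x ^ 2 = N → y ^ 2 = M →
          4 * w * ((M / N ^ 2)⁻¹ * (2 * (μ₁ * (w / N) * (k * σ₀)) * (z * y / x))) * (2 * z) =
            16 * (z ^ 2) * (w ^ 2) * (μ₁ * k * (N * x)) * (σ₀ / (N * y)) := by
        rintro x y z w _ _ k hx hy rfl rfl
        field_simp
        ring
      have h4 := key _ _ √q √r _ _ (condNumber σ) hsn hsm hsn2 hsm2
      rw [← hξ', ← ht, ← hp] at h4
      rw [h4, hsq2, hsr2, hq]; ring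
    rw [h2, hsp]
    have h5 : 10000 * (β * μ₁ * condNumber σ * (n * √n) * r * Real.log n) ≤ ε * m := by
      have := mul_le_mul_of_nonneg_left hm₁ hε.le
      refine le_trans (le_of_eq ?_) this
      field_simp
    have h6 : ε / 20 * σ₀ * (√m / n) = ε / 20 * m * (σ₀ / (n * √m)) := by
      have key : ∀ y M : ℝ, 0 < y → y ^ 2 = M → ε / 20 * σ₀ * (y / n) =
          ε / 20 * M * (σ₀ / (n * y)) := by
        rintro y _ hy rfl
        field_simp
      exact key _ _ hsm hsm2
    rw [h6]
    refine mul_le_mul_of_nonneg_right ?_ (by positivity)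
    have : 0 ≤ ε * m := by positivity
    linarith
  have hall := one_sub_le_samplingLaw_real (n := n) (m := m)
    (S := {ω | IsGoodSample ω X U V p (ε / 20) σ₀ (2 * β * Real.log n + 2)})
    (B₁ := {ω | ¬ ∀ i j, (sampleCount ω i j : ℝ) ≤ 2 * β * Real.log n + 2})
    (B₂ := {ω | ¬ ∀ Z ∈ tangentSpace U V,
      1 * (frobInner Z (sample ω Z) - p * frobInner Z Z) ≤ ε / 20 * p * frobNorm Z ^ 2})
    (B₃ := {ω | ¬ ∀ Z ∈ tangentSpace U V,
      -1 * (frobInner Z (sample ω Z) - p * frobInner Z Z) ≤ ε / 20 * p * frobNorm Z ^ 2})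
    (B₄ := {ω | ¬ ∀ u v : Fin n → ℝ,
      2 * (u ⬝ᵥ ((sample ω X - p • X) *ᵥ v)) ≤ t * (u ⬝ᵥ u + v ⬝ᵥ v)})
    (fun ω h1 h2 h3 h4 => by
      simp only [Set.mem_ofPred_eq, not_not] at h1 h2 h3 h4 ⊢
      refine ⟨h1, fun Z hZ => ?_, fun X₀ hX₀ => ?_⟩
      · rw [abs_le]
        constructor
        · linarith [h3 Z hZ]
        · linarith [h2 Z hZ]
      · exact (mul_le_mul_of_nonneg_right (frobNorm_init_sub_le hX.svd hrn hp.symm hp0 ht0 h4 hX₀)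
          (Real.sqrt_nonneg _)).trans hinit)
  have a1 := P2 1 (by simp)
  have a2 := P2 (-1) (by simp)
  linarith

end Probability

/-! ### Assembling the guarantee -/

section Guarantee

/-- Dropping the denominators, which lie below one, leaves a condition linear in `ε`; it is the only
consequence of the radius condition that is used. -/
theorem RCGRadius.sum_lt_one {κ₁ κ₂ ε : ℝ} (hκ₁ : 0 ≤ κ₁) (hκ₂ : 0 ≤ κ₂) (hε : 0 < ε)
    (h : RCGRadius κ₁ κ₂ ε) : 18 * ε + 12 * κ₂ * ε + 3 * κ₁ * κ₂ < 1 := by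
  obtain ⟨h1, h2⟩ := h
  have hd : 0 < 1 - 4 * ε := by nlinarith
  have e1 : 18 * ε ≤ (18 * ε - 10 * κ₁ * ε * (1 + 4 * ε)) / ((1 - 4 * ε) - κ₁ * (1 + 4 * ε)) := by
    rw [le_div_iff₀ h1]
    have : 0 ≤ κ₁ * ε * (1 + 4 * ε) := by positivity
    nlinarith
  have e2 : 12 * κ₂ * ε + 3 * κ₁ * κ₂ ≤ (4 * κ₂ * ε + κ₁ * κ₂) / (1 - 4 * ε) +
      (8 * κ₂ * ε + 2 * κ₁ * κ₂) / (1 - 4 * ε) := by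
    rw [← add_div, le_div_iff₀ hd]
    have : 0 ≤ (12 * κ₂ * ε + 3 * κ₁ * κ₂) * (4 * ε) := by positivity
    linarith
  rw [tau₁, tau₂] at h2
  linarith

/-- The sample size condition makes `n` at least three and implies the bounds that are used for the
near isometry and for the initial guess. -/
theorem sample_size_bounds {ε β μ₀ μ₁ κ : ℝ} (hε : 0 < ε) (hε1 : ε ≤ 1) (hβ : 1 < β)
    (hμ₀ : 1 ≤ μ₀) (hμ₁ : 0 ≤ μ₁) (hκ : 1 ≤ κ) (hr : 1 ≤ r) (hn : 2 ≤ n) (hm : m ≤ n ^ 2)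
    (h : 10000 * β ^ (3 / 2 : ℝ) * max (μ₀ / ε ^ 2) (μ₁ * (1 + ε) / ε) * κ *
      (n : ℝ) ^ (3 / 2 : ℝ) * r * Real.log n ^ (3 / 2 : ℝ) ≤ m) :
    3 ≤ n ∧ 10000 * β * (μ₀ / ε ^ 2) * n * r * Real.log n ≤ m ∧
      10000 * β * (μ₁ / ε) * κ * (n * √n) * r * Real.log n ≤ m := by
  have hn' : (2 : ℝ) ≤ n := by exact_mod_cast hn
  have hr' : (1 : ℝ) ≤ r := by exact_mod_cast hr
  have hsplit : ∀ x : ℝ, 0 < x → x ^ (3 / 2 : ℝ) = x * √x := fun x hx => by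
    rw [show (3 / 2 : ℝ) = 1 + 1 / 2 by norm_num, Real.rpow_add hx, Real.rpow_one,
      Real.sqrt_eq_rpow]
  have hlog0 : 1 / 2 < Real.log n := by
    have := Real.log_le_log (by norm_num) hn'
    linarith [Real.log_two_gt_d9]
  have hβ1 : β ≤ β ^ (3 / 2 : ℝ) := Real.self_le_rpow_of_one_le hβ.le (by norm_num)
  have hmax1 := le_max_left (μ₀ / ε ^ 2) (μ₁ * (1 + ε) / ε)
  have hmax2 : μ₁ / ε ≤ max (μ₀ / ε ^ 2) (μ₁ * (1 + ε) / ε) := by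
    refine le_trans ?_ (le_max_right _ _)
    gcongr
    nlinarith
  have hone : 1 ≤ μ₀ / ε ^ 2 := by
    rw [one_le_div (by positivity)]; nlinarith
  have hn3 : 3 ≤ n := by
    -- For `n = 2` the required sample size would be at least `2500`, while `m ≤ 4`.
    by_contra hlt
    have hn2 : n = 2 := by omega
    have hlog1 : (1 / 2 : ℝ) ^ (3 / 2 : ℝ) ≤ Real.log n ^ (3 / 2 : ℝ) :=
      Real.rpow_le_rpow (by norm_num) hlog0.le (by norm_num)
    have h2 : (1 / 4 : ℝ) ≤ (1 / 2 : ℝ) ^ (3 / 2 : ℝ) := by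
      have := Real.rpow_le_rpow_of_exponent_ge (x := (1 / 2 : ℝ)) (by norm_num) (by norm_num)
        (show (3 / 2 : ℝ) ≤ 2 by norm_num)
      refine le_trans (le_of_eq ?_) this
      norm_num
    have h3 : (1 : ℝ) ≤ (n : ℝ) ^ (3 / 2 : ℝ) := Real.one_le_rpow (by linarith) (by norm_num)
    have h4 : 10000 * 1 * 1 * 1 * 1 * 1 * (1 / 4 : ℝ) ≤ m := by
      refine le_trans ?_ h
      gcongr
      · linarith
      · linarith
      · linarith
    have h5 : (m : ℝ) ≤ 4 := by
      rw [hn2] at hm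
      exact_mod_cast hm
    linarith
  have hlog : 1 ≤ Real.log n := by
    rw [Real.le_log_iff_exp_le (by linarith)]
    have h3 : (3 : ℝ) ≤ n := by exact_mod_cast hn3
    linarith [Real.exp_one_lt_three]
  have hlog1 : Real.log n ≤ Real.log n ^ (3 / 2 : ℝ) :=
    Real.self_le_rpow_of_one_le hlog (by norm_num)
  have hnn : (n : ℝ) ≤ (n : ℝ) ^ (3 / 2 : ℝ) :=
    Real.self_le_rpow_of_one_le (by linarith) (by norm_num)
  refine ⟨hn3, le_trans ?_ h, le_trans ?_ h⟩
  · calc 10000 * β * (μ₀ / ε ^ 2) * n * r * Real.log n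
        = 10000 * β * (μ₀ / ε ^ 2) * 1 * n * r * Real.log n := by ring
      _ ≤ _ := by gcongr
  · rw [← hsplit n (by linarith)]
    gcongr

theorem samplingLaw_real_converges_ge {X : Matrix (Fin n) (Fin n) ℝ}
    {U V : Matrix (Fin n) (Fin r) ℝ} {σ : Fin r → ℝ} {μ₀ μ₁ : ℝ}
    (hX : IsMeasuredMatrix X U σ V μ₀ μ₁) (hr : 1 ≤ r) (hm : m ≤ n ^ 2) {ε β : ℝ} (hε : 0 < ε)
    (hε1 : 18 * ε < 1) (hβ : 1 < β)
    (h : 10000 * β ^ (3 / 2 : ℝ) * max (μ₀ / ε ^ 2) (μ₁ * (1 + ε) / ε) * condNumber σ *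
      (n : ℝ) ^ (3 / 2 : ℝ) * r * Real.log n ^ (3 / 2 : ℝ) ≤ m)
    {S : Set (Fin m → Fin n × Fin n)} (hS : ∀ (p c L : ℝ) ω, 0 < p → p ≤ L → 0 < L → 0 < c →
      (∀ i, c ≤ σ i) → IsGoodSample ω X U V p (ε / 20) c L → ω ∈ S) :
    1 - 3 * (n : ℝ) ^ (2 - 2 * β) - 2 * (n : ℝ) ^ (1 - β) ≤ (samplingLaw n m).real S := by
  rcases Nat.lt_or_ge n 2 with hn | hn
  -- For `n = 1` the claimed probability is negative; `n = 0` leaves no room for an orthonormal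
  -- column.
  · have h0 : (0 : ℝ) ≤ (samplingLaw n m).real S := measureReal_nonneg
    have hn1 : n = 1 := by
      rcases Nat.eq_zero_or_pos n with h0 | h0
      · subst h0
        have h1 := congrFun (congrFun hX.svd.left_orthonormal ⟨0, hr⟩) ⟨0, hr⟩
        simp [Matrix.mul_apply] at h1
      · omega
    subst hn1
    simp only [Nat.cast_one, Real.one_rpow]
    linarith
  have hμ₀ := hX.one_le_incoherence hr (by omega)
  have hμ₁ : 0 ≤ μ₁ := by
    have h1 := hX.spikiness_pos hr
    have h2 : 0 ≤ √((r : ℝ) / (n : ℝ) ^ 2) * sigmaMax σ :=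
      mul_nonneg (Real.sqrt_nonneg _) ((hX.pos ⟨0, hr⟩).le.trans (le_sigmaMax σ _))
    by_contra hneg
    nlinarith
  obtain ⟨hn3, hm₀, hm₁⟩ := sample_size_bounds hε (by linarith) hβ hμ₀ hμ₁
    (one_le_condNumber hX.pos hr) hr hn hm h
  have : NeZero n := ⟨by omega⟩
  have hn' : (0 : ℝ) < n := by positivity
  have hlog : 0 < Real.log n := Real.log_pos (by exact_mod_cast hn)
  have hr' : (0 : ℝ) < r := by exact_mod_cast hr
  have hm0 : (0 : ℝ) < m := lt_of_lt_of_le (by positivity) hm₀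
  have hL : 2 ≤ 2 * β * Real.log n + 2 := by
    have : 0 ≤ 2 * β * Real.log n := by positivity
    linarith
  have hp : (m : ℝ) / (n : ℝ) ^ 2 ≤ 1 := by
    rw [div_le_one (by positivity)]; exact_mod_cast hm
  refine (samplingLaw_real_isGoodSample_ge hX hr hn3 hm hε (by linarith) hβ hm₀ hm₁).trans
    (measureReal_mono fun ω hω => hS _ _ _ ω (by positivity) (by linarith) (by linarith)
      (sigmaMin_pos hX.pos hr) (sigmaMin_le σ) hω)

end Guarantee

end MatrixCompletion

/-! ### The recovery guarantee. -/

open MatrixCompletion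
theorem mainTheorem2 :
    ∃ C : ℝ, 0 < C ∧
      ∀ κ₁ κ₂ : ℝ, 0 ≤ κ₁ → 0 ≤ κ₂ → κ₁ * κ₂ < 1 / 3 →
      ∃ εcg : ℝ, 0 < εcg ∧
        ∀ ε₀ : ℝ, 0 < ε₀ →
        ∀ (n m r : ℕ), 1 ≤ r → m ≤ n ^ 2 →
        ∀ (X : Matrix (Fin n) (Fin n) ℝ) (U : Matrix (Fin n) (Fin r) ℝ) (σ : Fin r → ℝ)
          (V : Matrix (Fin n) (Fin r) ℝ) (μ₀ μ₁ : ℝ), IsMeasuredMatrix X U σ V μ₀ μ₁ →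
        ∀ β : ℝ, 1 < β →
          C * β ^ (3 / 2 : ℝ) * max (μ₀ / ε₀ ^ 2) (μ₁ * (1 + ε₀) / ε₀) * condNumber σ *
              (n : ℝ) ^ (3 / 2 : ℝ) * r * Real.log n ^ (3 / 2 : ℝ) ≤ m →
          (RGradRadius ε₀ →
            1 - 3 * (n : ℝ) ^ (2 - 2 * β) - 2 * (n : ℝ) ^ (1 - β) ≤
              (samplingLaw n m).real {ω | RGradConverges r X ω}) ∧
          (ε₀ ≤ εcg ∨ RCGRadius κ₁ κ₂ ε₀ →
            1 - 3 * (n : ℝ) ^ (2 - 2 * β) - 2 * (n : ℝ) ^ (1 - β) ≤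
              (samplingLaw n m).real {ω | RGradConverges r X ω ∧ RCGConverges κ₁ κ₂ r X ω}) := by
  refine ⟨10000, by norm_num, fun κ₁ κ₂ hκ₁ hκ₂ hκ => ?_⟩
  -- Half the largest radius with `18 ε + 12 κ₂ ε + 3 κ₁ κ₂ ≤ 1`, so the inequality is strict.
  refine ⟨(1 - 3 * (κ₁ * κ₂)) / (2 * (18 + 12 * κ₂)),
    div_pos (by linarith) (by positivity), ?_⟩
  intro ε₀ hε n m r hr hm X U σ V μ₀ μ₁ hX β hβ hsize
  constructor
  · rintro ⟨h1, h2⟩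
    rw [div_lt_one h1] at h2
    exact samplingLaw_real_converges_ge hX hr hm hε (by linarith) hβ hsize
      fun p c L ω hp hpL hL hc hσ hgood =>
        hgood.rgradConverges hX.svd hp hpL hL (by positivity) (by linarith) hc hσ
  · intro hrad
    -- With `a = ε₀ / 20` the recursion for conjugate gradients needs only `7.5 ε₀ + 3.75 κ₂ ε₀ + 3
    -- κ₁ κ₂ < 1`, so both alternatives suffice.
    have hsum : 18 * ε₀ + 12 * κ₂ * ε₀ + 3 * κ₁ * κ₂ < 1 := by
      rcases hrad with h1 | h1
      · rw [le_div_iff₀ (by positivity)] at h1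
        nlinarith
      · exact h1.sum_lt_one hκ₁ hκ₂ hε
    have h18 : 18 * ε₀ < 1 := by
      have : 0 ≤ 12 * κ₂ * ε₀ + 3 * κ₁ * κ₂ := by positivity
      linarith
    refine samplingLaw_real_converges_ge hX hr hm hε h18 hβ hsize
      fun p c L ω hp hpL hL hc hσ hgood =>
        ⟨hgood.rgradConverges hX.svd hp hpL hL (by positivity) (by linarith) hc hσ,
          hgood.rcgConverges hX.svd hp hpL hL (by positivity) (by linarith) hc hσ hκ₁ hκ₂ ?_⟩
    have : 0 ≤ κ₂ * ε₀ := by positivity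
    linarith
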